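/- A 4-coloured graph $(\Gamma,\gamma)$ is a finite loopless multigraph, regular of degree 4, with an edge-colouring $\gamma:E(\Gamma)\to\{0,1,2,3\}$ that is injective on adjacent edges. Let $K(\Gamma)$ be the pseudocomplex obtained from one 3-simplex for each vertex of $\Gamma$, with vertices labelled $0,1,2,3$, by identifying, for each edge of colour $c$ joining $v$ and $w$, the faces of the simplices of $v$ and $w$ opposite to their vertices labelled $c$, so that equally labelled vertices coincide. $(\Gamma,\gamma)$ is a (3-)gem of a closed connected PL 3-manifold $M$ if $|K(\Gamma)|$ is PL-homeomorphic to $M$. **Proposition.** Let $(\Gamma,\gamma)$ be a gem of a closed connected PL 3-manifold $M$, and let $e_0,e_1,e_2,e_3$ be edges of $\Gamma$ with $\gamma(e_i)=i$ for each $i$ such that $\Gamma\setminus\{e_0,e_1,e_2,e_3\}$ has exactly two connected components $\bar\Gamma^{(1)},\bar\Gamma^{(2)}$. For $i=1,2$ let $\Gamma^{(i)}$ be obtained from $\bar\Gamma^{(i)}$ (with its edge-colouring) by adding a new vertex $v_i$ and, for each colour $j\in\{0,1,2,3\}$, an edge of colour $j$ joining $v_i$ to the unique vertex of $\bar\Gamma^{(i)}$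 that is not incident with an edge of colour $j$ of $\bar\Gamma^{(i)}$. Then $\Gamma^{(1)}$ and $\Gamma^{(2)}$ are gems of closed connected PL 3-manifolds, and $M$ is a connected sum $|K(\Gamma^{(1)})|\,\#\,|K(\Gamma^{(2)})|$: if $\Gamma^{(i)}$ is a gem of $M_i$ ($i=1,2$), then there are PL 3-balls $B_i\subset M_i$ such that $M$ is PL-homeomorphic to the union of $M_1\setminus\operatorname{int}B_1$ and $M_2\setminus\operatorname{int}B_2$ glued along a PL homeomorphism $\partial B_1\to\partial B_2$. -/

import Mathlib

namespace Gem

/-! ## Piecewise-linear topology in finite-dimensional real vector spaces -/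

section PL

variable {E F E₁ E₂ : Type*}
  [NormedAddCommGroup E] [NormedSpace ℝ E] [NormedAddCommGroup F] [NormedSpace ℝ F]
  [NormedAddCommGroup E₁] [NormedSpace ℝ E₁] [NormedAddCommGroup E₂] [NormedSpace ℝ E₂]

/-- `f` is a piecewise-linear map on the compact polyhedron `X`: the set `X` is the union of
finitely many convex polytopes, on each of which `f` agrees with an affine map. -/
def IsPLOn (f : E → F) (X : Set E) : Prop :=
  ∃ P : Set (Finset E), P.Finite ∧ X = ⋃ s ∈ P, convexHull ℝ (s : Set E) ∧
    ∀ s ∈ P, ∃ A : E →ᵃ[ℝ] F, Set.EqOn f A (convexHull ℝ (s : Set E))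

/-- A compact polyhedron: a finite union of convex polytopes. -/
def IsCompactPolyhedron (X : Set E) : Prop :=
  ∃ P : Set (Finset E), P.Finite ∧ X = ⋃ s ∈ P, convexHull ℝ (s : Set E)

/-- A PL embedding of the compact polyhedron `X` in `Y`. Its inverse is automatically PL, so this
is a PL homeomorphism of `X` onto `f '' X`. -/
def IsPLEmbedding (f : E → F) (X : Set E) (Y : Set F) : Prop :=
  IsPLOn f X ∧ Set.InjOn f X ∧ Set.MapsTo f X Y

/-- A closed PL `d`-manifold: a compact polyhedron in which each point has a (polyhedral)
neighbourhood that is PL homeomorphic to a neighbourhood of a point of `ℝᵈ`, the two points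
corresponding to each other. -/
def IsClosedPLManifold (d : ℕ) (X : Set E) : Prop :=
  IsCompactPolyhedron X ∧
    ∀ x ∈ X, ∃ N ⊆ X, N ∈ nhdsWithin x X ∧
      ∃ f : E → EuclideanSpace ℝ (Fin d), IsPLOn f N ∧ Set.InjOn f N ∧ f '' N ∈ nhds (f x)

/-- The standard 3-simplex, with vertices labelled by the colours `0, 1, 2, 3`. -/
abbrev Simplex : Set (Fin 4 → ℝ) := stdSimplex ℝ (Fin 4)

/-- The interior of the standard 3-simplex. -/
def simplexInterior : Set (Fin 4 → ℝ) := {x | x ∈ Simplex ∧ ∀ i, 0 < x i}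

/-- The boundary of the standard 3-simplex. -/
def simplexBoundary : Set (Fin 4 → ℝ) := {x | x ∈ Simplex ∧ ∃ i, x i = 0}

/-- `M` is a connected sum of the closed 3-manifolds `M₁` and `M₂`: there are PL 3-balls
`b₁ '' Simplex` in `M₁` and `b₂ '' Simplex` in `M₂` such that `M` is obtained from the complements
of their interiors by gluing the boundary spheres through a PL homeomorphism. That is, the two
complements have PL embeddings `g₁`, `g₂` in `M` whose images cover `M` and meet exactly in the
common image of the two boundary spheres (so the gluing map is `g₂⁻¹ ∘ g₁`). -/
def IsConnectedSum (M : Set E) (M₁ : Set E₁) (M₂ : Set E₂) : Prop :=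
  ∃ (b₁ : (Fin 4 → ℝ) → E₁) (b₂ : (Fin 4 → ℝ) → E₂) (g₁ : E₁ → E) (g₂ : E₂ → E),
    IsPLEmbedding b₁ Simplex M₁ ∧ IsPLEmbedding b₂ Simplex M₂ ∧
    IsPLEmbedding g₁ (M₁ \ b₁ '' simplexInterior) M ∧
    IsPLEmbedding g₂ (M₂ \ b₂ '' simplexInterior) M ∧
    g₁ '' (M₁ \ b₁ '' simplexInterior) ∪ g₂ '' (M₂ \ b₂ '' simplexInterior) = M ∧
    g₁ '' (M₁ \ b₁ '' simplexInterior) ∩ g₂ '' (M₂ \ b₂ '' simplexInterior) =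
      g₁ '' (b₁ '' simplexBoundary) ∧
    g₁ '' (b₁ '' simplexBoundary) = g₂ '' (b₂ '' simplexBoundary)

end PL

/-! ## Edge-coloured graphs -/

section Graphs

variable {α β : Type*}

/-- `(G, γ)` is a 4-coloured graph: a finite loopless multigraph, regular of degree 4, with an
edge-colouring by `0, 1, 2, 3` that is injective on adjacent edges. (In the absence of loops the
degree of a vertex is the number of edges incident with it.) -/
structure IsColouredGraph (G : Graph α β) (γ : β → Fin 4) : Prop where
  finite : G.vertexSet.Finite
  loopless : G.Loopless
  regular : ∀ v ∈ G.vertexSet, (G.incidenceSet v).ncard = 4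
  injective : ∀ v ∈ G.vertexSet, Set.InjOn γ (G.incidenceSet v)

/-- `H` is a connected component of `G`. -/
def IsComponent (H G : Graph α β) : Prop :=
  ∃ v ∈ G.vertexSet, H = G.induce {w | Relation.ReflTransGen G.Adj v w}

/-- `v` is the only vertex of `H` that is not incident with an edge of colour `j`. -/
def IsBoundaryVertex (H : Graph α β) (γ : β → Fin 4) (j : Fin 4) (v : α) : Prop :=
  ∀ w, (w ∈ H.vertexSet ∧ ∀ e, H.Inc e w → γ e ≠ j) ↔ w = v

/-- The graph obtained from `H` by adding a new vertex `none` and, for each colour `j`, a new edge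
`Sum.inr j` joining `none` to the vertex of `H` missing the colour `j`. -/
def cap (H : Graph α β) (γ : β → Fin 4) : Graph (Option α) (β ⊕ Fin 4) where
  vertexSet := insert none (some '' H.vertexSet)
  IsLink f x y := Sum.elim
    (fun e => ∃ u w, H.IsLink e u w ∧ x = some u ∧ y = some w)
    (fun j => ∃ v, IsBoundaryVertex H γ j v ∧ (x = none ∧ y = some v ∨ x = some v ∧ y = none)) f
  isLink_symm := by
    rintro (e | j) -
    · refine ⟨?_⟩
      rintro x y ⟨u, w, h, hx, hy⟩
      exact ⟨w, u, h.symm, hy, hx⟩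
    · refine ⟨?_⟩
      rintro x y ⟨v, h, h' | h'⟩
      · exact ⟨v, h, Or.inr ⟨h'.2, h'.1⟩⟩
      · exact ⟨v, h, Or.inl ⟨h'.2, h'.1⟩⟩
  eq_or_eq_of_isLink_of_isLink := by
    rintro (e | j) x y z t h h'
    · obtain ⟨u, w, h, rfl, rfl⟩ := h
      obtain ⟨u', w', h', rfl, rfl⟩ := h'
      simpa using h.left_eq_or_eq h'
    · obtain ⟨v, hv, h⟩ := h
      obtain ⟨v', hv', h'⟩ := h'
      have : v = v' := (hv' v).1 ((hv v).2 rfl)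
      subst this
      rcases h with ⟨rfl, rfl⟩ | ⟨rfl, rfl⟩ <;> rcases h' with ⟨rfl, rfl⟩ | ⟨rfl, rfl⟩ <;> simp
  left_mem_of_isLink := by
    rintro (e | j) x y h
    · obtain ⟨u, w, h, rfl, rfl⟩ := h
      exact Or.inr ⟨u, h.left_mem, rfl⟩
    · obtain ⟨v, hv, ⟨rfl, -⟩ | ⟨rfl, -⟩⟩ := h
      · exact Or.inl rfl
      · exact Or.inr ⟨v, ((hv v).2 rfl).1, rfl⟩

/-- The colouring of the capped graph: old edges keep their colour, the new edge `Sum.inr j` has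
colour `j`. -/
def capColour (γ : β → Fin 4) : β ⊕ Fin 4 → Fin 4 := Sum.elim γ id

/-- The elementary identifications in the pseudocomplex of `(G, γ)`: whenever `v` and `w` are
joined by an edge of colour `c`, the faces of the simplices of `v` and `w` opposite to their
vertices labelled `c` are identified by the label-preserving affine map. -/
def GlueRel (G : Graph α β) (γ : β → Fin 4) (p q : Σ _ : G.vertexSet, Simplex) : Prop :=
  p.2 = q.2 ∧ ∃ e, G.IsLink e p.1 q.1 ∧ p.2.1 (γ e) = 0

/-- The space `|K(G, γ)|` of the coloured pseudocomplex of `(G, γ)`: the disjoint union of one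
3-simplex for each vertex, modulo the equivalence relation generated by the identifications
above, with the quotient topology. -/
abbrev Realization (G : Graph α β) (γ : β → Fin 4) : Type _ := Quot (GlueRel G γ)

/-- `(G, γ)` is a gem of the closed connected PL 3-manifold `M`: it is a 4-coloured graph and there
is a PL homeomorphism of `|K(G, γ)|` onto `M`, that is, a homeomorphism that is PL on each
simplex. -/
def IsGem (G : Graph α β) (γ : β → Fin 4) {n : ℕ} (M : Set (EuclideanSpace ℝ (Fin n))) : Prop :=
  IsColouredGraph G γ ∧ IsClosedPLManifold 3 M ∧ IsConnected M ∧
    ∃ h : Realization G γ ≃ₜ M,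
      ∀ v : G.vertexSet, ∃ f : (Fin 4 → ℝ) → EuclideanSpace ℝ (Fin n), IsPLOn f Simplex ∧
        ∀ x : Simplex, (h (Quot.mk _ ⟨v, x⟩) : EuclideanSpace ℝ (Fin n)) = f x

end Graphs

end Gem

namespace Gem

/-! ### Convex polytopes: half-spaces, affine preimages and left inverses. -/

section Polytopes

variable {E F E' : Type*}
  [NormedAddCommGroup E] [NormedSpace ℝ E] [NormedAddCommGroup F] [NormedSpace ℝ F]
  [NormedAddCommGroup E'] [NormedSpace ℝ E']

/-! Each colour `c` acts on the vertices as a fixed-point-free involution `σ c`. Points `x` and `y`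
of the simplices of `v` and `w` coincide in the complex exactly when `x = y` and `v`, `w` are joined
by edges whose colours `i` satisfy `x i = 0` (`SamePoint`). Everything is done in this language.

The connected sum rests on parity. Since `M` is connected, so is the graph, and one of the four
edges leaves the first component `A`. Its colour pairs off all but one vertex of `A`, so `A` has odd
size, no colour can pair off all of `A`, and each of the four edges crosses (`exists_isCut`).
Capping contracts the complement of `A` to a vertex `o`. The same parity shows that outside `A` the
ends of the cut edges of colours `i` and `j` are joined by edges of these two colours
(`IsCut.mem_of_closed`), so a path through `o` can be rerouted through the complement, and two
vertices of `A` are joined by the same sets of colours before and after capping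
(`IsCap.joined_iff`). Hence the simplices of `A` form the same polyhedron in `M` as in the capped
complex, where only the open simplex of `o` is missing. These simplices are the balls of the
connected sum, and their boundaries are glued by the identity (`IsCap.isConnectedSum`).

The harder claim is that the capped complex is a 3-manifold, that is, that its vertex links are
2-spheres. The route is cohomology with coefficients in `ℤ/2`. In a gem of a manifold the link of a
vertex has vanishing first cohomology, because a punctured ball in `ℝ³` does
(`cocyclesTrivial_ball`, `IsGemMap.isAcyclic_link`). This property survives capping: a cocycle on
the capped link pulls back along the contraction, and by parity its potential descends
(`IsCap.isAcyclic_link`). Conversely, a connected 3-coloured graph with vanishing cohomology is a PL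
sphere (`isSphere_of_isAcyclic`), and cones over such spheres are PL charts
(`IsGemMap.isClosedPLManifold`).

The recognition of spheres is an induction on the number of triangles. If some pair of colours has
more than one bicoloured cycle, hexagon flips shrink a union of vertex stars until two triangles
share two edges; this pillow is then removed. If each pair of colours has a single cycle, linear
algebra over `ℤ/2` leaves only two triangles (`card_le_two`). Flips and removals preserve
connectedness and acyclicity, and a sphere obtained after the move yields one before it. Finally,
any coloured complex embeds in some `ℝᴺ` (`exists_isGemMap`), which supplies the manifolds required
by `IsGem`. -/

/-- A convex polytope: the convex hull of a finite set. -/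
def IsPolytope (X : Set E) : Prop := ∃ s : Finset E, X = convexHull ℝ (s : Set E)

lemma isPolytope_convexHull (s : Finset E) : IsPolytope (convexHull ℝ (s : Set E)) := ⟨s, rfl⟩

lemma IsPolytope.image {X : Set E} (h : IsPolytope X) (A : E →ᵃ[ℝ] F) : IsPolytope (A '' X) := by
  classical
  obtain ⟨s, rfl⟩ := h
  exact ⟨s.image A, by rw [A.image_convexHull, Finset.coe_image]⟩

lemma IsPolytope.prod {X : Set E} {Y : Set F} (hX : IsPolytope X) (hY : IsPolytope Y) :
    IsPolytope (X ×ˢ Y) := by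
  obtain ⟨s, rfl⟩ := hX
  obtain ⟨t, rfl⟩ := hY
  exact ⟨s ×ˢ t, by rw [Finset.coe_product, convexHull_prod]⟩

lemma IsPolytope.isCompact {X : Set E} (h : IsPolytope X) : IsCompact X := by
  obtain ⟨s, rfl⟩ := h
  exact s.finite_toSet.isCompact_convexHull ℝ

/-- The point where the affine function `ℓ` vanishes on the segment from `u` to `v`. -/
noncomputable def crossing (ℓ : E →ᵃ[ℝ] ℝ) (u v : E) : E :=
  AffineMap.lineMap u v (ℓ u / (ℓ u - ℓ v))

lemma crossing_zero (ℓ : E →ᵃ[ℝ] ℝ) {u v : E} (h : ℓ u - ℓ v ≠ 0) : ℓ (crossing ℓ u v) = 0 := by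
  rw [crossing, AffineMap.apply_lineMap, AffineMap.lineMap_apply]
  simp only [vsub_eq_sub, smul_eq_mul, vadd_eq_add]
  field_simp
  ring

/-- Free of denominators, so that weighted sums of crossing points can be expanded. -/
lemma crossing_smul (ℓ : E →ᵃ[ℝ] ℝ) {u v : E} (h : ℓ u - ℓ v ≠ 0) :
    (ℓ u - ℓ v) • crossing ℓ u v = ℓ u • v - ℓ v • u := by
  rw [crossing, AffineMap.lineMap_apply, vsub_eq_sub, vadd_eq_add, smul_add, smul_smul,
    mul_div_cancel₀ _ h]
  module

lemma crossing_mem_segment (ℓ : E →ᵃ[ℝ] ℝ) {u v : E} (hu : 0 ≤ ℓ u) (hv : ℓ v < 0) :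
    crossing ℓ u v ∈ segment ℝ u v := by
  rw [segment_eq_image_lineMap]
  exact ⟨_, ⟨div_nonneg hu (by linarith), (div_le_one (by linarith)).2 (by linarith)⟩, rfl⟩

lemma affine_sum (ℓ : E →ᵃ[ℝ] ℝ) {s : Finset E} {w : E → ℝ} (hw : ∑ y ∈ s, w y = 1) :
    ℓ (∑ y ∈ s, w y • y) = ∑ y ∈ s, w y * ℓ y := by
  have h1 : ∀ y, ℓ y = ℓ.linear y + ℓ 0 := fun y => by
    have := ℓ.map_vadd 0 y
    simpa using this
  have h2 : ∀ y ∈ s, w y * ℓ y = w y * ℓ.linear y + w y * ℓ 0 := fun y _ => by rw [h1 y, mul_add]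
  rw [h1, map_sum, Finset.sum_congr rfl h2, Finset.sum_add_distrib, ← Finset.sum_mul, hw, one_mul]
  simp only [map_smul, smul_eq_mul]

/-- The truncated polytope is spanned by the given points with `ℓ ≥ 0` and by the points where
segments from these to the remaining ones cross `ℓ = 0`. -/
lemma IsPolytope.inter_halfspace {X : Set E} (h : IsPolytope X) (ℓ : E →ᵃ[ℝ] ℝ) :
    IsPolytope (X ∩ {x | 0 ≤ ℓ x}) := by
  classical
  obtain ⟨s, rfl⟩ := h
  set p := s.filter fun x => 0 ≤ ℓ x with hp
  set q := s.filter fun x => ¬ 0 ≤ ℓ x with hq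
  refine ⟨p ∪ (p ×ˢ q).image fun z => crossing ℓ z.1 z.2, ?_⟩
  set C := convexHull ℝ ((p ∪ (p ×ˢ q).image fun z => crossing ℓ z.1 z.2 : Finset E) : Set E)
  have hpC : ∀ u ∈ p, u ∈ C := fun u hu => subset_convexHull ℝ _ (by simp [hu])
  have hqC : ∀ z ∈ p ×ˢ q, crossing ℓ z.1 z.2 ∈ C := fun z hz => subset_convexHull ℝ _ (by
    rw [Finset.mem_coe, Finset.mem_union]
    exact Or.inr (Finset.mem_image_of_mem _ hz))
  apply Set.Subset.antisymm
  · rintro x ⟨hx, hx0⟩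
    obtain ⟨w, hw0, hw1, hwx⟩ := Finset.mem_convexHull'.1 hx
    have hℓ := affine_sum ℓ hw1
    rw [hwx, ← Finset.sum_filter_add_sum_filter_not s (fun x => 0 ≤ ℓ x)] at hℓ
    rw [← Finset.sum_filter_add_sum_filter_not s (fun x => 0 ≤ ℓ x)] at hw1 hwx
    rw [← hp, ← hq] at hℓ hw1 hwx
    have hwp : ∀ u ∈ p, 0 ≤ w u := fun u hu => hw0 u (Finset.mem_filter.1 hu).1
    have hwq : ∀ u ∈ q, 0 ≤ w u := fun u hu => hw0 u (Finset.mem_filter.1 hu).1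
    have hlp : ∀ u ∈ p, 0 ≤ ℓ u := fun u hu => (Finset.mem_filter.1 hu).2
    have hlq : ∀ u ∈ q, ℓ u < 0 := fun u hu => not_le.1 (Finset.mem_filter.1 hu).2
    set A := ∑ u ∈ p, w u * ℓ u with hA
    set B := ∑ u ∈ q, w u * ℓ u with hB
    have hB0 : B ≤ 0 :=
      Finset.sum_nonpos fun u hu => mul_nonpos_of_nonneg_of_nonpos (hwq u hu) (hlq u hu).le
    have hx0' : 0 ≤ A + B := hℓ ▸ hx0
    rcases eq_or_lt_of_le (show 0 ≤ A by linarith) with hA0 | hA0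
    · have hB' : B = 0 := by linarith
      have hz : ∀ u ∈ q, w u = 0 := fun u hu => by
        have := (Finset.sum_eq_zero_iff_of_nonpos fun u hu =>
          mul_nonpos_of_nonneg_of_nonpos (hwq u hu) (hlq u hu).le).1 hB' u hu
        exact (mul_eq_zero.1 this).resolve_right (hlq u hu).ne
      rw [Finset.sum_eq_zero hz, add_zero] at hw1
      rw [Finset.sum_eq_zero (s := q) fun u hu => by rw [hz u hu, zero_smul], add_zero] at hwx
      rw [← hwx]
      exact (convex_convexHull ℝ _).sum_mem hwp hw1 hpC
    -- The negative total `B` is cancelled against the fraction `-B / A` of the positive total `A`: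
    -- each `u ∈ p` keeps the fraction `1 + B / A` of its weight, and the rest is paired
    -- proportionally with the points of `q` at the crossing points.
    · have key := (convex_convexHull ℝ _ : Convex ℝ C).sum_mem (t := p.disjSum (p ×ˢ q))
        (w := Sum.elim (fun u => (1 + B / A) * w u)
          fun z => w z.1 * w z.2 * (ℓ z.1 - ℓ z.2) / A)
        (z := Sum.elim id fun z => crossing ℓ z.1 z.2) ?_ ?_ ?_
      · rw [Finset.sum_disjSum] at key
        convert key using 1
        simp only [Sum.elim_inl, Sum.elim_inr, id]
        have e1 : ∑ z ∈ p ×ˢ q, (w z.1 * w z.2 * (ℓ z.1 - ℓ z.2) / A) • crossing ℓ z.1 z.2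
            = ∑ z ∈ p ×ˢ q, (((w z.1 * ℓ z.1) / A) • w z.2 • z.2
              - ((w z.2 * ℓ z.2) / A) • w z.1 • z.1) := by
          refine Finset.sum_congr rfl fun z hz => ?_
          obtain ⟨h1, h2⟩ := Finset.mem_product.1 hz
          have := hlp _ h1
          have := hlq _ h2
          have hc := crossing_smul ℓ (u := z.1) (v := z.2) (by linarith)
          rw [show w z.1 * w z.2 * (ℓ z.1 - ℓ z.2) / A = (w z.1 * w z.2 / A) * (ℓ z.1 - ℓ z.2) by
            ring, mul_smul, hc]
          module
        rw [e1, Finset.sum_sub_distrib, Finset.sum_product, Finset.sum_product_right]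
        simp only [← Finset.smul_sum, ← Finset.sum_smul, ← Finset.sum_div, mul_smul, ← hA, ← hB]
        rw [div_self hA0.ne', ← hwx]
        module
      · rintro (u | z) hz
        · have hu := Finset.inl_mem_disjSum.1 hz
          refine mul_nonneg ?_ (hwp u hu)
          have : 1 + B / A = (A + B) / A := by field_simp
          rw [this]
          positivity
        · obtain ⟨h1, h2⟩ := Finset.mem_product.1 (Finset.inr_mem_disjSum.1 hz)
          have := hlp _ h1
          have := hlq _ h2
          exact div_nonneg (mul_nonneg (mul_nonneg (hwp _ h1) (hwq _ h2)) (by linarith)) hA0.le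
      · rw [Finset.sum_disjSum]
        simp only [Sum.elim_inl, Sum.elim_inr]
        have e1 : ∑ z ∈ p ×ˢ q, w z.1 * w z.2 * (ℓ z.1 - ℓ z.2) / A
            = ∑ z ∈ p ×ˢ q, (((w z.1 * ℓ z.1) / A) * w z.2
              - ((w z.2 * ℓ z.2) / A) * w z.1) :=
          Finset.sum_congr rfl fun z _ => by ring
        rw [e1, Finset.sum_sub_distrib, Finset.sum_product, Finset.sum_product_right]
        simp only [← Finset.mul_sum, ← Finset.sum_mul, ← Finset.sum_div, ← hA, ← hB]
        rw [div_self hA0.ne']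
        linear_combination hw1
      · rintro (u | z) hz
        · exact hpC u (Finset.inl_mem_disjSum.1 hz)
        · exact hqC z (Finset.inr_mem_disjSum.1 hz)
  · refine convexHull_min ?_ ((convex_convexHull ℝ _).inter ?_)
    · intro x hx
      rw [Finset.mem_coe, Finset.mem_union, Finset.mem_image] at hx
      rcases hx with hx | ⟨z, hz, rfl⟩
      · obtain ⟨h1, h2⟩ := Finset.mem_filter.1 hx
        exact ⟨subset_convexHull ℝ _ h1, h2⟩
      · obtain ⟨h1, h2⟩ := Finset.mem_product.1 hz
        obtain ⟨h1, h1'⟩ := Finset.mem_filter.1 h1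
        obtain ⟨h2, h2'⟩ := Finset.mem_filter.1 h2
        rw [not_le] at h2'
        exact ⟨segment_subset_convexHull h1 h2 (crossing_mem_segment ℓ h1' h2'),
          (crossing_zero ℓ (by linarith)).ge⟩
    · exact (convex_Ici (0 : ℝ)).affine_preimage ℓ

lemma IsPolytope.inter_halfspaces {ι : Type*} {X : Set E} (h : IsPolytope X) (I : Finset ι)
    (ℓ : ι → E →ᵃ[ℝ] ℝ) : IsPolytope (X ∩ {x | ∀ i ∈ I, 0 ≤ ℓ i x}) := by
  classical
  induction I using Finset.induction_on with
  | empty => simpa using h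
  | insert i I _ ih =>
    convert ih.inter_halfspace (ℓ i) using 1
    ext x
    simp only [Finset.forall_mem_insert, Set.mem_inter_iff, Set.mem_ofPred_eq]
    tauto

/-- The set is the projection to `E` of the part of `X × Y` cut out by the graph of `A`; each
coordinate equation of the graph is a pair of half-spaces. -/
lemma IsPolytope.inter_preimage [FiniteDimensional ℝ F] {X : Set E} {Y : Set F}
    (hX : IsPolytope X) (hY : IsPolytope Y) (A : E →ᵃ[ℝ] F) : IsPolytope (X ∩ A ⁻¹' Y) := by
  let b := Module.finBasis ℝ F
  let δ : E × F →ᵃ[ℝ] F := A.comp (AffineMap.fst) - AffineMap.snd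
  let ℓ : (Fin (Module.finrank ℝ F) × Bool) → E × F →ᵃ[ℝ] ℝ := fun i =>
    if i.2 then (b.coord i.1).toAffineMap.comp δ else -((b.coord i.1).toAffineMap.comp δ)
  have h := ((hX.prod hY).inter_halfspaces Finset.univ ℓ).image AffineMap.fst
  convert h using 1
  ext x
  constructor
  · rintro ⟨hx, hy⟩
    refine ⟨(x, A x), ⟨⟨hx, hy⟩, ?_⟩, rfl⟩
    rintro ⟨i, j⟩ -
    cases j <;> simp [ℓ, δ]
  · rintro ⟨⟨x, y⟩, ⟨⟨hx, hy⟩, hz⟩, rfl⟩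
    have hxy : A x - y = 0 := by
      apply b.ext_elem
      intro i
      have h1 := hz (i, true) (Finset.mem_univ _)
      have h2 := hz (i, false) (Finset.mem_univ _)
      simp only [ℓ, δ, if_true, Bool.false_eq_true, if_false] at h1 h2
      have h1' : 0 ≤ b.coord i (A x - y) := h1
      have h2' : 0 ≤ -(b.coord i (A x - y)) := h2
      have := le_antisymm (by linarith) h1'
      simpa using this
    exact ⟨hx, (sub_eq_zero.1 hxy).symm ▸ hy⟩

lemma IsPolytope.inter [FiniteDimensional ℝ E] {X Y : Set E} (hX : IsPolytope X)
    (hY : IsPolytope Y) : IsPolytope (X ∩ Y) :=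
  hX.inter_preimage hY (AffineMap.id ℝ E)

/-- Contracting towards the centroid by a small factor `t` brings any two points of the affine span
into the hull, and affine maps commute with the contraction. -/
lemma AffineMap.injOn_affineSpan {s : Finset E} (A : E →ᵃ[ℝ] F)
    (h : Set.InjOn A (convexHull ℝ (s : Set E))) : Set.InjOn A (affineSpan ℝ (s : Set E)) := by
  classical
  rcases s.eq_empty_or_nonempty with rfl | hs
  · simp
  set n : ℝ := ((s.card : ℕ) : ℝ) with hn
  have hn0 : 0 < n := by simpa [hn] using hs
  set c : E := ∑ y ∈ s, n⁻¹ • y with hc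
  have mix : ∀ x ∈ affineSpan ℝ (s : Set E), ∃ ε > (0 : ℝ), ∀ t : ℝ, 0 < t → t < ε →
      (1 - t) • c + t • x ∈ convexHull ℝ (s : Set E) := by
    intro x hx
    have hr : (s : Set E) = Set.range ((↑) : s → E) := by simp
    rw [hr] at hx
    obtain ⟨w, hw1, hwx⟩ := (mem_affineSpan_iff_eq_affineCombination ℝ E).1 hx |> fun
      ⟨t, w, h1, h2⟩ => eq_affineCombination_of_mem_affineSpan_of_fintype hx
    have hwx' : x = ∑ y : s, w y • (y : E) := by
      rw [hwx, Finset.affineCombination_eq_linear_combination _ _ _ hw1]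
    set K := ∑ y : s, |w y| with hK
    have hK0 : 0 ≤ K := Finset.sum_nonneg fun _ _ => abs_nonneg _
    -- `K` bounds all coefficients of `x`, so for such `t` the centroid weight `(1 - t) / n`
    -- outweighs `t * |w y|`.
    refine ⟨(1 + n * (K + 1))⁻¹, by positivity, fun t ht ht' => ?_⟩
    have hb : t * (1 + n * (K + 1)) < 1 := by
      rwa [lt_inv_comm₀ ht (by positivity), ← one_div, lt_div_iff₀ ht, mul_comm] at ht'
    have hsum : (1 - t) • c + t • x = ∑ y : s, ((1 - t) * n⁻¹ + t * w y) • (y : E) := by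
      simp only [add_smul, Finset.sum_add_distrib, mul_smul, ← Finset.smul_sum]
      rw [← hwx', hc, ← Finset.sum_coe_sort s, ← Finset.smul_sum]
    rw [hsum]
    refine (convex_convexHull ℝ _).sum_mem (fun y _ => ?_) ?_
      (fun y _ => subset_convexHull ℝ _ y.2)
    · have h1 : |w y| ≤ K := Finset.single_le_sum (f := fun y => |w y|)
        (fun _ _ => abs_nonneg _) (Finset.mem_univ y)
      have h2 := neg_abs_le (w y)
      have h3 : 0 ≤ (1 - t) + t * n * w y := by nlinarith [mul_pos ht hn0]
      have : (1 - t) * n⁻¹ + t * w y = ((1 - t) + t * n * w y) * n⁻¹ := by field_simp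
      rw [this]
      positivity
    · rw [Finset.sum_add_distrib, ← Finset.mul_sum, ← Finset.mul_sum, hw1]
      simp [← hn, hn0.ne']
  intro x hx y hy hxy
  obtain ⟨ε, hε, h1⟩ := mix x hx
  obtain ⟨ε', hε', h2⟩ := mix y hy
  obtain ⟨t, ht0, ht⟩ := exists_between (lt_min hε hε')
  have e1 := h1 t ht0 (ht.trans_le (min_le_left _ _))
  have e2 := h2 t ht0 (ht.trans_le (min_le_right _ _))
  have hl : ∀ z, (1 - t) • c + t • z = AffineMap.lineMap c z t := fun z => by
    rw [AffineMap.lineMap_apply_module]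
  have := h e1 e2 (by rw [hl, hl, AffineMap.apply_lineMap, AffineMap.apply_lineMap, hxy])
  have h3 : t • x = t • y := by simpa using this
  exact smul_right_injective E ht0.ne' h3

/-- Makes the inverse of an injective PL map affine on the image of each piece. -/
lemma AffineMap.exists_leftInverse {s : Finset E} (A : E →ᵃ[ℝ] F)
    (h : Set.InjOn A (convexHull ℝ (s : Set E))) :
    ∃ D : F →ᵃ[ℝ] E, ∀ x ∈ convexHull ℝ (s : Set E), D (A x) = x := by
  rcases s.eq_empty_or_nonempty with rfl | ⟨p, hp⟩
  · exact ⟨AffineMap.const ℝ F 0, by simp⟩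
  have hinj := AffineMap.injOn_affineSpan A h
  have hpS : p ∈ affineSpan ℝ (s : Set E) := subset_affineSpan ℝ _ hp
  let W := (affineSpan ℝ (s : Set E)).direction
  have hker : (A.linear.domRestrict W).ker = ⊥ := by
    rw [LinearMap.ker_eq_bot']
    rintro ⟨w, hw⟩ hw0
    have hw0' : A.linear w = 0 := hw0
    have h1 : w +ᵥ p ∈ affineSpan ℝ (s : Set E) := AffineSubspace.vadd_mem_of_mem_direction hw hpS
    have := hinj h1 hpS (by rw [A.map_vadd, hw0', zero_vadd])
    simpa using this
  obtain ⟨g, hg⟩ := LinearMap.exists_leftInverse_of_injective _ hker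
  refine ⟨{ toFun := fun y => (g (y - A p) : E) + p
            linear := W.subtype.comp g
            map_vadd' := fun q v => ?_ }, fun x hx => ?_⟩
  · simp only [vadd_eq_add, LinearMap.comp_apply, Submodule.subtype_apply]
    rw [add_sub_assoc, map_add]
    push_cast
    abel
  · have hxS : x ∈ affineSpan ℝ (s : Set E) := convexHull_subset_affineSpan _ hx
    have hd : x -ᵥ p ∈ W := AffineSubspace.vsub_mem_direction hxS hpS
    have h1 : A x - A p = A.linear.domRestrict W ⟨x -ᵥ p, hd⟩ := by
      rw [LinearMap.domRestrict_apply]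
      exact (A.linearMap_vsub x p).symm
    change (g (A x - A p) : E) + p = x
    rw [h1, ← LinearMap.comp_apply, hg]
    simp

end Polytopes

end Gem

namespace Gem

/-! ### The calculus of PL maps on compact polyhedra. -/

section PLMaps

variable {E F E' F' : Type*}
  [NormedAddCommGroup E] [NormedSpace ℝ E] [NormedAddCommGroup F] [NormedSpace ℝ F]
  [NormedAddCommGroup E'] [NormedSpace ℝ E'] [NormedAddCommGroup F'] [NormedSpace ℝ F']

/-- With pieces as sets rather than vertex sets, they can be intersected and truncated directly. -/
lemma isPLOn_iff {f : E → F} {X : Set E} : IsPLOn f X ↔ ∃ P : Set (Set E), P.Finite ∧ X = ⋃₀ P ∧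
    ∀ s ∈ P, IsPolytope s ∧ ∃ A : E →ᵃ[ℝ] F, Set.EqOn f A s := by
  constructor
  · rintro ⟨P, hP, hX, h⟩
    refine ⟨(fun s : Finset E => convexHull ℝ (s : Set E)) '' P, hP.image _, ?_, ?_⟩
    · rw [Set.sUnion_image, hX]
    · rintro _ ⟨s, hs, rfl⟩
      exact ⟨⟨s, rfl⟩, h s hs⟩
  · rintro ⟨P, hP, hX, h⟩
    choose! c hc using fun s hs => (h s hs).1
    refine ⟨c '' P, hP.image _, ?_, ?_⟩
    · rw [Set.biUnion_image, hX, Set.sUnion_eq_biUnion]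
      exact Set.iUnion₂_congr fun s hs => hc s hs
    · rintro _ ⟨s, hs, rfl⟩
      rw [← hc s hs]
      exact (h s hs).2

lemma isPLOn_affine {X : Set E} (h : IsPolytope X) (A : E →ᵃ[ℝ] F) : IsPLOn A X :=
  isPLOn_iff.2 ⟨{X}, Set.finite_singleton _, by simp, by simpa using ⟨h, A, Set.eqOn_refl _ _⟩⟩

lemma IsPLOn.congr {f g : E → F} {X : Set E} (h : IsPLOn f X) (hfg : Set.EqOn f g X) :
    IsPLOn g X := by
  obtain ⟨P, hP, hX, h⟩ := isPLOn_iff.1 h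
  refine isPLOn_iff.2 ⟨P, hP, hX, fun s hs => ⟨(h s hs).1, ?_⟩⟩
  obtain ⟨A, hA⟩ := (h s hs).2
  refine ⟨A, (hfg.symm.mono ?_).trans hA⟩
  rw [hX]
  exact Set.subset_sUnion_of_mem hs

lemma IsPLOn.iUnion {ι : Type*} [Finite ι] {f : E → F} {X : ι → Set E}
    (h : ∀ i, IsPLOn f (X i)) : IsPLOn f (⋃ i, X i) := by
  choose P hP hX h using fun i => isPLOn_iff.1 (h i)
  refine isPLOn_iff.2 ⟨⋃ i, P i, Set.finite_iUnion hP, ?_, ?_⟩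
  · rw [Set.sUnion_iUnion]
    exact Set.iUnion_congr hX
  · intro s hs
    obtain ⟨i, hi⟩ := Set.mem_iUnion.1 hs
    exact h i s hi

/-- Each piece of `f` is subdivided by the preimages of the pieces of `g`. -/
lemma IsPLOn.comp [FiniteDimensional ℝ F] {g : F → E'} {f : E → F} {X : Set E} {Y : Set F}
    (hg : IsPLOn g Y) (hf : IsPLOn f X) (hm : Set.MapsTo f X Y) : IsPLOn (g ∘ f) X := by
  obtain ⟨P, hP, hX, hf⟩ := isPLOn_iff.1 hf
  obtain ⟨Q, hQ, hY, hg⟩ := isPLOn_iff.1 hg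
  choose! A hA using fun s hs => (hf s hs).2
  choose! B hB using fun s hs => (hg s hs).2
  refine isPLOn_iff.2 ⟨Set.image2 (fun s t => s ∩ A s ⁻¹' t) P Q, hP.image2 _ hQ, ?_, ?_⟩
  · ext x
    simp only [Set.mem_sUnion, Set.mem_image2, exists_exists_and_exists_and_eq_and]
    constructor
    · intro hx
      have hfx := hm hx
      rw [hX] at hx
      obtain ⟨s, hs, hxs⟩ := hx
      rw [hY] at hfx
      obtain ⟨t, ht, hxt⟩ := hfx
      exact ⟨s, hs, t, ht, hxs, by rwa [Set.mem_preimage, ← hA s hs hxs]⟩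
    · rintro ⟨s, hs, t, ht, hxs, -⟩
      rw [hX]
      exact ⟨s, hs, hxs⟩
  · rintro _ ⟨s, hs, t, ht, rfl⟩
    refine ⟨(hf s hs).1.inter_preimage (hg t ht).1 _, (B t).comp (A s), fun x hx => ?_⟩
    simp only [Function.comp_apply, AffineMap.comp_apply]
    rw [hA s hs hx.1, hB t ht hx.2]

lemma IsPLOn.isCompactPolyhedron {f : E → F} {X : Set E} (h : IsPLOn f X) :
    IsCompactPolyhedron X := by
  obtain ⟨P, hP, hX, -⟩ := h
  exact ⟨P, hP, hX⟩

lemma IsCompactPolyhedron.isPLOn {X : Set E} (h : IsCompactPolyhedron X) (A : E →ᵃ[ℝ] F) :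
    IsPLOn A X := by
  obtain ⟨P, hP, hX⟩ := h
  exact ⟨P, hP, hX, fun _ _ => ⟨A, Set.eqOn_refl _ _⟩⟩

lemma IsPLOn.mono [FiniteDimensional ℝ E] {f : E → F} {X Y : Set E} (h : IsPLOn f X)
    (hY : IsCompactPolyhedron Y) (hYX : Y ⊆ X) : IsPLOn f Y :=
  h.comp (f := id) (hY.isPLOn (AffineMap.id ℝ E)) hYX

lemma IsPLOn.affine_comp {f : E → F} {X : Set E} (h : IsPLOn f X) (A : F →ᵃ[ℝ] E') :
    IsPLOn (fun x => A (f x)) X := by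
  obtain ⟨P, hP, hX, h⟩ := h
  refine ⟨P, hP, hX, fun s hs => ?_⟩
  obtain ⟨B, hB⟩ := h s hs
  exact ⟨A.comp B, fun x hx => by simp [hB hx]⟩

/-- A common subdivision; it reduces binary operations on PL maps to affine ones. -/
lemma IsPLOn.refine [FiniteDimensional ℝ E] {f : E → F} {g : E → F'} {X : Set E}
    (hf : IsPLOn f X) (hg : IsPLOn g X) :
    ∃ P : Set (Set E), P.Finite ∧ X = ⋃₀ P ∧ ∀ s ∈ P, IsPolytope s ∧
      (∃ A : E →ᵃ[ℝ] F, Set.EqOn f A s) ∧ ∃ B : E →ᵃ[ℝ] F', Set.EqOn g B s := by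
  obtain ⟨P, hP, hX, hf⟩ := isPLOn_iff.1 hf
  obtain ⟨Q, hQ, hY, hg⟩ := isPLOn_iff.1 hg
  refine ⟨Set.image2 (· ∩ ·) P Q, hP.image2 _ hQ, ?_, ?_⟩
  · rw [Set.sUnion_image2, ← Set.inter_self X]
    nth_rw 1 [hX]
    rw [hY, Set.sUnion_eq_biUnion, Set.sUnion_eq_biUnion, Set.iUnion₂_inter]
    exact Set.iUnion₂_congr fun s hs => by rw [Set.inter_iUnion₂]
  · rintro _ ⟨s, hs, t, ht, rfl⟩
    obtain ⟨h1, A, hA⟩ := hf s hs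
    obtain ⟨h2, B, hB⟩ := hg t ht
    exact ⟨h1.inter h2, ⟨A, hA.mono Set.inter_subset_left⟩, B, hB.mono Set.inter_subset_right⟩

lemma IsPLOn.prodMk [FiniteDimensional ℝ E] {f : E → F} {g : E → F'} {X : Set E}
    (hf : IsPLOn f X) (hg : IsPLOn g X) : IsPLOn (fun x => (f x, g x)) X := by
  obtain ⟨P, hP, hX, h⟩ := hf.refine hg
  refine isPLOn_iff.2 ⟨P, hP, hX, fun s hs => ?_⟩
  obtain ⟨h1, ⟨A, hA⟩, B, hB⟩ := h s hs
  exact ⟨h1, A.prod B, fun x hx => by simp [hA hx, hB hx]⟩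

lemma IsPLOn.add [FiniteDimensional ℝ E] {f g : E → F} {X : Set E}
    (hf : IsPLOn f X) (hg : IsPLOn g X) : IsPLOn (fun x => f x + g x) X :=
  (hf.prodMk hg).affine_comp (AffineMap.fst + AffineMap.snd)

lemma IsPLOn.sub [FiniteDimensional ℝ E] {f g : E → F} {X : Set E}
    (hf : IsPLOn f X) (hg : IsPLOn g X) : IsPLOn (fun x => f x - g x) X :=
  (hf.prodMk hg).affine_comp (AffineMap.fst - AffineMap.snd)

lemma IsPLOn.const_smul {f : E → F} {X : Set E} (c : ℝ) (hf : IsPLOn f X) :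
    IsPLOn (fun x => c • f x) X :=
  hf.affine_comp (c • AffineMap.id ℝ F)

lemma IsCompactPolyhedron.isPLOn_const {X : Set E} (h : IsCompactPolyhedron X) (c : F) :
    IsPLOn (fun _ => c) X :=
  h.isPLOn (AffineMap.const ℝ E c)

lemma IsPLOn.pi {n : ℕ} [FiniteDimensional ℝ E] {f : E → Fin n → ℝ} {X : Set E}
    (hX : IsCompactPolyhedron X) (h : ∀ i, IsPLOn (fun x => f x i) X) : IsPLOn f X := by
  induction n with
  | zero => exact (hX.isPLOn_const (0 : Fin 0 → ℝ)).congr fun x _ => Subsingleton.elim _ _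
  | succ n ih =>
    have h1 := ih (f := fun x i => f x i.succ) fun i => h i.succ
    let A : ℝ × (Fin n → ℝ) →ₗ[ℝ] (Fin (n + 1) → ℝ) :=
      LinearMap.pi (Fin.cons (LinearMap.fst ℝ ℝ (Fin n → ℝ))
        fun i => (LinearMap.proj i).comp (LinearMap.snd ℝ ℝ (Fin n → ℝ)))
    refine (((h 0).prodMk h1).affine_comp A.toAffineMap).congr fun x _ => ?_
    ext i
    refine Fin.cases ?_ (fun i => ?_) i <;> simp [A]

/-- Every piece is cut along the zero set of `a`. The pieces are closed, so the zero set lies on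
both sides and the two maps must agree there. -/
lemma IsPLOn.ite_le [FiniteDimensional ℝ E] {a : E → ℝ} {f g : E → F} {X : Set E}
    (ha : IsPLOn a X) (hf : IsPLOn f X) (hg : IsPLOn g X)
    (hfg : ∀ x ∈ X, a x = 0 → f x = g x) : IsPLOn (fun x => if 0 ≤ a x then f x else g x) X := by
  obtain ⟨P, hP, hX, h⟩ := ha.refine (hf.prodMk hg)
  have hsX : ∀ s ∈ P, s ⊆ X := fun s hs => hX ▸ Set.subset_sUnion_of_mem hs
  choose! A hA using fun s hs => (h s hs).2.1
  choose! B hB using fun s hs => (h s hs).2.2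
  refine isPLOn_iff.2 ⟨(fun s => s ∩ {x | 0 ≤ A s x}) '' P ∪ (fun s => s ∩ {x | 0 ≤ (-A s) x}) '' P,
    (hP.image _).union (hP.image _), ?_, ?_⟩
  · ext x
    simp only [Set.mem_sUnion, Set.mem_union, Set.mem_image]
    constructor
    · intro hx
      rw [hX] at hx
      obtain ⟨s, hs, hxs⟩ := hx
      rcases le_total 0 (A s x) with h0 | h0
      · exact ⟨_, Or.inl ⟨s, hs, rfl⟩, hxs, h0⟩
      · exact ⟨_, Or.inr ⟨s, hs, rfl⟩, hxs, by simpa using h0⟩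
    · rintro ⟨_, ⟨s, hs, rfl⟩ | ⟨s, hs, rfl⟩, hxs, -⟩ <;> exact hsX s hs hxs
  · rintro _ (⟨s, hs, rfl⟩ | ⟨s, hs, rfl⟩)
    · refine ⟨(h s hs).1.inter_halfspace _, AffineMap.fst.comp (B s), fun x hx => ?_⟩
      have h0 : 0 ≤ a x := by rw [hA s hs hx.1]; exact hx.2
      have := hB s hs hx.1
      simp only at this
      simp [h0, ← this]
    · refine ⟨(h s hs).1.inter_halfspace _, AffineMap.snd.comp (B s), fun x hx => ?_⟩
      have h0 : a x ≤ 0 := by rw [hA s hs hx.1]; simpa using hx.2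
      have := hB s hs hx.1
      simp only at this
      rcases eq_or_lt_of_le h0 with h0 | h0
      · simp [h0, ← this, hfg x (hsX s hs hx.1) h0]
      · simp [not_le.2 h0, ← this]

lemma IsPLOn.min [FiniteDimensional ℝ E] {f g : E → ℝ} {X : Set E}
    (hf : IsPLOn f X) (hg : IsPLOn g X) : IsPLOn (fun x => min (f x) (g x)) X := by
  refine (IsPLOn.ite_le (hg.sub hf) hf hg fun x _ h => by linarith).congr fun x _ => ?_
  simp only [sub_nonneg, min_def]

lemma IsPLOn.isCompactPolyhedron_image {f : E → F} {X : Set E} (h : IsPLOn f X) :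
    IsCompactPolyhedron (f '' X) := by
  obtain ⟨P, hP, hX, h⟩ := isPLOn_iff.1 h
  refine (isPLOn_iff.2 ⟨(f '' ·) '' P, hP.image _, ?_, ?_⟩ :
    IsPLOn (id : F → F) _).isCompactPolyhedron
  · rw [hX, Set.sUnion_eq_biUnion, Set.image_iUnion₂, Set.sUnion_image]
  · rintro _ ⟨s, hs, rfl⟩
    obtain ⟨h1, A, hA⟩ := h s hs
    exact ⟨(hA.image_eq.symm ▸ h1.image A : IsPolytope (f '' s)), AffineMap.id ℝ F, Set.eqOn_refl _ _⟩

/-- A map on the image of an injective PL map `f` is PL if its composition with `f` is PL. -/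
lemma IsPLOn.of_comp [FiniteDimensional ℝ E] {f : E → F} {f' : E → E'} {g : F → E'} {X : Set E}
    (hf : IsPLOn f X) (hinj : Set.InjOn f X) (hf' : IsPLOn f' X)
    (hg : ∀ x ∈ X, g (f x) = f' x) : IsPLOn g (f '' X) := by
  obtain ⟨P, hP, hX, h⟩ := hf.refine hf'
  refine isPLOn_iff.2 ⟨(f '' ·) '' P, hP.image _, ?_, ?_⟩
  · rw [hX, Set.sUnion_eq_biUnion, Set.image_iUnion₂, Set.sUnion_image]
  · rintro _ ⟨s, hs, rfl⟩
    have hsX : s ⊆ X := hX ▸ Set.subset_sUnion_of_mem hs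
    obtain ⟨h1, ⟨A, hA⟩, B, hB⟩ := h s hs
    refine ⟨(hA.image_eq.symm ▸ h1.image A : IsPolytope (f '' s)), ?_⟩
    obtain ⟨c, rfl⟩ := h1
    obtain ⟨D, hD⟩ := AffineMap.exists_leftInverse A ((hinj.mono hsX).congr hA)
    refine ⟨B.comp D, ?_⟩
    rintro _ ⟨x, hx, rfl⟩
    rw [AffineMap.comp_apply, hA hx, hD x hx, ← hA hx, hg x (hsX hx), hB hx]

lemma IsCompactPolyhedron.isCompact {X : Set E} (h : IsCompactPolyhedron X) : IsCompact X := by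
  obtain ⟨P, hP, rfl⟩ := h
  exact hP.isCompact_biUnion fun s _ => (isPolytope_convexHull s).isCompact

lemma IsPLOn.continuousOn [FiniteDimensional ℝ E] {f : E → F} {X : Set E} (h : IsPLOn f X) :
    ContinuousOn f X := by
  obtain ⟨P, hP, hX, h⟩ := isPLOn_iff.1 h
  have := hP.to_subtype
  rw [hX, Set.sUnion_eq_iUnion]
  refine LocallyFinite.continuousOn_iUnion (locallyFinite_of_finite _)
    (fun s => (h s s.2).1.isCompact.isClosed) fun s => ?_
  obtain ⟨A, hA⟩ := (h s s.2).2
  exact (A.continuous_of_finiteDimensional.continuousOn).congr hA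

lemma stdSimplex_isPolytope (ι : Type*) [Fintype ι] : IsPolytope (stdSimplex ℝ ι) := by
  classical
  refine ⟨Finset.univ.image fun i j => if i = j then 1 else 0, ?_⟩
  rw [← convexHull_basis_eq_stdSimplex]
  simp

lemma isCompactPolyhedron_stdSimplex (ι : Type*) [Fintype ι] :
    IsCompactPolyhedron (stdSimplex ℝ ι) :=
  (isPLOn_affine (stdSimplex_isPolytope ι) (AffineMap.id ℝ (ι → ℝ))).isCompactPolyhedron

end PLMaps

end Gem

namespace Gem

/-! ### Coloured graphs as families of involutions. -/

section Involutions

variable {ι V W : Type*}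

/-- A graph with vertex set `V` whose edges are properly coloured by `ι`, each vertex being incident
with exactly one edge of each colour: `σ i v` is the neighbour of `v` along its edge of
colour `i`. -/
structure IsColouring (σ : ι → V → V) : Prop where
  invol : ∀ i v, σ i (σ i v) = v
  ne : ∀ i v, σ i v ≠ v

/-- `v` and `w` are joined by a path all of whose edges have colours in `J`. -/
def Joined (σ : ι → V → V) (J : Set ι) : V → V → Prop :=
  Relation.ReflTransGen fun v w => ∃ i ∈ J, σ i v = w

lemma IsColouring.injective {σ : ι → V → V} (h : IsColouring σ) (i : ι) :
    Function.Injective (σ i) :=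
  Function.LeftInverse.injective (h.invol i)

lemma IsColouring.eq_apply {σ : ι → V → V} (h : IsColouring σ) {i : ι} {v w : V} (e : σ i v = w) :
    v = σ i w := by
  rw [← e, h.invol]

lemma Joined.refl (σ : ι → V → V) (J : Set ι) (v : V) : Joined σ J v v :=
  Relation.ReflTransGen.refl

lemma Joined.trans {σ : ι → V → V} {J : Set ι} {u v w : V} (h : Joined σ J u v)
    (h' : Joined σ J v w) : Joined σ J u w :=
  Relation.ReflTransGen.trans h h'

lemma Joined.edge (σ : ι → V → V) {J : Set ι} {i : ι} (hi : i ∈ J) (v : V) :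
    Joined σ J v (σ i v) :=
  Relation.ReflTransGen.single ⟨i, hi, rfl⟩

lemma Joined.symm {σ : ι → V → V} (hσ : IsColouring σ) {J : Set ι} {v w : V}
    (h : Joined σ J v w) : Joined σ J w v := by
  induction h with
  | refl => exact Joined.refl _ _ _
  | tail _ h ih =>
    obtain ⟨i, hi, rfl⟩ := h
    exact Relation.ReflTransGen.head ⟨i, hi, hσ.invol i _⟩ ih

lemma Joined.mono {σ : ι → V → V} {J J' : Set ι} (hJ : J ⊆ J') {v w : V}
    (h : Joined σ J v w) : Joined σ J' v w :=
  Relation.ReflTransGen.mono (fun _ _ ⟨i, hi, h⟩ => ⟨i, hJ hi, h⟩) _ _ h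

lemma Joined.mem {σ : ι → V → V} {J : Set ι} {S : Set V} (hS : ∀ i ∈ J, ∀ v ∈ S, σ i v ∈ S)
    {v w : V} (h : Joined σ J v w) (hv : v ∈ S) : w ∈ S := by
  induction h with
  | refl => exact hv
  | tail _ h ih =>
    obtain ⟨i, hi, rfl⟩ := h
    exact hS i hi _ ih

/-- Later applied also with `f = id` when no colour of `J` can occur: then the two ends of the path
coincide. -/
lemma Joined.apply_eq {X : Type*} {σ : ι → V → V} {J : Set ι} {f : V → X}
    (hf : ∀ i ∈ J, ∀ v, f (σ i v) = f v) {v w : V} (h : Joined σ J v w) : f w = f v := by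
  induction h with
  | refl => rfl
  | tail _ h ih =>
    obtain ⟨i, hi, rfl⟩ := h
    rw [hf i hi, ih]

/-- Two points `(v, x)`, `(w, y)` of the disjoint union of simplices represent the same point of
the coloured complex. -/
def SamePoint (σ : ι → V → V) (p q : V × (ι → ℝ)) : Prop :=
  p.2 = q.2 ∧ Joined σ {i | p.2 i = 0} p.1 q.1

lemma SamePoint.refl (σ : ι → V → V) (p : V × (ι → ℝ)) : SamePoint σ p p :=
  ⟨rfl, Joined.refl _ _ _⟩

lemma SamePoint.symm {σ : ι → V → V} (hσ : IsColouring σ) {p q : V × (ι → ℝ)}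
    (h : SamePoint σ p q) : SamePoint σ q p := by
  obtain ⟨v, x⟩ := p
  obtain ⟨w, y⟩ := q
  obtain ⟨rfl, h⟩ := h
  exact ⟨rfl, h.symm hσ⟩

lemma SamePoint.trans {σ : ι → V → V} {p q r : V × (ι → ℝ)}
    (h : SamePoint σ p q) (h' : SamePoint σ q r) : SamePoint σ p r := by
  obtain ⟨v, x⟩ := p
  obtain ⟨w, y⟩ := q
  obtain ⟨u, z⟩ := r
  obtain ⟨rfl, h⟩ := h
  obtain ⟨rfl, h'⟩ := h'
  exact ⟨rfl, h.trans h'⟩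

lemma SamePoint.edge (σ : ι → V → V) {i : ι} (v : V) {x : ι → ℝ} (hx : x i = 0) :
    SamePoint σ (v, x) (σ i v, x) :=
  ⟨rfl, Joined.edge σ hx v⟩

/-- To descend to the complexes, a map of simplices need only respect the gluing along single edges.
-/
lemma SamePoint.map [Fintype ι] {σ : ι → V → V} {σ' : ι → W → W}
    {θ : V → (ι → ℝ) → W × (ι → ℝ)}
    (h : ∀ v i, ∀ x ∈ stdSimplex ℝ ι, x i = 0 → SamePoint σ' (θ v x) (θ (σ i v) x))
    {p q : V × (ι → ℝ)} (hp : p.2 ∈ stdSimplex ℝ ι) (hpq : SamePoint σ p q) :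
    SamePoint σ' (θ p.1 p.2) (θ q.1 q.2) := by
  obtain ⟨v, x⟩ := p
  obtain ⟨w, y⟩ := q
  obtain ⟨rfl, hpq⟩ := hpq
  dsimp only at *
  induction hpq with
  | refl => exact SamePoint.refl _ _
  | tail _ e ih =>
    obtain ⟨i, hi, rfl⟩ := e
    exact ih.trans (h _ i x hp hi)

end Involutions

/-! ### Realizing 3-coloured graphs on the sphere -/

section Sphere

variable {V W : Type*}

/-- The standard triangle. -/
abbrev Triangle : Set (Fin 3 → ℝ) := stdSimplex ℝ (Fin 3)

/-- A positively homogeneous function on `ℝ³` whose unit level set is the boundary of a bipyramid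
over a triangle. -/
noncomputable def bipyramidGauge (y : Fin 3 → ℝ) : ℝ :=
  |y 0 + y 1 + y 2| + (y 0 + y 1 + y 2) - 3 * min (y 0) (min (y 1) (y 2))

/-- The complex of triangles of a 3-coloured graph is piecewise linearly homeomorphic to the
boundary of a bipyramid. -/
def IsSphere (σ : Fin 3 → V → V) : Prop :=
  ∃ φ : V → (Fin 3 → ℝ) → (Fin 3 → ℝ), (∀ v, IsPLOn (φ v) Triangle) ∧
    (∀ v, ∀ x ∈ Triangle, ∀ w, ∀ y ∈ Triangle,
      φ v x = φ w y ↔ SamePoint σ (v, x) (w, y)) ∧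
    ∀ y, bipyramidGauge y = 1 ↔ ∃ v, ∃ x ∈ Triangle, φ v x = y

/-- `θ` and `θ'` are mutually inverse after identification. Piecewise linearity is only asked of the
composite with a map that respects the identifications, because `θ` may jump between representatives
of the same point. -/
lemma IsSphere.transport {σ : Fin 3 → V → V} {σ' : Fin 3 → W → W} (hσ : IsColouring σ)
    (θ : V → (Fin 3 → ℝ) → W × (Fin 3 → ℝ)) (θ' : W → (Fin 3 → ℝ) → V × (Fin 3 → ℝ))
    (hT : ∀ v, ∀ x ∈ Triangle, (θ v x).2 ∈ Triangle)
    (hT' : ∀ v, ∀ x ∈ Triangle, (θ' v x).2 ∈ Triangle)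
    (hθ : ∀ v i, ∀ x ∈ Triangle, x i = 0 → SamePoint σ' (θ v x) (θ (σ i v) x))
    (hθ' : ∀ v i, ∀ x ∈ Triangle, x i = 0 → SamePoint σ (θ' v x) (θ' (σ' i v) x))
    (hinv : ∀ v, ∀ x ∈ Triangle, SamePoint σ (θ' (θ v x).1 (θ v x).2) (v, x))
    (hinv' : ∀ v, ∀ x ∈ Triangle, SamePoint σ' (θ (θ' v x).1 (θ' v x).2) (v, x))
    (hPL : ∀ φ : W → (Fin 3 → ℝ) → (Fin 3 → ℝ), (∀ v, IsPLOn (φ v) Triangle) →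
      (∀ v, ∀ x ∈ Triangle, ∀ w, ∀ y ∈ Triangle,
        SamePoint σ' (v, x) (w, y) → φ v x = φ w y) →
      ∀ v, IsPLOn (fun x => φ (θ v x).1 (θ v x).2) Triangle)
    (h : IsSphere σ') : IsSphere σ := by
  obtain ⟨φ, h1, h2, h3⟩ := h
  refine ⟨fun v x => φ (θ v x).1 (θ v x).2,
    hPL φ h1 fun v x hx w y hy => (h2 v x hx w y hy).2, fun v x hx w y hy => ?_, fun y => ?_⟩
  · rw [h2 _ _ (hT v x hx) _ _ (hT w y hy)]
    constructor
    · intro h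
      have := SamePoint.map hθ' (hT v x hx) h
      exact ((hinv v x hx).symm hσ).trans (this.trans (hinv w y hy))
    · exact SamePoint.map hθ hx
  · rw [h3]
    constructor
    · rintro ⟨w, x, hx, rfl⟩
      exact ⟨(θ' w x).1, (θ' w x).2, hT' w x hx, (h2 _ _ (hT _ _ (hT' w x hx)) _ _ hx).2
        (hinv' w x hx)⟩
    · rintro ⟨w, x, hx, rfl⟩
      exact ⟨_, _, hT w x hx, rfl⟩

lemma fin3_cases (i c : Fin 3) : i = c ∨ i = c + 1 ∨ i = c + 2 := by
  revert i c; decide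

lemma fin3_ne_add_one (i : Fin 3) : i ≠ i + 1 := by
  revert i; decide

lemma fin3_ne_add_two (i : Fin 3) : i ≠ i + 2 := by
  revert i; decide

/-! ### The hexagon flip -/

section Flip

/-- The colouring obtained from `σ` by the hexagon flip at `a`: the triangle `a` and the three
triangles adjacent to it are replaced by the opposite triangulation of the hexagon formed by
them. -/
def flip [DecidableEq V] (σ : Fin 3 → V → V) (a : V) (i : Fin 3) (v : V) : V :=
  Equiv.swap (σ (i + 1) a) (σ (i + 2) a) (σ i (Equiv.swap (σ (i + 1) a) (σ (i + 2) a) v))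

/-- In the opposite triangulation the outer edge of colour `i` of the triangle `σ j a` becomes that
of `σ k a` and vice versa; this is why the flip conjugates `σ i` by their transposition, in which
their order does not matter. -/
lemma swap_flip_eq [DecidableEq V] (σ : Fin 3 → V → V) (a : V) {i j k : Fin 3} (hij : i ≠ j) (hik : i ≠ k)
    (hjk : j ≠ k) : Equiv.swap (σ (i + 1) a) (σ (i + 2) a) = Equiv.swap (σ j a) (σ k a) := by
  rcases fin3_cases j i with rfl | rfl | rfl
  · exact absurd rfl hij
  · rcases fin3_cases k i with rfl | rfl | rfl
    · exact absurd rfl hik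
    · exact absurd rfl hjk
    · rfl
  · rcases fin3_cases k i with rfl | rfl | rfl
    · exact absurd rfl hik
    · exact Equiv.swap_comm _ _
    · exact absurd rfl hjk

variable {σ : Fin 3 → V → V} {a : V}

lemma flip_apply_centre [DecidableEq V] (hσ : IsColouring σ) (ha : Function.Injective fun i => σ i a)
    (i : Fin 3) : flip σ a i a = σ i a := by
  have h1 : σ i a ≠ σ (i + 1) a := fun h => by
    exact absurd (ha h) (fin3_ne_add_one i)
  have h2 : σ i a ≠ σ (i + 2) a := fun h => by
    exact absurd (ha h) (fin3_ne_add_two i)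
  rw [flip, Equiv.swap_apply_of_ne_of_ne (hσ.ne _ _).symm (hσ.ne _ _).symm,
    Equiv.swap_apply_of_ne_of_ne h1 h2]

lemma isColouring_flip [DecidableEq V] (hσ : IsColouring σ) (a : V) : IsColouring (flip σ a) where
  invol i v := by simp [flip, hσ.invol]
  ne i v h := by
    rw [flip, Equiv.swap_apply_eq_iff] at h
    exact hσ.ne _ _ h

lemma flip_flip [DecidableEq V] (hσ : IsColouring σ) (ha : Function.Injective fun i => σ i a) :
    flip (flip σ a) a = σ := by
  funext i v
  rw [flip, flip_apply_centre hσ ha, flip_apply_centre hσ ha, flip]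
  simp

/-- The centre `a` (`none`) of the flip and the three triangles adjacent to it. -/
def flipVertex (σ : Fin 3 → V → V) (a : V) : Option (Fin 3) → V := fun r => r.elim a fun i => σ i a

lemma flipVertex_injective (hσ : IsColouring σ) (ha : Function.Injective fun i => σ i a) :
    Function.Injective (flipVertex σ a) := by
  rintro (_ | i) (_ | j) h
  · rfl
  · exact absurd h.symm (hσ.ne _ _)
  · exact absurd h (hσ.ne _ _)
  · exact congrArg some (ha h)

/-- Barycentric coordinates for the triangles of the model hexagon. -/
def hexCoord (r : Option (Fin 3)) (z : Fin 3 → ℝ) : Fin 3 → ℝ :=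
  r.elim z fun i j => if j = i then -3 * z i else z j + 2 * z i

/-- The triangles of the model hexagon. -/
noncomputable def hexMap (r : Option (Fin 3)) (x : Fin 3 → ℝ) : Fin 3 → ℝ :=
  r.elim x fun i j => if j = i then -x i / 3 else x j + 2 * x i / 3

/-- The central symmetry of the model hexagon. -/
noncomputable def hexSymm (z : Fin 3 → ℝ) : Fin 3 → ℝ := fun j => 2 / 3 - z j

open Classical in
/-- A triangle of the model hexagon containing `z`. -/
noncomputable def hexPiece (z : Fin 3 → ℝ) : Option (Fin 3) :=
  if z 0 < 0 then some 0 else if z 1 < 0 then some 1 else if z 2 < 0 then some 2 else none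

lemma hexCoord_hexMap (r : Option (Fin 3)) (x : Fin 3 → ℝ) : hexCoord r (hexMap r x) = x := by
  rcases r with _ | i
  · rfl
  · funext j
    simp only [hexCoord, hexMap, Option.elim_some, if_true]
    split_ifs with h
    · subst h; ring
    · ring

lemma hexMap_hexCoord (r : Option (Fin 3)) (x : Fin 3 → ℝ) : hexMap r (hexCoord r x) = x := by
  rcases r with _ | i
  · rfl
  · funext j
    simp only [hexCoord, hexMap, Option.elim_some, if_true]
    split_ifs with h
    · subst h; ring
    · ring

/-- The apex of the outer triangle `some i` has `i`-th coordinate `-1/3` and the others `2/3`: it is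
the reflection of the corner `i` of the central triangle in its barycentre. The constants of
`hexMap` are chosen for this, so that the symmetry preserves colours. -/
lemma hexSymm_hexSymm (z : Fin 3 → ℝ) : hexSymm (hexSymm z) = z := by
  funext j; simp [hexSymm]

lemma mem_triangle {x : Fin 3 → ℝ} :
    x ∈ Triangle ↔ 0 ≤ x 0 ∧ 0 ≤ x 1 ∧ 0 ≤ x 2 ∧ x 0 + x 1 + x 2 = 1 := by
  simp [stdSimplex, Fin.sum_univ_three, Fin.forall_fin_succ, and_assoc]

/-- At most one coordinate is negative in the hexagon, and it names the outer triangle. The only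
ambiguity is an edge of the central triangle, where both triangles give the same coordinates. -/
lemma hexCoord_hexPiece_mem {z : Fin 3 → ℝ} {r : Option (Fin 3)} (h : hexCoord r z ∈ Triangle) :
    hexCoord (hexPiece z) z = hexCoord r z ∧
      (hexPiece z = r ∨ hexPiece z = none ∧ ∃ i, r = some i ∧ z i = 0) := by
  rcases r with _ | i
  · obtain ⟨h0, h1, h2, h3⟩ := mem_triangle.1 h
    simp only [hexCoord, Option.elim_none] at h0 h1 h2
    simp [hexPiece, not_lt.2 h0, not_lt.2 h1, not_lt.2 h2]
  · obtain ⟨h0, h1, h2, h3⟩ := mem_triangle.1 h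
    by_cases hi : z i = 0
    · have hc : hexCoord (some i) z = z := by
        funext j
        by_cases hj : j = i
        · subst hj; simp [hexCoord, hi]
        · simp [hexCoord, hi, hj]
      rw [hc] at h0 h1 h2 ⊢
      simp only [hexPiece, not_lt.2 h0, not_lt.2 h1, not_lt.2 h2, if_false]
      exact ⟨rfl, Or.inr ⟨trivial, i, rfl, hi⟩⟩
    · have : hexPiece z = some i := by
        fin_cases i <;> simp [hexCoord] at h0 h1 h2 hi
        · have : z 0 < 0 := lt_of_le_of_ne (by linarith) hi
          simp [hexPiece, this]
        · have : z 1 < 0 := lt_of_le_of_ne (by linarith) hi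
          simp [hexPiece, this, not_lt.2 (show 0 ≤ z 0 by linarith)]
        · have : z 2 < 0 := lt_of_le_of_ne (by linarith) hi
          simp [hexPiece, this, not_lt.2 (show 0 ≤ z 0 by linarith),
            not_lt.2 (show 0 ≤ z 1 by linarith)]
      exact ⟨by rw [this], Or.inl this⟩

lemma exists_hexCoord_mem {x : Fin 3 → ℝ} (hx : x ∈ Triangle) (r : Option (Fin 3)) :
    ∃ s, hexCoord s (hexSymm (hexMap r x)) ∈ Triangle := by
  obtain ⟨h0, h1, h2, h3⟩ := mem_triangle.1 hx
  by_contra! hn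
  have e0 := hn none
  have e1 := hn (some 0)
  have e2 := hn (some 1)
  have e3 := hn (some 2)
  rw [mem_triangle] at e0 e1 e2 e3
  rcases r with _ | i
  · simp [hexCoord, hexSymm, hexMap] at e0 e1 e2 e3
    grind
  · fin_cases i <;> simp [hexCoord, hexSymm, hexMap] at e0 e1 e2 e3 <;> grind

end Flip

end Sphere

end Gem

namespace Gem

/-! ### Flipping a hexagon does not change the surface. -/

section FlipSphere

variable {V : Type*} {σ : Fin 3 → V → V} {a : V}

/-- The map of the hexagon formed by the triangle `a` and the adjacent triangles induced by the
central symmetry of the model hexagon. -/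
noncomputable def flipLocal (σ : Fin 3 → V → V) (a : V) (r : Option (Fin 3)) (x : Fin 3 → ℝ) :
    V × (Fin 3 → ℝ) :=
  (flipVertex σ a (hexPiece (hexSymm (hexMap r x))),
    hexCoord (hexPiece (hexSymm (hexMap r x))) (hexSymm (hexMap r x)))

open Classical in
/-- The map of triangles inducing a homeomorphism between the complexes of `σ` and of its flip. -/
noncomputable def flipMap (σ : Fin 3 → V → V) (a : V) (v : V) (x : Fin 3 → ℝ) :
    V × (Fin 3 → ℝ) :=
  if h : ∃ r, flipVertex σ a r = v then flipLocal σ a h.choose x else (v, x)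

lemma flipMap_flipVertex (hσ : IsColouring σ) (ha : Function.Injective fun i => σ i a)
    (r : Option (Fin 3)) (x : Fin 3 → ℝ) :
    flipMap σ a (flipVertex σ a r) x = flipLocal σ a r x := by
  have h : ∃ s, flipVertex σ a s = flipVertex σ a r := ⟨r, rfl⟩
  rw [flipMap, dif_pos h, flipVertex_injective hσ ha h.choose_spec]

lemma flipMap_of_ne {v : V} (h : ∀ r, flipVertex σ a r ≠ v) (x : Fin 3 → ℝ) :
    flipMap σ a v x = (v, x) :=
  dif_neg fun ⟨r, hr⟩ => h r hr

lemma hexPiece_samePoint {z : Fin 3 → ℝ} {r : Option (Fin 3)}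
    (h : hexCoord r z ∈ Triangle) :
    SamePoint σ (flipVertex σ a (hexPiece z), hexCoord (hexPiece z) z)
      (flipVertex σ a r, hexCoord r z) := by
  obtain ⟨h1, h2 | ⟨h2, i, rfl, hi⟩⟩ := hexCoord_hexPiece_mem h
  · rw [h2]; exact SamePoint.refl _ _
  · rw [h1, h2]
    exact SamePoint.edge σ a (by simp [hexCoord, hi])

lemma flipLocal_mem {x : Fin 3 → ℝ} (hx : x ∈ Triangle) (r : Option (Fin 3)) :
    (flipLocal σ a r x).2 ∈ Triangle := by
  obtain ⟨s, hs⟩ := exists_hexCoord_mem hx r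
  simp only [flipLocal]
  rwa [(hexCoord_hexPiece_mem hs).1]

lemma flipMap_mem (hσ : IsColouring σ) (ha : Function.Injective fun i => σ i a)
    {x : Fin 3 → ℝ} (hx : x ∈ Triangle) (v : V) : (flipMap σ a v x).2 ∈ Triangle := by
  by_cases h : ∃ r, flipVertex σ a r = v
  · obtain ⟨r, rfl⟩ := h
    rw [flipMap_flipVertex hσ ha]
    exact flipLocal_mem hx r
  · rw [flipMap_of_ne fun r hr => h ⟨r, hr⟩]
    exact hx

lemma flipMap_flipMap (hσ : IsColouring σ) (ha : Function.Injective fun i => σ i a)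
    {x : Fin 3 → ℝ} (hx : x ∈ Triangle) (v : V) :
    SamePoint σ (flipMap σ a (flipMap σ a v x).1 (flipMap σ a v x).2) (v, x) := by
  by_cases h : ∃ r, flipVertex σ a r = v
  · obtain ⟨r, rfl⟩ := h
    rw [flipMap_flipVertex hσ ha]
    simp only [flipLocal]
    rw [flipMap_flipVertex hσ ha]
    simp only [flipLocal]
    rw [hexMap_hexCoord, hexSymm_hexSymm]
    have := hexPiece_samePoint (σ := σ) (a := a) (z := hexMap r x) (r := r)
      (by rwa [hexCoord_hexMap])
    rwa [hexCoord_hexMap] at this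
  · rw [flipMap_of_ne fun r hr => h ⟨r, hr⟩, flipMap_of_ne fun r hr => h ⟨r, hr⟩]
    exact SamePoint.refl _ _

/-- This edge runs from the apex of the triangle `i` to the corner `k` of the central one. Its image
runs from the corner `i` to the apex of the triangle `k`, hence is an edge of that triangle with
unchanged coordinates. -/
lemma hexCoord_edge {x : Fin 3 → ℝ} (hx : x ∈ Triangle) {i k c : Fin 3} (hic : i ≠ c)
    (hik : i ≠ k) (hkc : k ≠ c) (hc : x c = 0) :
    hexCoord (some k) (hexSymm (hexMap (some i) x)) = x := by
  obtain ⟨h0, h1, h2, h3⟩ := mem_triangle.1 hx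
  have hs : x i + x k = 1 := by
    fin_cases i <;> fin_cases k <;> fin_cases c <;> simp at hic hik hkc hc ⊢ <;> linarith
  funext j
  have hj : j = i ∨ j = k ∨ j = c := by
    revert hic hik hkc; clear * -; revert i j k c; decide
  rcases hj with rfl | rfl | rfl
  · simp [hexCoord, hexSymm, hexMap, hik, hik.symm]; linarith
  · simp [hexCoord, hexSymm, hexMap, hik.symm]; linarith
  · simp [hexCoord, hexSymm, hexMap, hkc.symm, hic.symm, hik.symm, hc]; linarith

variable [DecidableEq V]

/-- The exclusion of `a` and `σ c a` leaves the edges of colour `c` that are not inside the hexagon.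
-/
lemma flipMap_edge (hσ : IsColouring σ) (ha : Function.Injective fun i => σ i a)
    {x : Fin 3 → ℝ} (hx : x ∈ Triangle) {c : Fin 3} (hc : x c = 0) {v : V} (hva : v ≠ a)
    (hvc : v ≠ σ c a) :
    SamePoint σ (flipMap σ a v x) (Equiv.swap (σ (c + 1) a) (σ (c + 2) a) v, x) := by
  by_cases h : ∃ r, flipVertex σ a r = v
  · obtain ⟨_ | i, rfl⟩ := h
    · exact absurd rfl hva
    have hic : i ≠ c := fun h => hvc (by rw [h]; rfl)
    obtain ⟨k, hik, hkc⟩ : ∃ k, i ≠ k ∧ k ≠ c := by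
      clear * - hic; revert i c; decide
    rw [flipMap_flipVertex hσ ha, swap_flip_eq (V := V) σ a hic.symm hkc.symm hik]
    have := hexPiece_samePoint (σ := σ) (a := a) (z := hexSymm (hexMap (some i) x)) (r := some k)
      (by rwa [hexCoord_edge hx hic hik hkc hc])
    rw [hexCoord_edge hx hic hik hkc hc] at this
    have e : Equiv.swap (σ i a) (σ k a) (flipVertex σ a (some i)) = flipVertex σ a (some k) :=
      Equiv.swap_apply_left _ _
    rw [e]
    exact this
  · rw [flipMap_of_ne fun r hr => h ⟨r, hr⟩, Equiv.swap_apply_of_ne_of_ne]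
    · exact SamePoint.refl _ _
    · exact fun h' => h ⟨some _, h'.symm⟩
    · exact fun h' => h ⟨some _, h'.symm⟩

/-- Inside the hexagon the symmetry is a single continuous map. Elsewhere `flipMap_edge` applies on
both sides, and the two transpositions cancel those in `flip`. -/
lemma flipMap_glue (hσ : IsColouring σ) (ha : Function.Injective fun i => σ i a)
    (v : V) (c : Fin 3) {x : Fin 3 → ℝ} (hx : x ∈ Triangle) (hc : x c = 0) :
    SamePoint σ (flipMap σ a v x) (flipMap σ a (flip σ a c v) x) := by
  have hac := flip_apply_centre hσ ha c
  have hl : hexMap (some c) x = hexMap none x := by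
    funext j
    by_cases hj : j = c
    · subst hj; simp [hexMap, hc]
    · simp [hexMap, hc, hj]
  have hcentre : flipMap σ a (σ c a) x = flipMap σ a a x := by
    have h1 := flipMap_flipVertex hσ ha (some c) x
    have h2 := flipMap_flipVertex hσ ha none x
    rw [flipLocal, hl] at h1
    rw [flipLocal] at h2
    exact h1.trans h2.symm
  by_cases hva : v = a
  · rw [hva, hac, hcentre]; exact SamePoint.refl _ _
  by_cases hvc : v = σ c a
  · rw [hvc, ← hac, (isColouring_flip hσ a).invol, hac, hcentre]; exact SamePoint.refl _ _
  have h1 := flipMap_edge hσ ha hx hc hva hvc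
  have h2 := flipMap_edge hσ ha hx hc (v := flip σ a c v)
    (fun h => hvc (by rw [← hac, ← (isColouring_flip hσ a).invol c v, h]))
    (fun h => hva ((isColouring_flip hσ a).injective c (h.trans hac.symm)))
  refine h1.trans (SamePoint.trans ?_ (h2.symm hσ))
  rw [flip, Equiv.swap_apply_self]
  exact SamePoint.edge σ _ hc

lemma flipVertex_flip (hσ : IsColouring σ) (ha : Function.Injective fun i => σ i a) :
    flipVertex (flip σ a) a = flipVertex σ a := by
  funext r
  rcases r with _ | i
  · rfl
  · exact flip_apply_centre hσ ha i

/-- The same formula thus serves in both directions, and every fact about `flipMap` may be used for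
`σ` and for its flip. -/
lemma flipMap_flip (hσ : IsColouring σ) (ha : Function.Injective fun i => σ i a) :
    flipMap (flip σ a) a = flipMap σ a := by
  funext v x
  unfold flipMap flipLocal
  rw [flipVertex_flip hσ ha]

/-- The change of barycentric coordinates between triangles of the model hexagon that is induced
by its central symmetry, as an affine map. -/
noncomputable def hexCoordAffine (r s : Option (Fin 3)) : (Fin 3 → ℝ) →ᵃ[ℝ] (Fin 3 → ℝ) :=
  (IsLinearMap.mk' (hexCoord s) ⟨fun x y => by
      rcases s with _ | i
      · rfl
      · funext j; simp only [hexCoord, Option.elim_some, Pi.add_apply]; split_ifs <;> ring,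
    fun c x => by
      rcases s with _ | i
      · rfl
      · funext j
        simp only [hexCoord, Option.elim_some, Pi.smul_apply, smul_eq_mul]
        split_ifs <;> ring⟩).toAffineMap.comp
  ((AffineMap.const ℝ _ (fun _ => 2 / 3 : Fin 3 → ℝ) - AffineMap.id ℝ _).comp
  (IsLinearMap.mk' (hexMap r) ⟨fun x y => by
      rcases r with _ | i
      · rfl
      · funext j; simp only [hexMap, Option.elim_some, Pi.add_apply]; split_ifs <;> ring,
    fun c x => by
      rcases r with _ | i
      · rfl
      · funext j
        simp only [hexMap, Option.elim_some, Pi.smul_apply, smul_eq_mul]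
        split_ifs <;> ring⟩).toAffineMap)

lemma hexCoordAffine_apply (r s : Option (Fin 3)) (x : Fin 3 → ℝ) :
    hexCoordAffine r s x = hexCoord s (hexSymm (hexMap r x)) :=
  rfl

lemma isSphere_of_flip (hσ : IsColouring σ) (ha : Function.Injective fun i => σ i a)
    (h : IsSphere (flip σ a)) : IsSphere σ := by
  have hσ' := isColouring_flip hσ a
  have ha' : Function.Injective fun i => flip σ a i a := by
    simpa only [flip_apply_centre hσ ha] using ha
  have e := flipMap_flip hσ ha
  refine IsSphere.transport hσ (flipMap σ a) (flipMap σ a) (fun v x hx => flipMap_mem hσ ha hx v)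
    (fun v x hx => flipMap_mem hσ ha hx v) (fun v i x hx hi => ?_)
    (fun v i x hx hi => flipMap_glue hσ ha v i hx hi)
    (fun v x hx => flipMap_flipMap hσ ha hx v) (fun v x hx => ?_) (fun φ h1 h2 v => ?_) h
  · have := flipMap_glue hσ' ha' v i hx hi
    rwa [e, flip_flip hσ ha] at this
  · have := flipMap_flipMap hσ' ha' hx v
    rwa [e] at this
  · by_cases h : ∃ r, flipVertex σ a r = v
    · obtain ⟨r, rfl⟩ := h
      -- The triangle is cut according to the triangle `s` that contains the reflected point. On
      -- overlaps `hexPiece` may choose another triangle, which is harmless since `φ` respects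
      -- identifications.
      have hcover : Triangle = ⋃ s : Option (Fin 3), (Triangle ∩ hexCoordAffine r s ⁻¹' Triangle :
          Set (Fin 3 → ℝ)) := by
        ext x
        simp only [Set.mem_iUnion, Set.mem_inter_iff, Set.mem_preimage, hexCoordAffine_apply]
        refine ⟨fun hx => ?_, fun ⟨_, hx, _⟩ => hx⟩
        obtain ⟨s, hs⟩ := exists_hexCoord_mem hx r
        exact ⟨s, hx, hs⟩
      rw [hcover]
      refine IsPLOn.iUnion fun s => ?_
      have hp : IsPolytope (Triangle ∩ hexCoordAffine r s ⁻¹' Triangle) :=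
        (stdSimplex_isPolytope _).inter_preimage (stdSimplex_isPolytope _) _
      refine ((h1 (flipVertex σ a s)).comp (isPLOn_affine hp (hexCoordAffine r s))
        fun x hx => hx.2).congr fun x hx => ?_
      rw [Function.comp_apply, flipMap_flipVertex hσ ha]
      refine (h2 _ _ (flipLocal_mem hx.1 r) _ _ hx.2 ?_).symm
      have := hexPiece_samePoint (σ := flip σ a) (a := a) (z := hexSymm (hexMap r x)) (r := s)
        hx.2
      rw [flipVertex_flip hσ ha] at this
      rw [hexCoordAffine_apply]
      exact this
    · exact (h1 v).congr fun x _ => by rw [flipMap_of_ne fun r hr => h ⟨r, hr⟩]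

end FlipSphere

end Gem

namespace Gem

/-! ### Connectedness and vanishing cohomology under flips. -/

section Acyclic

variable {V : Type*}

/-- The graph coloured by `σ` is connected. -/
def IsConn {ι : Type*} (σ : ι → V → V) : Prop :=
  ∀ A : Set V, (∀ i, ∀ v ∈ A, σ i v ∈ A) → A.Nonempty → A = Set.univ

/-- The first cohomology of the surface of the 3-coloured graph `σ` with coefficients in `ℤ/2`
vanishes: every Čech 1-cocycle of the cover by the stars of its vertices is a coboundary. -/
def IsAcyclic (σ : Fin 3 → V → V) : Prop :=
  ∀ h : Fin 3 → V → ZMod 2,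
    (∀ i j k, i ≠ j → i ≠ k → j ≠ k → ∀ v, h i (σ k v) + h j (σ k v) = h i v + h j v) →
    ∃ f : V → ZMod 2, ∀ i k, i ≠ k → ∀ v, f (σ i v) + h k (σ i v) = f v + h k v

lemma zmod_two_add_self (x : ZMod 2) : x + x = 0 := CharTwo.add_self_eq_zero x

lemma fin3_third {i j : Fin 3} (hij : i ≠ j) : ∃ k, i ≠ k ∧ j ≠ k := by
  revert i j; decide

lemma fin3_eq_third {i j k l : Fin 3} (hij : i ≠ j) (hik : i ≠ k) (hjk : j ≠ k) :
    l = i ∨ l = j ∨ l = k := by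
  revert i j k l; decide

variable [DecidableEq V] {σ : Fin 3 → V → V} {a : V}

/-- A closed set contains all or none of the four triangles of the hexagon, so it is unaffected by
the transpositions. -/
lemma isConn_flip (hσ : IsColouring σ) (ha : Function.Injective fun i => σ i a)
    (h : IsConn σ) : IsConn (flip σ a) := by
  intro A hA hne
  have hb : ∀ i, σ i a ∈ A ↔ a ∈ A := fun i => by
    rw [← flip_apply_centre hσ ha]
    refine ⟨fun h => ?_, hA i a⟩
    have := hA i _ h
    rwa [(isColouring_flip hσ a).invol] at this
  have hs : ∀ i v, Equiv.swap (σ (i + 1) a) (σ (i + 2) a) v ∈ A ↔ v ∈ A := fun i v => by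
    rcases eq_or_ne v (σ (i + 1) a) with rfl | h1
    · rw [Equiv.swap_apply_left, hb, hb]
    rcases eq_or_ne v (σ (i + 2) a) with rfl | h2
    · rw [Equiv.swap_apply_right, hb, hb]
    rw [Equiv.swap_apply_of_ne_of_ne h1 h2]
  refine h A (fun i v hv => ?_) hne
  have := hA i _ ((hs i v).2 hv)
  rw [flip, Equiv.swap_apply_self, hs] at this
  exact this

/-- The cocycle is normalized so that it has one value at each of the six corners of the hexagon.
These values are read off on the other triangulation, and the resulting potential is transported
back. -/
lemma isAcyclic_flip (hσ : IsColouring σ) (ha : Function.Injective fun i => σ i a)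
    (h : IsAcyclic σ) : IsAcyclic (flip σ a) := by
  have hσ' := isColouring_flip hσ a
  have hcen := flip_apply_centre hσ ha
  have hbne : ∀ {i j}, i ≠ j → σ i a ≠ σ j a := fun hij h => hij (ha h)
  intro h₀ hh₀
  -- Adding the same `f₀` to all three components leaves their pairwise sums, hence the cocycle,
  -- unchanged. At `σ k a` the two conditions `i ≠ k` prescribe the same value by the cocycle
  -- identity.
  obtain ⟨f₀, hf₀⟩ : ∃ f₀ : V → ZMod 2, f₀ a = 0 ∧
      ∀ i k, i ≠ k → f₀ (σ k a) + h₀ i (σ k a) = f₀ a + h₀ i a := by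
    refine ⟨fun v => if v = σ 0 a then h₀ 1 a + h₀ 1 v else if v = σ 1 a then h₀ 2 a + h₀ 2 v
      else if v = σ 2 a then h₀ 0 a + h₀ 0 v else 0, ?_, ?_⟩
    · simp [(hσ.ne _ _).symm]
    · have e : ∀ i j k, i ≠ j → i ≠ k → j ≠ k →
          h₀ i (σ k a) + h₀ j (σ k a) = h₀ i a + h₀ j a := fun i j k hij hik hjk => by
        have := hh₀ i j k hij hik hjk a
        rwa [hcen] at this
      have e0 := e 1 2 0 (by decide) (by decide) (by decide)
      have e1 := e 2 0 1 (by decide) (by decide) (by decide)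
      have e2 := e 0 1 2 (by decide) (by decide) (by decide)
      have n01 : σ 0 a ≠ σ 1 a := hbne (by decide)
      have n02 : σ 0 a ≠ σ 2 a := hbne (by decide)
      have n12 : σ 1 a ≠ σ 2 a := hbne (by decide)
      have p1 : ∀ x y : ZMod 2, y + x + x = 0 + y := by decide
      have p2 : ∀ x y z w : ZMod 2, x + y = z + w → z + x + y = 0 + w := by decide
      intro i k hik
      dsimp only
      rw [if_neg (hσ.ne 0 a).symm, if_neg (hσ.ne 1 a).symm, if_neg (hσ.ne 2 a).symm]
      rcases (show k = 0 ∨ k = 1 ∨ k = 2 from fin3_cases k 0) with rfl | rfl | rfl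
      · rw [if_pos rfl]
        rcases (show i = 0 ∨ i = 1 ∨ i = 2 from fin3_cases i 0) with rfl | rfl | rfl
        exacts [absurd rfl hik, p1 _ _, p2 _ _ _ _ e0]
      · rw [if_neg n01.symm, if_pos rfl]
        rcases (show i = 1 ∨ i = 2 ∨ i = 0 from fin3_cases i 1) with rfl | rfl | rfl
        exacts [absurd rfl hik, p1 _ _, p2 _ _ _ _ e1]
      · rw [if_neg n02.symm, if_neg n12.symm, if_pos rfl]
        rcases (show i = 2 ∨ i = 0 ∨ i = 1 from fin3_cases i 2) with rfl | rfl | rfl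
        exacts [absurd rfl hik, p1 _ _, p2 _ _ _ _ e2]
  obtain ⟨g, hg, hn⟩ : ∃ g : Fin 3 → V → ZMod 2, (∀ i v, g i v = f₀ v + h₀ i v) ∧
      ∀ i k, i ≠ k → g i (σ k a) = g i a :=
    ⟨fun i v => f₀ v + h₀ i v, fun _ _ => rfl, hf₀.2⟩
  have hgc : ∀ i j k, i ≠ j → i ≠ k → j ≠ k → ∀ v,
      g i (flip σ a k v) + g j (flip σ a k v) = g i v + g j v := fun i j k hij hik hjk v => by
    have := hh₀ i j k hij hik hjk v
    have e : ∀ x y z : ZMod 2, x + y + (x + z) = y + z := by decide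
    simp only [hg, e, this]
  suffices ∃ f : V → ZMod 2, ∀ i k, i ≠ k → ∀ v,
      f (flip σ a i v) + g k (flip σ a i v) = f v + g k v by
    obtain ⟨f, hf⟩ := this
    exact ⟨fun v => f v + f₀ v, fun i k hik v => by simpa only [hg, add_assoc] using hf i k hik v⟩
  -- After the flip the corner of colour `i` of `a` is the former apex of `σ i a`, and the former
  -- corner of `a` belongs only to `σ i a` among the four triangles. So `H i` takes the value `g i
  -- a` at the apex and `g i (σ i a)` at the corner.
  let H : Fin 3 → V → ZMod 2 := fun i v => if v = a then g i (σ i a) else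
    if v = σ i a then g i a else if ∃ j, v = σ j a then g i (σ i a) else g i v
  have Ha : ∀ i, H i a = g i (σ i a) := fun i => by simp [H]
  have Hi : ∀ i, H i (σ i a) = g i a := fun i => by simp [H, hσ.ne]
  have Hj : ∀ i j, i ≠ j → H i (σ j a) = g i (σ i a) := fun i j hij => by
    simp only [H]
    rw [if_neg (hσ.ne j a), if_neg (hbne hij.symm), if_pos ⟨j, rfl⟩]
  have Ho : ∀ i v, v ≠ a → (∀ j, v ≠ σ j a) → H i v = g i v := fun i v h1 h2 => by
    simp [H, h1, h2]
  have hswap : ∀ i j k, i ≠ j → i ≠ k → j ≠ k → ∀ v, v ≠ a → v ≠ σ k a →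
      H i v + H j v = g i (Equiv.swap (σ (k + 1) a) (σ (k + 2) a) v) +
        g j (Equiv.swap (σ (k + 1) a) (σ (k + 2) a) v) := by
    intro i j k hij hik hjk v h1 h2
    rw [swap_flip_eq σ a hik.symm hjk.symm hij]
    rcases eq_or_ne v (σ i a) with rfl | h3
    · rw [Equiv.swap_apply_left, Hi, Hj j i hij.symm, hn i j hij]
    rcases eq_or_ne v (σ j a) with rfl | h4
    · rw [Equiv.swap_apply_right, Hi, Hj i j hij, hn j i hij.symm]
    have h5 : ∀ l, v ≠ σ l a := fun l => by
      rcases fin3_eq_third (l := l) hij hik hjk with rfl | rfl | rfl <;> assumption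
    rw [Equiv.swap_apply_of_ne_of_ne h3 h4, Ho _ _ h1 h5, Ho _ _ h1 h5]
  have hne : ∀ k v, v ≠ a → v ≠ σ k a → σ k v ≠ a ∧ σ k v ≠ σ k a := fun k v h1 h2 =>
    ⟨fun h => h2 (by rw [← h, hσ.invol]), fun h => h1 (hσ.injective k h)⟩
  obtain ⟨f, hf⟩ := h H fun i j k hij hik hjk v => by
    rcases eq_or_ne v a with rfl | h1
    · rw [Hj i k hik, Hj j k hjk, Ha, Ha]
    rcases eq_or_ne v (σ k a) with rfl | h2
    · rw [hσ.invol, Hj i k hik, Hj j k hjk, Ha, Ha]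
    obtain ⟨h3, h4⟩ := hne k v h1 h2
    rw [hswap i j k hij hik hjk _ h3 h4, hswap i j k hij hik hjk _ h1 h2]
    have := hgc i j k hij hik hjk (Equiv.swap (σ (k + 1) a) (σ (k + 2) a) v)
    rwa [flip, Equiv.swap_apply_self] at this
  -- The potential is constant on the hexagon, as `H k` agrees on `a` and `σ i a` for `k ≠ i`.
  have hfa : ∀ i, f (σ i a) = f a := fun i => by
    obtain ⟨k, hik⟩ : ∃ k, i ≠ k := ⟨_, fin3_ne_add_one i⟩
    have := hf i k hik a
    rwa [Hj k i hik.symm, Ha, add_left_inj] at this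
  have hswap' : ∀ i k, i ≠ k → ∀ v, v ≠ a → v ≠ σ i a → f v + g k v =
      f (Equiv.swap (σ (i + 1) a) (σ (i + 2) a) v) +
        H k (Equiv.swap (σ (i + 1) a) (σ (i + 2) a) v) := by
    intro i k hik v h1 h2
    obtain ⟨j, hij, hkj⟩ := fin3_third hik
    rw [swap_flip_eq σ a hik hij hkj]
    rcases eq_or_ne v (σ k a) with rfl | h3
    · rw [Equiv.swap_apply_left, Hj k j hkj, hfa, hfa]
    rcases eq_or_ne v (σ j a) with rfl | h4
    · rw [Equiv.swap_apply_right, Hi, hfa, hfa, hn k j hkj]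
    have h5 : ∀ l, v ≠ σ l a := fun l => by
      rcases fin3_eq_third (l := l) hik hij hkj with rfl | rfl | rfl <;> assumption
    rw [Equiv.swap_apply_of_ne_of_ne h3 h4, Ho _ _ h1 h5]
  refine ⟨f, fun i k hik v => ?_⟩
  rcases eq_or_ne v a with rfl | h1
  · rw [hcen, hfa, hn k i hik.symm]
  rcases eq_or_ne v (σ i a) with rfl | h2
  · rw [← hcen i, hσ'.invol, hcen, hfa, hn k i hik.symm]
  have h3 : flip σ a i v ≠ a := fun h => h2 (by rw [← hcen, ← hσ'.invol i v, h])
  have h4 : flip σ a i v ≠ σ i a := fun h => h1 (hσ'.injective i (h.trans (hcen i).symm))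
  rw [hswap' i k hik _ h3 h4, hswap' i k hik _ h1 h2, flip, Equiv.swap_apply_self]
  exact hf i k hik _

/-- A proper subset that is closed under two of the colours becomes smaller by a suitable flip. -/
lemma exists_closed_flip (hσ : IsColouring σ) (ha : Function.Injective fun i => σ i a)
    {k : Fin 3} {S : Finset V} (hS : ∀ i, i ≠ k → ∀ v ∈ S, σ i v ∈ S) (haS : a ∈ S)
    (hk : σ k a ∉ S) : ∃ S' : Finset V, S'.card < S.card ∧ S'.Nonempty ∧ a ∉ S' ∧
      ∀ i, i ≠ k → ∀ v ∈ S', flip σ a i v ∈ S' := by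
  have hbne : ∀ {i j}, i ≠ j → σ i a ≠ σ j a := fun hij h => hij (ha h)
  have k1 := fin3_ne_add_one k
  have k2 := fin3_ne_add_two k
  have k12 : k + 1 ≠ k + 2 := by clear * -; revert k; decide
  -- Three of the four triangles contain the corner of colour `k` of `a`; after the flip only the
  -- one called `σ k a` does. The new set is `T` with `σ k a` added, a net loss of two.
  set T := ((S.erase a).erase (σ (k + 1) a)).erase (σ (k + 2) a) with hT
  have hmem : ∀ i, i ≠ k → ∀ v ∈ insert (σ k a) T, flip σ a i v ∈ insert (σ k a) T := by
    intro i hik v hv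
    obtain ⟨j, hij, hkj⟩ := fin3_third hik
    have hTm : ∀ w, w ∈ T ↔ w ∈ S ∧ w ≠ a ∧ w ≠ σ i a ∧ w ≠ σ j a := by
      intro w
      have : (w ≠ σ (k + 1) a ∧ w ≠ σ (k + 2) a) ↔ (w ≠ σ i a ∧ w ≠ σ j a) := by
        rcases fin3_cases i k with rfl | rfl | rfl
        · exact absurd rfl hik
        · rcases fin3_cases j k with rfl | rfl | rfl
          · exact absurd rfl hkj
          · exact absurd rfl hij
          · rfl
        · rcases fin3_cases j k with rfl | rfl | rfl
          · exact absurd rfl hkj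
          · exact and_comm
          · exact absurd rfl hij
      simp only [hT, Finset.mem_erase]
      tauto
    have hiS := hS i hik a haS
    have hjS := hS j hkj.symm a haS
    rw [flip, swap_flip_eq σ a hij hik hkj.symm]
    rw [Finset.mem_insert] at hv
    have hu : ∃ u ∈ S, u ≠ a ∧ u ≠ σ i a ∧ u ≠ σ k a ∧ Equiv.swap (σ j a) (σ k a) v = u := by
      rcases hv with rfl | hv
      · exact ⟨σ j a, hjS, hσ.ne _ _, hbne hij.symm, hbne hkj.symm, Equiv.swap_apply_right _ _⟩
      · obtain ⟨h1, h2, h3, h4⟩ := (hTm v).1 hv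
        have h5 : v ≠ σ k a := fun h => hk (h ▸ h1)
        exact ⟨v, h1, h2, h3, h5, Equiv.swap_apply_of_ne_of_ne h4 h5⟩
    obtain ⟨u, hu, hua, hui, -, hvu⟩ := hu
    rw [hvu]
    have h1 := hS i hik u hu
    have h2 : σ i u ≠ σ k a := fun h => hk (h ▸ h1)
    rw [Finset.mem_insert]
    rcases eq_or_ne (σ i u) (σ j a) with h3 | h3
    · rw [h3, Equiv.swap_apply_left]; exact Or.inl rfl
    · rw [Equiv.swap_apply_of_ne_of_ne h3 h2, hTm]
      exact Or.inr ⟨h1, fun h => hui (by rw [← h, hσ.invol]), fun h => hua (hσ.injective i h), h3⟩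
  refine ⟨insert (σ k a) T, ?_, ⟨_, Finset.mem_insert_self _ _⟩, ?_, hmem⟩
  · have c1 : σ (k + 1) a ∈ S.erase a :=
      Finset.mem_erase.2 ⟨hσ.ne _ _, hS _ k1.symm a haS⟩
    have c2 : σ (k + 2) a ∈ (S.erase a).erase (σ (k + 1) a) :=
      Finset.mem_erase.2 ⟨hbne k12.symm, Finset.mem_erase.2 ⟨hσ.ne _ _, hS _ k2.symm a haS⟩⟩
    have e0 := Finset.card_erase_add_one haS
    have e1 := Finset.card_erase_add_one c1
    have e2 := Finset.card_erase_add_one c2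
    have e3 := Finset.card_insert_le (σ k a) T
    rw [← hT] at e2
    omega
  · simp [hT, (hσ.ne k a).symm]

end Acyclic

end Gem

namespace Gem

/-! ### Pillows: two triangles with two common edges. -/

section Pillow

variable {V : Type*}

/-- The vertices `a` and `b` are joined by edges of both colours other than `k`, but not by an edge
of colour `k`. -/
structure IsPillow (σ : Fin 3 → V → V) (k : Fin 3) (a b : V) : Prop where
  colouring : IsColouring σ
  edge : ∀ i, i ≠ k → σ i a = b
  third : σ k a ≠ b

/-! ### Sliding points of a triangle parallel to a median -/

/-- The greatest value of the `k`-th coordinate on the line through `x` parallel to the median of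
the triangle through the vertex `k`. -/
noncomputable def slideMax (k : Fin 3) (x : Fin 3 → ℝ) : ℝ :=
  x k + 2 * min (x (k + 1)) (x (k + 2))

/-- The point with `k`-th coordinate `t` on the line through `x` parallel to the median of the
triangle through the vertex `k`. -/
noncomputable def slide (k : Fin 3) (x : Fin 3 → ℝ) (t : ℝ) : Fin 3 → ℝ :=
  fun j => if j = k then t else x j + (x k - t) / 2

@[simp] lemma slide_self (k : Fin 3) (x : Fin 3 → ℝ) (t : ℝ) : slide k x t k = t := by
  simp [slide]

@[simp] lemma slide_slide (k : Fin 3) (x : Fin 3 → ℝ) (s t : ℝ) :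
    slide k (slide k x s) t = slide k x t := by
  funext j
  by_cases h : j = k
  · simp [slide, h]
  · simp [slide, h]; ring

lemma slide_eq (k : Fin 3) (x : Fin 3 → ℝ) {t : ℝ} (h : t = x k) : slide k x t = x := by
  funext j
  by_cases h' : j = k <;> simp [slide, h, h']

@[simp] lemma slideMax_slide (k : Fin 3) (x : Fin 3 → ℝ) (t : ℝ) :
    slideMax k (slide k x t) = slideMax k x := by
  have h1 : k + 1 ≠ k := (fin3_ne_add_one k).symm
  have h2 : k + 2 ≠ k := (fin3_ne_add_two k).symm
  simp only [slideMax, slide, if_true, if_neg h1, if_neg h2]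
  rw [min_add_add_right]
  ring

lemma sum_slide (k : Fin 3) (x : Fin 3 → ℝ) : x k + x (k + 1) + x (k + 2) = x 0 + x 1 + x 2 := by
  fin_cases k
  · rfl
  · change x 1 + x 2 + x 0 = _; ring
  · change x 2 + x 0 + x 1 = _; ring

lemma mem_triangle' (k : Fin 3) {x : Fin 3 → ℝ} :
    x ∈ Triangle ↔ 0 ≤ x k ∧ 0 ≤ x (k + 1) ∧ 0 ≤ x (k + 2) ∧ x k + x (k + 1) + x (k + 2) = 1 := by
  rw [sum_slide, mem_triangle]
  fin_cases k
  · rfl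
  · change _ ↔ 0 ≤ x 1 ∧ 0 ≤ x 2 ∧ 0 ≤ x 0 ∧ _; tauto
  · change _ ↔ 0 ≤ x 2 ∧ 0 ≤ x 0 ∧ 0 ≤ x 1 ∧ _; tauto

lemma le_slideMax (k : Fin 3) {x : Fin 3 → ℝ} (hx : x ∈ Triangle) : x k ≤ slideMax k x := by
  obtain ⟨h0, h1, h2, h3⟩ := (mem_triangle' k).1 hx
  have := le_min h1 h2
  rw [slideMax]; linarith

lemma slide_mem (k : Fin 3) {x : Fin 3 → ℝ} (hx : x ∈ Triangle) {t : ℝ} (h0 : 0 ≤ t)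
    (ht : t ≤ slideMax k x) : slide k x t ∈ Triangle := by
  obtain ⟨-, -, -, h3⟩ := (mem_triangle' k).1 hx
  have h1 : k + 1 ≠ k := (fin3_ne_add_one k).symm
  have h2 : k + 2 ≠ k := (fin3_ne_add_two k).symm
  rw [slideMax] at ht
  have := min_le_left (x (k + 1)) (x (k + 2))
  have := min_le_right (x (k + 1)) (x (k + 2))
  simp only [mem_triangle' k, slide, if_true, if_neg h1, if_neg h2]
  refine ⟨h0, ?_, ?_, ?_⟩ <;> linarith

/-- The points on the two edges through the vertex `k` are the upper ends of their lines. -/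
lemma slideMax_eq (k : Fin 3) {x : Fin 3 → ℝ} (hx : x ∈ Triangle) {i : Fin 3} (hik : i ≠ k)
    (hi : x i = 0) : slideMax k x = x k := by
  obtain ⟨-, h1, h2, -⟩ := (mem_triangle' k).1 hx
  have : min (x (k + 1)) (x (k + 2)) = 0 := by
    rcases fin3_cases i k with rfl | rfl | rfl
    · exact absurd rfl hik
    · rw [hi, min_eq_left h2]
    · rw [hi, min_eq_right h1]
  rw [slideMax, this]; ring

lemma exists_of_slideMax_eq (k : Fin 3) {x : Fin 3 → ℝ} (h : slideMax k x = x k) :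
    ∃ i, i ≠ k ∧ x i = 0 := by
  rw [slideMax] at h
  have : min (x (k + 1)) (x (k + 2)) = 0 := by linarith
  rcases min_choice (x (k + 1)) (x (k + 2)) with h' | h'
  · exact ⟨k + 1, (fin3_ne_add_one k).symm, by rw [← h', this]⟩
  · exact ⟨k + 2, (fin3_ne_add_two k).symm, by rw [← h', this]⟩

lemma isPLOn_coord {X : Set (Fin 3 → ℝ)} (hX : IsCompactPolyhedron X) (i : Fin 3) :
    IsPLOn (fun x : Fin 3 → ℝ => x i) X :=
  hX.isPLOn (AffineMap.proj i : (Fin 3 → ℝ) →ᵃ[ℝ] ℝ)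

lemma isPLOn_slideMax (k : Fin 3) : IsPLOn (slideMax k) Triangle := by
  have h := isPLOn_coord (isCompactPolyhedron_stdSimplex (Fin 3))
  exact (h k).add (((h (k + 1)).min (h (k + 2))).const_smul 2)

lemma isPLOn_slide (k : Fin 3) {t : (Fin 3 → ℝ) → ℝ} (ht : IsPLOn t Triangle) :
    IsPLOn (fun x => slide k x (t x)) Triangle := by
  have hT := isCompactPolyhedron_stdSimplex (Fin 3)
  have h := isPLOn_coord hT
  refine IsPLOn.pi hT fun j => ?_
  by_cases hj : j = k
  · simpa [slide, hj] using ht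
  · refine ((h j).add (((h k).sub ht).const_smul (1 / 2))).congr fun x _ => ?_
    simp only [slide, if_neg hj, smul_eq_mul]
    ring

/-! ### Removing a pillow -/

variable {σ : Fin 3 → V → V} {k : Fin 3} {a b : V}

namespace IsPillow

variable (h : IsPillow σ k a b)

include h

lemma edge' {i : Fin 3} (hi : i ≠ k) : σ i b = a := by
  rw [← h.edge i hi, h.colouring.invol]

lemma ne : a ≠ b := by
  rw [← h.edge (k + 1) (fin3_ne_add_one k).symm]
  exact (h.colouring.ne _ _).symm

lemma symm : IsPillow σ k b a :=
  ⟨h.colouring, fun _ hi => h.edge' hi, fun h' => h.third (by rw [← h', h.colouring.invol])⟩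

lemma apply_ne {v : V} (hv : v ≠ a ∧ v ≠ b) {i : Fin 3} (hi : i ≠ k) : σ i v ≠ a ∧ σ i v ≠ b :=
  ⟨fun h' => hv.2 (by rw [← h.edge i hi, ← h', h.colouring.invol]),
    fun h' => hv.1 (by rw [← h.edge' hi, ← h', h.colouring.invol])⟩

end IsPillow

variable [DecidableEq V]

/-- The colouring obtained by removing the pillow formed by `a` and `b` and joining the neighbours
of `a` and `b` of the third colour `k`. -/
def removePillow (h : IsPillow σ k a b) (i : Fin 3) (v : {v // v ≠ a ∧ v ≠ b}) :
    {v // v ≠ a ∧ v ≠ b} :=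
  if h1 : σ i v = a then ⟨σ k b, h.symm.third, h.colouring.ne _ _⟩ else
    if h2 : σ i v = b then ⟨σ k a, h.colouring.ne _ _, h.third⟩ else ⟨σ i v, h1, h2⟩

variable (h : IsPillow σ k a b)

lemma removePillow_of_ne {i : Fin 3} (v : {v // v ≠ a ∧ v ≠ b}) (hi : i ≠ k) :
    (removePillow h i v : V) = σ i v := by
  obtain ⟨h1, h2⟩ := h.apply_ne v.2 hi
  rw [removePillow, dif_neg h1, dif_neg h2]

lemma removePillow_left : (removePillow h k ⟨σ k a, h.colouring.ne _ _, h.third⟩ : V) = σ k b := by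
  rw [removePillow, dif_pos (h.colouring.invol _ _)]

lemma removePillow_right :
    (removePillow h k ⟨σ k b, h.symm.third, h.colouring.ne _ _⟩ : V) = σ k a := by
  have e := h.colouring.invol k b
  rw [removePillow, dif_neg (by rw [e]; exact h.ne.symm), dif_pos e]

lemma removePillow_other (v : {v // v ≠ a ∧ v ≠ b}) (h1 : (v : V) ≠ σ k a) (h2 : (v : V) ≠ σ k b) :
    (removePillow h k v : V) = σ k v := by
  rw [removePillow, dif_neg fun h' => h1 (h.colouring.eq_apply h'),
    dif_neg fun h' => h2 (h.colouring.eq_apply h')]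

lemma isColouring_removePillow : IsColouring (removePillow h) := by
  have hσ := h.colouring
  have hd : σ k a ≠ σ k b := fun h' => h.ne (hσ.injective k h')
  constructor
  · intro i v
    apply Subtype.ext
    by_cases hi : i = k
    · subst hi
      by_cases h1 : (v : V) = σ i a
      · obtain rfl : v = ⟨σ i a, hσ.ne _ _, h.third⟩ := Subtype.ext h1
        have e : removePillow h i ⟨σ i a, hσ.ne _ _, h.third⟩ =
          ⟨σ i b, h.symm.third, hσ.ne _ _⟩ := Subtype.ext (removePillow_left h)
        rw [e, removePillow_right]
      by_cases h2 : (v : V) = σ i b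
      · obtain rfl : v = ⟨σ i b, h.symm.third, hσ.ne _ _⟩ := Subtype.ext h2
        have e : removePillow h i ⟨σ i b, h.symm.third, hσ.ne _ _⟩ =
          ⟨σ i a, hσ.ne _ _, h.third⟩ := Subtype.ext (removePillow_right h)
        rw [e, removePillow_left]
      · have e := removePillow_other h v h1 h2
        rw [removePillow_other h _ (by rw [e]; exact fun h' => v.2.1 (hσ.injective i h'))
          (by rw [e]; exact fun h' => v.2.2 (hσ.injective i h')), e, hσ.invol]
    · rw [removePillow_of_ne h _ hi, removePillow_of_ne h _ hi, hσ.invol]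
  · intro i v h'
    have h' := congrArg Subtype.val h'
    by_cases hi : i = k
    · subst hi
      by_cases h1 : (v : V) = σ i a
      · obtain rfl : v = ⟨σ i a, hσ.ne _ _, h.third⟩ := Subtype.ext h1
        rw [removePillow_left] at h'
        exact hd h'.symm
      by_cases h2 : (v : V) = σ i b
      · obtain rfl : v = ⟨σ i b, h.symm.third, hσ.ne _ _⟩ := Subtype.ext h2
        rw [removePillow_right] at h'
        exact hd h'
      · rw [removePillow_other h v h1 h2] at h'
        exact hσ.ne _ _ h'
    · rw [removePillow_of_ne h _ hi] at h'
      exact hσ.ne _ _ h'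

/-- A closed set is extended by `a` and `b` when it contains `σ k a`, equivalently `σ k b`. -/
lemma isConn_removePillow (hc : IsConn σ) : IsConn (removePillow h) := by
  have hσ := h.colouring
  intro A hA hne
  have hmem : ∀ {v} (hv : v ≠ a ∧ v ≠ b) {w} (hw : w ≠ a ∧ w ≠ b) i, (⟨v, hv⟩ : {v // v ≠ a ∧ v ≠ b}) ∈ A →
      (removePillow h i ⟨v, hv⟩ : V) = w → (⟨w, hw⟩ : {v // v ≠ a ∧ v ≠ b}) ∈ A := by
    intro v hv w hw i hvA e
    have := hA i _ hvA
    rwa [show removePillow h i ⟨v, hv⟩ = ⟨w, hw⟩ from Subtype.ext e] at this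
  let c : {v // v ≠ a ∧ v ≠ b} := ⟨σ k a, hσ.ne _ _, h.third⟩
  let d : {v // v ≠ a ∧ v ≠ b} := ⟨σ k b, h.symm.third, hσ.ne _ _⟩
  have hcd : c ∈ A ↔ d ∈ A := ⟨fun hh => hmem _ _ k hh (removePillow_left h),
    fun hh => hmem _ _ k hh (removePillow_right h)⟩
  let B : Set V := {v | (∃ hv, (⟨v, hv⟩ : {v // v ≠ a ∧ v ≠ b}) ∈ A) ∨ (v = a ∨ v = b) ∧ c ∈ A}
  have hB : B = Set.univ := by
    refine hc B ?_ ?_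
    · rintro i v (⟨hv, hvA⟩ | ⟨rfl | rfl, hcA⟩)
      · by_cases hi : i = k
        · subst hi
          by_cases h1 : v = σ i a
          · subst h1
            exact Or.inr ⟨Or.inl (hσ.invol _ _), hvA⟩
          by_cases h2 : v = σ i b
          · subst h2
            exact Or.inr ⟨Or.inr (hσ.invol _ _), hcd.2 hvA⟩
          · have hw : σ i v ≠ a ∧ σ i v ≠ b := ⟨fun h' => h1 (by rw [← h', hσ.invol]),
              fun h' => h2 (by rw [← h', hσ.invol])⟩
            exact Or.inl ⟨hw, hmem hv hw i hvA (removePillow_other h ⟨v, hv⟩ h1 h2)⟩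
        · exact Or.inl ⟨h.apply_ne hv hi, hmem hv _ i hvA (removePillow_of_ne h ⟨v, hv⟩ hi)⟩
      · by_cases hi : i = k
        · subst hi
          exact Or.inl ⟨_, hcA⟩
        · exact Or.inr ⟨Or.inr (h.edge i hi), hcA⟩
      · by_cases hi : i = k
        · subst hi
          exact Or.inl ⟨_, hcd.1 hcA⟩
        · exact Or.inr ⟨Or.inl (h.edge' hi), hcA⟩
    · obtain ⟨v, hv⟩ := hne
      exact ⟨v, Or.inl ⟨v.2, hv⟩⟩
  refine Set.eq_univ_of_forall fun v => ?_
  rcases (hB ▸ Set.mem_univ (v : V) : (v : V) ∈ B) with ⟨_, hv⟩ | ⟨h1 | h1, -⟩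
  · exact hv
  · exact absurd h1 v.2.1
  · exact absurd h1 v.2.2

lemma isAcyclic_removePillow (hq : IsAcyclic σ) : IsAcyclic (removePillow h) := by
  have hσ := h.colouring
  have hd : σ k a ≠ σ k b := fun h' => h.ne (hσ.injective k h')
  intro g hg
  let c : {v // v ≠ a ∧ v ≠ b} := ⟨σ k a, hσ.ne _ _, h.third⟩
  let d : {v // v ≠ a ∧ v ≠ b} := ⟨σ k b, h.symm.third, hσ.ne _ _⟩
  have hcd : removePillow h k c = d := Subtype.ext (removePillow_left h)
  -- The corner of colour `k` of the pillow lies in no other triangle, so its value is free and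
  -- taken to be `0`. The two other corners are shared with the neighbour `c`, which dictates their
  -- values.
  let H : Fin 3 → V → ZMod 2 := fun i v => if hv : v ≠ a ∧ v ≠ b then g i ⟨v, hv⟩ else
    if i = k then 0 else g i c
  have Hv : ∀ i v (hv : v ≠ a ∧ v ≠ b), H i v = g i ⟨v, hv⟩ := fun i v hv => dif_pos hv
  have Ha : ∀ i, i ≠ k → H i a = g i c := fun i hi => by simp [H, hi]
  have Hb : ∀ i, i ≠ k → H i b = g i c := fun i hi => by simp [H, hi]
  have Hk : H k a = 0 ∧ H k b = 0 := by simp [H]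
  have Hab : ∀ i, H i a = H i b := fun i => by simp [H]
  have hab : ∀ v, ¬ (v ≠ a ∧ v ≠ b) → v = a ∨ v = b := fun v hv => by tauto
  have hH : ∀ i j l, i ≠ j → i ≠ l → j ≠ l → ∀ v, H i (σ l v) + H j (σ l v) = H i v + H j v := by
    intro i j l hij hil hjl v
    by_cases hv : v ≠ a ∧ v ≠ b
    · by_cases hl : l = k
      · subst hl
        by_cases h1 : v = σ l a
        · subst h1
          rw [hσ.invol, Ha i hil, Ha j hjl, Hv _ _ hv, Hv _ _ hv]
        by_cases h2 : v = σ l b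
        · subst h2
          rw [hσ.invol, Hb i hil, Hb j hjl, Hv _ _ hv, Hv _ _ hv]
          have := hg i j l hij hil hjl c
          rw [hcd] at this
          exact this.symm
        · have := hg i j l hij hil hjl ⟨v, hv⟩
          have e := removePillow_other h ⟨v, hv⟩ h1 h2
          rw [Hv i _ hv, Hv j _ hv, ← this]
          change H i (σ l (⟨v, hv⟩ : {v // v ≠ a ∧ v ≠ b})) +
            H j (σ l (⟨v, hv⟩ : {v // v ≠ a ∧ v ≠ b})) = _
          rw [← e, Hv i _ (removePillow h l ⟨v, hv⟩).2, Hv j _ (removePillow h l ⟨v, hv⟩).2]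
      · have := hg i j l hij hil hjl ⟨v, hv⟩
        have e := removePillow_of_ne h ⟨v, hv⟩ hl
        rw [Hv i _ hv, Hv j _ hv, ← this]
        change H i (σ l (⟨v, hv⟩ : {v // v ≠ a ∧ v ≠ b})) +
          H j (σ l (⟨v, hv⟩ : {v // v ≠ a ∧ v ≠ b})) = _
        rw [← e, Hv i _ (removePillow h l ⟨v, hv⟩).2, Hv j _ (removePillow h l ⟨v, hv⟩).2]
    · by_cases hl : l = k
      · subst hl
        rcases hab v hv with rfl | rfl
        · rw [Ha i hil, Ha j hjl, Hv _ _ c.2, Hv _ _ c.2]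
        · rw [Hb i hil, Hb j hjl, Hv _ _ d.2, Hv _ _ d.2]
          have := hg i j l hij hil hjl c
          rw [hcd] at this
          exact this
      · rcases hab v hv with rfl | rfl
        · rw [h.edge l hl, Hab, Hab]
        · rw [h.edge' hl, Hab, Hab]
  obtain ⟨f, hf⟩ := hq H hH
  have e1 : ∀ i, i ≠ k → f c = f a := fun i hi => by
    have := hf k i hi.symm a
    rwa [Ha i hi, Hv i _ ⟨hσ.ne _ _, h.third⟩, add_left_inj] at this
  obtain ⟨i₀, hi₀⟩ : ∃ i, i ≠ k := ⟨_, (fin3_ne_add_one k).symm⟩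
  have e2 : f b = f a := by
    have := hf i₀ k hi₀ a
    rwa [h.edge i₀ hi₀, Hk.1, Hk.2, add_zero, add_zero] at this
  have key : ∀ i, i ≠ k → f d + g i d = f c + g i c := fun i hi => by
    have := hf k i hi.symm b
    rw [Hb i hi, Hv i _ ⟨h.symm.third, hσ.ne _ _⟩] at this
    rw [e1 i hi, ← e2]
    exact this
  refine ⟨fun v => f v, fun i j hij v => ?_⟩
  by_cases hi : i = k
  · subst hi
    by_cases h1 : (v : V) = σ i a
    · obtain rfl : v = c := Subtype.ext h1
      rw [hcd]
      exact key j hij.symm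
    by_cases h2 : (v : V) = σ i b
    · obtain rfl : v = d := Subtype.ext h2
      rw [← hcd, (isColouring_removePillow h).invol, hcd]
      exact (key j hij.symm).symm
    · have := hf i j hij v
      have e := removePillow_other h v h1 h2
      rw [← e, Hv j _ v.2, Hv j _ (removePillow h i v).2] at this
      exact this
  · have := hf i j hij v
    rw [← removePillow_of_ne h v hi, Hv j _ v.2, Hv j _ (removePillow h i v).2] at this
    exact this

end Pillow

end Gem

namespace Gem

/-! ### Removing a pillow does not change the surface. -/

section PillowSphere

variable {V : Type*} {σ : Fin 3 → V → V} {k : Fin 3} {a b : V} [DecidableEq V]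

/-- The map collapsing the pillow formed by `a` and `b` into the triangle adjacent to `a`. -/
noncomputable def collapsePillow (h : IsPillow σ k a b) (v : V) (x : Fin 3 → ℝ) :
    {v // v ≠ a ∧ v ≠ b} × (Fin 3 → ℝ) :=
  if hv : v ≠ a ∧ v ≠ b then
    (⟨v, hv⟩, if v = σ k a then slide k x (2 / 3 * slideMax k x + 1 / 3 * x k) else x)
  else (⟨σ k a, h.colouring.ne _ _, h.third⟩,
    if v = a then slide k x (2 / 3 * slideMax k x - 1 / 3 * x k) else slide k x (1 / 3 * x k))

open Classical in
/-- The inverse of `collapsePillow`. -/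
noncomputable def expandPillow (σ : Fin 3 → V → V) (k : Fin 3) (a b : V)
    (w : {v // v ≠ a ∧ v ≠ b}) (y : Fin 3 → ℝ) : V × (Fin 3 → ℝ) :=
  if (w : V) = σ k a then
    if 2 / 3 * slideMax k y ≤ y k then (σ k a, slide k y (3 * y k - 2 * slideMax k y))
    else if 1 / 3 * slideMax k y ≤ y k then (a, slide k y (2 * slideMax k y - 3 * y k))
    else (b, slide k y (3 * y k))
  else (w, y)

variable (h : IsPillow σ k a b)

/-- On each line parallel to the median the neighbour `σ k a` is squeezed into the upper third, `a`
upside down into the middle third and `b` into the lower third. Adjacent thirds match: `σ k a` and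
`a` meet where `x k = 0`, `a` and `b` where `x k` is maximal. -/
lemma collapsePillow_left (x : Fin 3 → ℝ) : collapsePillow h a x =
    (⟨σ k a, h.colouring.ne _ _, h.third⟩, slide k x (2 / 3 * slideMax k x - 1 / 3 * x k)) := by
  simp [collapsePillow]

lemma collapsePillow_right (x : Fin 3 → ℝ) : collapsePillow h b x =
    (⟨σ k a, h.colouring.ne _ _, h.third⟩, slide k x (1 / 3 * x k)) := by
  simp [collapsePillow, h.ne.symm]

lemma collapsePillow_nbr (x : Fin 3 → ℝ) : collapsePillow h (σ k a) x =
    (⟨σ k a, h.colouring.ne _ _, h.third⟩, slide k x (2 / 3 * slideMax k x + 1 / 3 * x k)) := by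
  simp [collapsePillow, h.third, h.colouring.ne k a]

lemma collapsePillow_other {v : V} (hv : v ≠ a ∧ v ≠ b) (hc : v ≠ σ k a) (x : Fin 3 → ℝ) :
    collapsePillow h v x = (⟨v, hv⟩, x) := by
  simp [collapsePillow, hv, hc]

lemma expandPillow_other {w : {v // v ≠ a ∧ v ≠ b}} (hc : (w : V) ≠ σ k a) (y : Fin 3 → ℝ) :
    expandPillow σ k a b w y = ((w : V), y) := by
  simp [expandPillow, hc]

omit [DecidableEq V] in
lemma pillow_cases (v : V) : v = a ∨ v = b ∨ v = σ k a ∨ (v ≠ a ∧ v ≠ b) ∧ v ≠ σ k a := by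
  tauto

include h

omit [DecidableEq V] in
lemma pillow_samePoint {x : Fin 3 → ℝ} (hx : slideMax k x = x k) :
    SamePoint σ (a, x) (b, x) := by
  obtain ⟨i, hi, hxi⟩ := exists_of_slideMax_eq k hx
  rw [← h.edge i hi]
  exact SamePoint.edge σ a hxi

lemma collapsePillow_mem (v : V) {x : Fin 3 → ℝ} (hx : x ∈ Triangle) :
    (collapsePillow h v x).2 ∈ Triangle := by
  have h1 := le_slideMax k hx
  have h0 : 0 ≤ x k := hx.1 k
  rcases pillow_cases (σ := σ) (k := k) (a := a) (b := b) v with rfl | rfl | rfl | ⟨hv, hc⟩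
  · rw [collapsePillow_left]
    exact slide_mem k hx (by linarith) (by linarith)
  · rw [collapsePillow_right]
    exact slide_mem k hx (by linarith) (by linarith)
  · rw [collapsePillow_nbr]
    exact slide_mem k hx (by linarith) (by linarith)
  · rwa [collapsePillow_other h hv hc]

omit h in
lemma expandPillow_mem (w : {v // v ≠ a ∧ v ≠ b}) {y : Fin 3 → ℝ} (hy : y ∈ Triangle) :
    (expandPillow σ k a b w y).2 ∈ Triangle := by
  have h1 := le_slideMax k hy
  have h0 : 0 ≤ y k := hy.1 k
  unfold expandPillow
  split_ifs with h2 h3 h4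
  · exact slide_mem k hy (by linarith) (by linarith)
  · exact slide_mem k hy (by linarith) (by linarith)
  · exact slide_mem k hy (by linarith) (by linarith)
  · exact hy

lemma collapsePillow_glue_third (v : V) {x : Fin 3 → ℝ} (hx : x k = 0) :
    SamePoint (removePillow h) (collapsePillow h v x) (collapsePillow h (σ k v) x) := by
  have hσ := h.colouring
  have hσ' := isColouring_removePillow h
  have hl : ∀ x : Fin 3 → ℝ, x k = 0 →
      SamePoint (removePillow h) (collapsePillow h a x) (collapsePillow h (σ k a) x) := by
    intro x hx
    rw [collapsePillow_left, collapsePillow_nbr, hx, mul_zero, sub_zero, add_zero]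
    exact SamePoint.refl _ _
  have hd : σ k b ≠ σ k a := fun h' => h.ne.symm (hσ.injective k h')
  have hr : ∀ x : Fin 3 → ℝ, x k = 0 →
      SamePoint (removePillow h) (collapsePillow h b x) (collapsePillow h (σ k b) x) := by
    intro x hx
    rw [collapsePillow_right, collapsePillow_other h ⟨h.symm.third, hσ.ne _ _⟩ hd,
      slide_eq k x (by rw [hx, mul_zero])]
    have := SamePoint.edge (removePillow h) ⟨σ k a, hσ.ne _ _, h.third⟩ hx
    rwa [show removePillow h k ⟨σ k a, hσ.ne _ _, h.third⟩ = ⟨σ k b, h.symm.third, hσ.ne _ _⟩ from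
      Subtype.ext (removePillow_left h)] at this
  rcases pillow_cases (σ := σ) (k := k) (a := a) (b := b) v with rfl | rfl | rfl | ⟨hv, hc⟩
  · exact hl x hx
  · exact hr x hx
  · rw [hσ.invol]; exact (hl x hx).symm hσ'
  · by_cases hvd : v = σ k b
    · rw [hvd, hσ.invol]; exact (hr x hx).symm hσ'
    · have e := removePillow_other h ⟨v, hv⟩ hc hvd
      have h1 : σ k v ≠ a ∧ σ k v ≠ b := by rw [← e]; exact (removePillow h k ⟨v, hv⟩).2
      have h2 : σ k v ≠ σ k a := fun h' => hv.1 (hσ.injective k h')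
      rw [collapsePillow_other h hv hc, collapsePillow_other h h1 h2]
      have := SamePoint.edge (removePillow h) ⟨v, hv⟩ hx
      rwa [show removePillow h k ⟨v, hv⟩ = ⟨σ k v, h1⟩ from Subtype.ext e] at this

/-- For `i ≠ k` the point is the upper end of its line, where the map fixes points of `σ k a` and
sends `a` and `b` to the same point. -/
lemma collapsePillow_glue (v : V) (i : Fin 3) {x : Fin 3 → ℝ} (hxT : x ∈ Triangle)
    (hx : x i = 0) :
    SamePoint (removePillow h) (collapsePillow h v x) (collapsePillow h (σ i v) x) := by
  have hσ := h.colouring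
  have hσ' := isColouring_removePillow h
  by_cases hi : i = k
  · subst hi
    exact collapsePillow_glue_third h v hx
  have hm := slideMax_eq k hxT hi hx
  have hab : collapsePillow h a x = collapsePillow h b x := by
    rw [collapsePillow_left, collapsePillow_right, hm]
    congr 2
    ring
  have hgen : ∀ v (hv : v ≠ a ∧ v ≠ b), collapsePillow h v x = (⟨v, hv⟩, x) := by
    intro v hv
    by_cases hc : v = σ k a
    · subst hc
      rw [collapsePillow_nbr, hm, slide_eq k x (by ring)]
    · exact collapsePillow_other h hv hc x
  by_cases hv : v ≠ a ∧ v ≠ b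
  · rw [hgen v hv, hgen _ (h.apply_ne hv hi)]
    have := SamePoint.edge (removePillow h) ⟨v, hv⟩ hx
    rwa [show removePillow h i ⟨v, hv⟩ = ⟨σ i v, h.apply_ne hv hi⟩ from
      Subtype.ext (removePillow_of_ne h _ hi)] at this
  · have : v = a ∨ v = b := by tauto
    rcases this with rfl | rfl
    · rw [h.edge i hi, hab]; exact SamePoint.refl _ _
    · rw [h.edge' hi, hab]; exact SamePoint.refl _ _

lemma expandPillow_glue (w : {v // v ≠ a ∧ v ≠ b}) (i : Fin 3) {x : Fin 3 → ℝ}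
    (hxT : x ∈ Triangle) (hx : x i = 0) :
    SamePoint σ (expandPillow σ k a b w x) (expandPillow σ k a b (removePillow h i w) x) := by
  have hσ := h.colouring
  have hσ' := isColouring_removePillow h
  by_cases hi : i = k
  · subst hi
    have hd : σ i b ≠ σ i a := fun h' => h.ne.symm (hσ.injective i h')
    have h0 : 0 ≤ slideMax i x := (hxT.1 i).trans (le_slideMax i hxT)
    have hl : SamePoint σ (expandPillow σ i a b ⟨σ i a, hσ.ne _ _, h.third⟩ x) (σ i b, x) := by
      have e1 := SamePoint.edge σ b hx
      unfold expandPillow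
      rw [if_pos rfl]
      split_ifs with h1 h2
      · have hm : slideMax i x = x i := by linarith
        rw [slide_eq i x (by rw [hm]; ring)]
        exact ((SamePoint.edge σ a hx).symm hσ).trans ((pillow_samePoint h hm).trans e1)
      · have hm : slideMax i x = x i := by linarith
        rw [slide_eq i x (by rw [hm, hx]; ring)]
        exact (pillow_samePoint h hm).trans e1
      · rwa [slide_eq i x (by rw [hx]; ring)]
    by_cases h1 : (w : V) = σ i a
    · obtain rfl : w = ⟨σ i a, hσ.ne _ _, h.third⟩ := Subtype.ext h1
      rw [expandPillow_other (w := removePillow h i _) (by rw [removePillow_left]; exact hd),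
        removePillow_left]
      exact hl
    by_cases h2 : (w : V) = σ i b
    · obtain rfl : w = ⟨σ i b, h.symm.third, hσ.ne _ _⟩ := Subtype.ext h2
      rw [show removePillow h i ⟨σ i b, h.symm.third, hσ.ne _ _⟩ = ⟨σ i a, hσ.ne _ _, h.third⟩ from
        Subtype.ext (removePillow_right h), expandPillow_other h1]
      exact hl.symm hσ
    · have e := removePillow_other h w h1 h2
      rw [expandPillow_other h1, expandPillow_other, e]
      · exact SamePoint.edge σ _ hx
      · rw [e]
        exact fun h' => w.2.1 (hσ.injective i h')
  · have hm := slideMax_eq k hxT hi hx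
    have h0 := hxT.1 k
    have hgen : ∀ w : {v // v ≠ a ∧ v ≠ b}, expandPillow σ k a b w x = ((w : V), x) := by
      intro w
      by_cases hc : (w : V) = σ k a
      · rw [expandPillow, if_pos hc, if_pos (by rw [hm]; linarith),
          slide_eq k x (by rw [hm]; ring), hc]
      · exact expandPillow_other hc x
    rw [hgen, hgen, removePillow_of_ne h w hi]
    exact SamePoint.edge σ _ hx

/-- Equality can fail where two thirds meet, since `expandPillow` picks one of the two triangles
there; the representatives still name the same point. -/
lemma expandPillow_collapsePillow (v : V) {x : Fin 3 → ℝ} (hx : x ∈ Triangle) :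
    SamePoint σ (expandPillow σ k a b (collapsePillow h v x).1 (collapsePillow h v x).2)
      (v, x) := by
  have hσ := h.colouring
  have h1 := le_slideMax k hx
  have h0 : 0 ≤ x k := hx.1 k
  rcases pillow_cases (σ := σ) (k := k) (a := a) (b := b) v with rfl | rfl | rfl | ⟨hv, hc⟩
  · rw [collapsePillow_left]
    simp only [expandPillow, if_true, slideMax_slide, slide_self, slide_slide]
    split_ifs with h2 h3
    · have : x k = 0 := by linarith
      rw [slide_eq k x (by rw [this]; ring)]
      exact (SamePoint.edge σ v this).symm hσ
    · rw [slide_eq k x (by ring)]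
      exact SamePoint.refl _ _
    · exact absurd (by linarith) h3
  · rw [collapsePillow_right]
    simp only [expandPillow, if_true, slideMax_slide, slide_self, slide_slide]
    split_ifs with h2 h3
    · have hm : slideMax k x = x k := by linarith
      have : x k = 0 := by linarith
      rw [slide_eq k x (by rw [hm, this]; ring)]
      exact ((SamePoint.edge σ a this).symm hσ).trans (pillow_samePoint h hm)
    · have hm : slideMax k x = x k := by linarith
      rw [slide_eq k x (by rw [hm]; ring)]
      exact pillow_samePoint h hm
    · rw [slide_eq k x (by ring)]
      exact SamePoint.refl _ _
  · rw [collapsePillow_nbr]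
    simp only [expandPillow, if_true, slideMax_slide, slide_self, slide_slide]
    rw [if_pos (by linarith), slide_eq k x (by ring)]
    exact SamePoint.refl _ _
  · rw [collapsePillow_other h hv hc, expandPillow_other (w := ⟨v, hv⟩) hc]
    exact SamePoint.refl _ _

lemma collapsePillow_expandPillow (w : {v // v ≠ a ∧ v ≠ b}) (y : Fin 3 → ℝ) :
    collapsePillow h (expandPillow σ k a b w y).1 (expandPillow σ k a b w y).2 = (w, y) := by
  by_cases hc : (w : V) = σ k a
  · obtain rfl : w = ⟨σ k a, h.colouring.ne _ _, h.third⟩ := Subtype.ext hc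
    simp only [expandPillow, if_true]
    split_ifs
    · simp only [collapsePillow_nbr, slideMax_slide, slide_self, slide_slide]
      rw [slide_eq k y (by ring)]
    · simp only [collapsePillow_left, slideMax_slide, slide_self, slide_slide]
      rw [slide_eq k y (by ring)]
    · simp only [collapsePillow_right, slide_self, slide_slide]
      rw [slide_eq k y (by ring)]
  · rw [expandPillow_other hc, collapsePillow_other h w.2 hc]

lemma isSphere_of_removePillow (hs : IsSphere (removePillow h)) : IsSphere σ := by
  have hl := isPLOn_slideMax k
  have hk := isPLOn_coord (isCompactPolyhedron_stdSimplex (Fin 3)) k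
  refine IsSphere.transport h.colouring (collapsePillow h) (expandPillow σ k a b)
    (fun v x hx => collapsePillow_mem h v hx) (fun v x hx => expandPillow_mem v hx)
    (fun v i x hx hi => collapsePillow_glue h v i hx hi)
    (fun v i x hx hi => expandPillow_glue h v i hx hi)
    (fun v x hx => expandPillow_collapsePillow h v hx)
    (fun v x hx => by rw [collapsePillow_expandPillow]; exact SamePoint.refl _ _)
    (fun φ h1 _ v => ?_) hs
  suffices ∃ w, ∃ t : (Fin 3 → ℝ) → (Fin 3 → ℝ), IsPLOn t Triangle ∧
      ∀ x, collapsePillow h v x = (w, t x) by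
    obtain ⟨w, t, ht, hw⟩ := this
    refine ((h1 w).comp ht fun x hx => ?_).congr fun x _ => by rw [hw]; rfl
    have := collapsePillow_mem h v hx
    rwa [hw] at this
  rcases pillow_cases (σ := σ) (k := k) (a := a) (b := b) v with rfl | rfl | rfl | ⟨hv, hc⟩
  · exact ⟨_, _, isPLOn_slide k ((hl.const_smul (2 / 3)).sub (hk.const_smul (1 / 3))),
      collapsePillow_left h⟩
  · exact ⟨_, _, isPLOn_slide k (hk.const_smul (1 / 3)), collapsePillow_right h⟩
  · exact ⟨_, _, isPLOn_slide k ((hl.const_smul (2 / 3)).add (hk.const_smul (1 / 3))),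
      collapsePillow_nbr h⟩
  · exact ⟨_, _, (isCompactPolyhedron_stdSimplex (Fin 3)).isPLOn (AffineMap.id ℝ _),
      collapsePillow_other h hv hc⟩

end PillowSphere

end Gem

namespace Gem

/-! ### Counting vertices by linear algebra over `ℤ/2`. -/

section Counting

variable {V : Type*} [Fintype V] {σ : Fin 3 → V → V}

/-- The functions `V → ℤ/2` that are invariant under the involution `σ i`. -/
def invariants (σ : Fin 3 → V → V) (i : Fin 3) : Submodule (ZMod 2) (V → ZMod 2) where
  carrier := {u | ∀ v, u (σ i v) = u v}
  add_mem' hu hw v := by simp only [Pi.add_apply, hu v, hw v]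
  zero_mem' _ := rfl
  smul_mem' c u hu v := by simp only [Pi.smul_apply, hu v]

/-- In characteristic two `N = 1 + σ i` has square zero, so its range and its kernel both consist of
invariants, and their dimensions add up to the number of vertices. -/
lemma card_le_finrank_invariants (hσ : IsColouring σ) (i : Fin 3) :
    Fintype.card V ≤ 2 * Module.finrank (ZMod 2) (invariants σ i) := by
  let N : (V → ZMod 2) →ₗ[ZMod 2] (V → ZMod 2) := LinearMap.id + LinearMap.funLeft _ _ (σ i)
  have hN : ∀ u v, N u v = u v + u (σ i v) := fun _ _ => rfl
  have hr : N.range ≤ invariants σ i := by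
    rintro _ ⟨u, rfl⟩ v
    rw [hN, hN, hσ.invol, add_comm]
  have hk : N.ker ≤ invariants σ i := fun u hu v => by
    have := congrFun (LinearMap.mem_ker.1 hu) v
    rw [hN, Pi.zero_apply] at this
    exact (CharTwo.add_eq_zero.1 this).symm
  have h1 := Submodule.finrank_mono hr
  have h2 := Submodule.finrank_mono hk
  have h3 := N.finrank_range_add_finrank_ker
  rw [Module.finrank_fintype_fun_eq_card] at h3
  omega

lemma sum_eq_zero_of_invariant (hσ : IsColouring σ) {i : Fin 3} {u : V → ZMod 2}
    (hu : u ∈ invariants σ i) : ∑ v, u v = 0 :=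
  Finset.sum_involution (fun v _ => σ i v)
    (fun v _ => by rw [hu v]; exact zmod_two_add_self _) (fun v _ _ => hσ.ne i v)
    (fun _ _ => Finset.mem_univ _) fun v _ => hσ.invol i v

/-- An acyclic 3-coloured graph with a single bicoloured cycle for each pair of colours has at most
two vertices. -/
lemma card_le_two (hσ : IsColouring σ) (hq : IsAcyclic σ) [Nonempty V]
    (h : ∀ k, ∀ S : Set V, (∀ i, i ≠ k → ∀ v ∈ S, σ i v ∈ S) → S.Nonempty → S = Set.univ) :
    Fintype.card V ≤ 2 := by
  obtain ⟨v₀⟩ := ‹Nonempty V›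
  let I := invariants σ
  -- The domain has dimension at least `3|V|/2`. The kernel has dimension at most `2`, and the range
  -- lies in the functions with sum zero, so has dimension at most `|V| - 1`. Hence `|V| ≤ 2`.
  let L : (I 0 × I 1 × I 2) →ₗ[ZMod 2] (V → ZMod 2) :=
    (I 0).subtype.coprod ((I 1).subtype.coprod (I 2).subtype)
  have hL : ∀ u, L u = u.1.1 + (u.2.1.1 + u.2.2.1) := fun _ => rfl
  have hconst : ∀ u, L u = 0 → ∀ v, u.2.1.1 v = u.2.1.1 v₀ ∧ u.2.2.1 v = u.2.2.1 v₀ := by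
    rintro ⟨⟨u₀, h₀⟩, ⟨u₁, h₁⟩, ⟨u₂, h₂⟩⟩ hu
    rw [hL] at hu
    have hu' : ∀ v, u₀ v + (u₁ v + u₂ v) = 0 := fun v => congrFun hu v
    -- Chosen so that the pairwise sums are `u₀`, `u₁`, `u₂`: elements of the kernel are precisely
    -- cocycles. With a single cycle for each pair of colours, `f + H k` is constant for each `k`.
    let H : Fin 3 → V → ZMod 2 := ![0, u₂, u₁]
    have e0 : ∀ v, H 1 v + H 2 v = u₀ v := fun v => by
      have := hu' v
      change u₂ v + u₁ v = u₀ v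
      rw [add_comm]
      exact (CharTwo.add_eq_zero.1 this).symm
    have e1 : ∀ v, H 0 v + H 2 v = u₁ v := fun v => by simp [H]
    have e2 : ∀ v, H 0 v + H 1 v = u₂ v := fun v => by simp [H]
    obtain ⟨f, hf⟩ := hq H (by
      intro i j k hij hik hjk v
      rcases (show k = 0 ∨ k = 1 ∨ k = 2 from fin3_cases k 0) with rfl | rfl | rfl
      · have : H i + H j = H 1 + H 2 := by
          rcases (by clear * - hij hik hjk; revert i j; decide :
            (i = 1 ∧ j = 2) ∨ (i = 2 ∧ j = 1)) with ⟨rfl, rfl⟩ | ⟨rfl, rfl⟩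
          exacts [rfl, add_comm _ _]
        have e : ∀ v, H i v + H j v = u₀ v := fun v => (congrFun this v).trans (e0 v)
        rw [e, e, h₀ v]
      · have : H i + H j = H 0 + H 2 := by
          rcases (by clear * - hij hik hjk; revert i j; decide :
            (i = 0 ∧ j = 2) ∨ (i = 2 ∧ j = 0)) with ⟨rfl, rfl⟩ | ⟨rfl, rfl⟩
          exacts [rfl, add_comm _ _]
        have e : ∀ v, H i v + H j v = u₁ v := fun v => (congrFun this v).trans (e1 v)
        rw [e, e, h₁ v]
      · have : H i + H j = H 0 + H 1 := by
          rcases (by clear * - hij hik hjk; revert i j; decide :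
            (i = 0 ∧ j = 1) ∨ (i = 1 ∧ j = 0)) with ⟨rfl, rfl⟩ | ⟨rfl, rfl⟩
          exacts [rfl, add_comm _ _]
        have e : ∀ v, H i v + H j v = u₂ v := fun v => (congrFun this v).trans (e2 v)
        rw [e, e, h₂ v])
    have hc : ∀ k v, f v + H k v = f v₀ + H k v₀ := fun k v => by
      have := h k {v | f v + H k v = f v₀ + H k v₀}
        (fun i hi v hv => (hf i k hi v).trans hv) ⟨v₀, rfl⟩
      exact (this ▸ Set.mem_univ v : v ∈ {v | f v + H k v = f v₀ + H k v₀})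
    intro v
    have key : ∀ i j, H i v + H j v = H i v₀ + H j v₀ := fun i j => by
      have h1 := hc i v
      have h2 := hc j v
      have e : ∀ x y z : ZMod 2, y + z = (x + y) + (x + z) := by decide
      rw [e (f v), h1, h2, ← e]
    change u₁ v = u₁ v₀ ∧ u₂ v = u₂ v₀
    exact ⟨by rw [← e1, ← e1, key], by rw [← e2, ← e2, key]⟩
  have hker : Module.finrank (ZMod 2) L.ker ≤ 2 := by
    let ev : L.ker →ₗ[ZMod 2] (ZMod 2 × ZMod 2) :=
      (((LinearMap.proj v₀ : (V → ZMod 2) →ₗ[ZMod 2] ZMod 2).comp ((I 1).subtype.comp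
        ((LinearMap.fst _ _ _).comp (LinearMap.snd _ _ _)))).prod
      ((LinearMap.proj v₀ : (V → ZMod 2) →ₗ[ZMod 2] ZMod 2).comp ((I 2).subtype.comp
        ((LinearMap.snd _ _ _).comp (LinearMap.snd _ _ _))))).comp L.ker.subtype
    have hev : ∀ u : L.ker, ev u = (u.1.2.1.1 v₀, u.1.2.2.1 v₀) := fun _ => rfl
    have hinj : Function.Injective ev := by
      rw [injective_iff_map_eq_zero]
      rintro ⟨u, hu⟩ h0
      rw [hev] at h0
      obtain ⟨h1, h2⟩ := Prod.mk.inj h0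
      have hu0 : L u = 0 := hu
      have hc := hconst u hu0
      have a1 : u.2.1.1 = 0 := funext fun v => (hc v).1.trans h1
      have a2 : u.2.2.1 = 0 := funext fun v => (hc v).2.trans h2
      have a0 : u.1.1 = 0 := by
        rw [hL, a1, a2] at hu0
        simpa using hu0
      obtain ⟨⟨u₀, h₀⟩, ⟨u₁, h₁⟩, ⟨u₂, h₂⟩⟩ := u
      simp only at a0 a1 a2
      subst a0 a1 a2
      rfl
    have := LinearMap.finrank_le_finrank_of_injective hinj
    simpa using this
  have hrange : Module.finrank (ZMod 2) L.range < Fintype.card V := by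
    rw [← Module.finrank_fintype_fun_eq_card (ZMod 2)]
    apply Submodule.finrank_lt
    intro htop
    classical
    have : Pi.single v₀ 1 ∈ L.range := htop ▸ Submodule.mem_top
    obtain ⟨u, hu⟩ := this
    have h1 : ∑ v, L u v = 0 := by
      simp only [hL, Pi.add_apply, Finset.sum_add_distrib]
      rw [sum_eq_zero_of_invariant hσ u.1.2, sum_eq_zero_of_invariant hσ u.2.1.2,
        sum_eq_zero_of_invariant hσ u.2.2.2]
      rfl
    rw [hu, Finset.sum_pi_single'] at h1
    simp at h1
  have hrk := L.finrank_range_add_finrank_ker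
  rw [Module.finrank_prod, Module.finrank_prod] at hrk
  have c0 := card_le_finrank_invariants hσ 0
  have c1 := card_le_finrank_invariants hσ 1
  have c2 := card_le_finrank_invariants hσ 2
  change _ = Module.finrank (ZMod 2) (invariants σ 0) + (Module.finrank (ZMod 2) (invariants σ 1) +
    Module.finrank (ZMod 2) (invariants σ 2)) at hrk
  omega

end Counting

/-! ### Two triangles form the boundary of a bipyramid. -/

section BaseCase

variable {V : Type*} {σ : Fin 3 → V → V}

/-- The piecewise linear map of the triangle onto the upper (`s = 1`) or lower (`s = -1`) half of the
bipyramid. -/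
noncomputable def bipyramidMap (s : ℝ) (x : Fin 3 → ℝ) : Fin 3 → ℝ :=
  fun j => x j - 1 / 3 + s * min (x 0) (min (x 1) (x 2))

lemma isPLOn_bipyramidMap (s : ℝ) : IsPLOn (bipyramidMap s) Triangle := by
  have hT := isCompactPolyhedron_stdSimplex (Fin 3)
  have h := isPLOn_coord hT
  exact IsPLOn.pi hT fun j => ((h j).sub (hT.isPLOn_const (1 / 3 : ℝ))).add
    (((h 0).min ((h 1).min (h 2))).const_smul s)

lemma bipyramidMap_sum {x : Fin 3 → ℝ} (hx : x ∈ Triangle) (s : ℝ) :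
    bipyramidMap s x 0 + bipyramidMap s x 1 + bipyramidMap s x 2 =
      3 * (s * min (x 0) (min (x 1) (x 2))) := by
  obtain ⟨-, -, -, h⟩ := mem_triangle.1 hx
  simp only [bipyramidMap]
  linear_combination h

lemma min_nonneg_triangle {x : Fin 3 → ℝ} (hx : x ∈ Triangle) : 0 ≤ min (x 0) (min (x 1) (x 2)) :=
  le_min (hx.1 0) (le_min (hx.1 1) (hx.1 2))

lemma bipyramidGauge_bipyramidMap {x : Fin 3 → ℝ} (hx : x ∈ Triangle) {s : ℝ}
    (hs : s = 1 ∨ s = -1) : bipyramidGauge (bipyramidMap s x) = 1 := by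
  have h0 := min_nonneg_triangle hx
  rw [bipyramidGauge, bipyramidMap_sum hx]
  have : min (bipyramidMap s x 0) (min (bipyramidMap s x 1) (bipyramidMap s x 2)) =
      min (x 0) (min (x 1) (x 2)) - 1 / 3 + s * min (x 0) (min (x 1) (x 2)) := by
    simp only [bipyramidMap, min_add_add_right, min_sub_sub_right]
  rw [this]
  have h1 : |3 * (s * min (x 0) (min (x 1) (x 2)))| = 3 * min (x 0) (min (x 1) (x 2)) := by
    rcases hs with rfl | rfl
    · rw [one_mul, abs_of_nonneg (by linarith)]
    · rw [neg_one_mul, abs_of_nonpos (by linarith)]; ring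
  rw [h1]
  ring

/-- Projecting along `(1, 1, 1)` recovers the point of the triangle; the gauge equation says that
its least coordinate is `|S| / 3`, which is the height. -/
lemma exists_bipyramidMap_eq {y : Fin 3 → ℝ} (hy : bipyramidGauge y = 1) {s : ℝ}
    (hs : s * (y 0 + y 1 + y 2) = |y 0 + y 1 + y 2|) (hs2 : s * s = 1) :
    ∃ x ∈ Triangle, bipyramidMap s x = y := by
  set m := min (y 0) (min (y 1) (y 2)) with hm
  set S := y 0 + y 1 + y 2 with hS
  rw [bipyramidGauge, ← hm, ← hS] at hy
  have m0 : m ≤ y 0 := min_le_left _ _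
  have m1 : m ≤ y 1 := (min_le_right _ _).trans (min_le_left _ _)
  have m2 : m ≤ y 2 := (min_le_right _ _).trans (min_le_right _ _)
  have hpos : 0 ≤ |S| := abs_nonneg _
  have hx : min (y 0 - S / 3 + 1 / 3) (min (y 1 - S / 3 + 1 / 3) (y 2 - S / 3 + 1 / 3)) =
      |S| / 3 := by
    rw [min_add_add_right, min_add_add_right, min_sub_sub_right, min_sub_sub_right, ← hm]
    linarith
  refine ⟨fun j => y j - S / 3 + 1 / 3, ?_, ?_⟩
  · rw [mem_triangle]
    exact ⟨by linarith, by linarith, by linarith, by rw [hS]; ring⟩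
  · funext j
    simp only [bipyramidMap]
    rw [hx, ← hs]
    linear_combination (S / 3) * hs2

lemma isSphere_of_card_eq_two [Fintype V] (hσ : IsColouring σ) (hV : Fintype.card V = 2) :
    IsSphere σ := by
  classical
  obtain ⟨p, q, hpq, huniv⟩ := Finset.card_eq_two.1 ((Finset.card_univ (α := V)).trans hV)
  have hor : ∀ v, v = p ∨ v = q := fun v => by
    have := huniv ▸ Finset.mem_univ v
    simpa using this
  have hp : ∀ i, σ i p = q := fun i => (hor _).resolve_left (hσ.ne i p)
  have hφ : ∀ v : V, (if v = p then (1 : ℝ) else -1) = 1 ∨ (if v = p then (1 : ℝ) else -1) = -1 :=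
    fun v => by by_cases h : v = p <;> simp [h]
  refine ⟨fun v => bipyramidMap (if v = p then 1 else -1), fun v => isPLOn_bipyramidMap _,
    fun v x hx w y hy => ?_, fun y => ⟨fun hy => ?_, ?_⟩⟩
  · have hx0 := min_nonneg_triangle hx
    have hy0 := min_nonneg_triangle hy
    constructor
    · intro h
      dsimp only at h
      have hs := bipyramidMap_sum hx (if v = p then 1 else -1)
      rw [h, bipyramidMap_sum hy] at hs
      have hxy : x = y := by
        funext j
        have := congrFun h j
        simp only [bipyramidMap] at this
        linarith
      subst hxy
      refine ⟨rfl, ?_⟩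
      by_cases hvw : v = w
      · rw [hvw]; exact Joined.refl _ _ _
      -- The two halves have coordinate sums of opposite signs, so they meet only at height zero.
      have hm : min (x 0) (min (x 1) (x 2)) = 0 := by
        rcases hor v with rfl | rfl <;> rcases hor w with rfl | rfl
        · exact absurd rfl hvw
        · simp [hpq.symm] at hs; linarith
        · simp [hpq.symm] at hs; linarith
        · exact absurd rfl hvw
      obtain ⟨i, hi⟩ : ∃ i, x i = 0 := by
        rcases min_choice (x 0) (min (x 1) (x 2)) with h | h
        · exact ⟨0, by rw [← h, hm]⟩
        · rcases min_choice (x 1) (x 2) with h' | h'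
          · exact ⟨1, by rw [← h', ← h, hm]⟩
          · exact ⟨2, by rw [← h', ← h, hm]⟩
      have hvw' : σ i v = w := by
        have := hσ.ne i v
        rcases hor v with rfl | rfl <;> rcases hor w with rfl | rfl
        · exact absurd rfl hvw
        · exact hp i
        · exact (hσ.eq_apply (hp i)).symm
        · exact absurd rfl hvw
      rw [← hvw']
      exact Joined.edge σ hi v
    · rintro ⟨hxy, hj⟩
      dsimp only at hxy hj
      subst hxy
      by_cases hi : ∃ i, x i = 0
      · obtain ⟨i, hi⟩ := hi
        have hm : min (x 0) (min (x 1) (x 2)) = 0 := by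
          refine le_antisymm ?_ hx0
          rw [← hi]
          fin_cases i
          · exact min_le_left _ _
          · exact (min_le_right _ _).trans (min_le_left _ _)
          · exact (min_le_right _ _).trans (min_le_right _ _)
        funext j
        simp [bipyramidMap, hm]
      · push Not at hi
        have hvw : w = v := hj.apply_eq (f := id) fun i hi' => absurd hi' (hi i)
        rw [hvw]
  · rcases le_total 0 (y 0 + y 1 + y 2) with h | h
    · obtain ⟨x, hx, hxy⟩ := exists_bipyramidMap_eq hy (s := 1) (by rw [abs_of_nonneg h, one_mul])
        (by norm_num)
      exact ⟨p, x, hx, by simpa using hxy⟩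
    · obtain ⟨x, hx, hxy⟩ := exists_bipyramidMap_eq hy (s := -1)
        (by rw [abs_of_nonpos h, neg_one_mul]) (by norm_num)
      exact ⟨q, x, hx, by simpa [hpq.symm] using hxy⟩
  · rintro ⟨v, x, hx, rfl⟩
    exact bipyramidGauge_bipyramidMap hx (hφ v)

end BaseCase

/-! ### The recognition of spheres. -/

section Induction

universe u

lemma two_le_card {V : Type u} [Fintype V] [Nonempty V] {σ : Fin 3 → V → V} (hσ : IsColouring σ) :
    2 ≤ Fintype.card V := by
  obtain ⟨v⟩ := ‹Nonempty V›
  exact Fintype.one_lt_card_iff.2 ⟨_, v, hσ.ne 0 v⟩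

/-- An acyclic connected 3-coloured graph is a sphere, provided this holds for graphs with fewer
vertices and there is a proper subset that is closed under two of the colours. -/
lemma isSphere_of_closed (n : ℕ)
    (ih : ∀ (V : Type u) [Fintype V] [Nonempty V] (σ : Fin 3 → V → V), Fintype.card V < n →
      IsColouring σ → IsConn σ → IsAcyclic σ → IsSphere σ)
    {V : Type u} [Fintype V] (hV : Fintype.card V = n) (k : Fin 3) (m : ℕ) :
    ∀ (σ : Fin 3 → V → V), IsColouring σ → IsConn σ → IsAcyclic σ → ∀ S : Finset V,
      S.card = m → S.Nonempty → (∃ v, v ∉ S) → (∀ i, i ≠ k → ∀ v ∈ S, σ i v ∈ S) →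
      IsSphere σ := by
  classical
  induction m using Nat.strong_induction_on with
  | _ m ihm =>
    intro σ hσ hc hq S hm hne hS hcl
    obtain ⟨a, haS, hka⟩ : ∃ a ∈ S, σ k a ∉ S := by
      by_contra! hcon
      have := hc S (fun i v hv => by
        by_cases hi : i = k
        · exact hi ▸ hcon v hv
        · exact hcl i hi v hv) hne
      obtain ⟨v, hv⟩ := hS
      exact hv (this ▸ Set.mem_univ v : v ∈ (S : Set V))
    by_cases ha : Function.Injective fun i => σ i a
    · obtain ⟨S', h1, h2, h3, h4⟩ := exists_closed_flip hσ ha hcl haS hka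
      exact isSphere_of_flip hσ ha (ihm S'.card (hm ▸ h1) (flip σ a) (isColouring_flip hσ a)
        (isConn_flip hσ ha hc) (isAcyclic_flip hσ ha hq) S' rfl h2 ⟨a, h3⟩ h4)
    · have hkne : ∀ i, i ≠ k → σ i a ≠ σ k a := fun i hi h => hka (h ▸ hcl i hi a haS)
      -- These two neighbours lie in `S` while `σ k a` does not, so this is the only possible
      -- coincidence; it produces a pillow.
      have h12 : σ (k + 1) a = σ (k + 2) a := by
        by_contra h12
        apply ha
        have n1 := hkne (k + 1) (fin3_ne_add_one k).symm
        have n2 := hkne (k + 2) (fin3_ne_add_two k).symm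
        intro i j hij
        dsimp only at hij
        rcases fin3_cases i k with hi | hi | hi <;> rcases fin3_cases j k with hj | hj | hj <;>
          rw [hi, hj] at hij ⊢
        exacts [absurd hij.symm n1, absurd hij.symm n2, absurd hij n1, absurd hij h12,
          absurd hij n2, absurd hij.symm h12]
      have hp : IsPillow σ k a (σ (k + 1) a) := by
        refine ⟨hσ, fun i hi => ?_, (hkne _ (fin3_ne_add_one k).symm).symm⟩
        rcases fin3_cases i k with rfl | rfl | rfl
        · exact absurd rfl hi
        · rfl
        · exact h12.symm
      have : Nonempty {v // v ≠ a ∧ v ≠ σ (k + 1) a} := ⟨⟨σ k a, hσ.ne _ _, hp.third⟩⟩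
      refine isSphere_of_removePillow hp (ih _ _ ?_ (isColouring_removePillow hp)
        (isConn_removePillow hp hc) (isAcyclic_removePillow hp hq))
      rw [← hV]
      exact Fintype.card_subtype_lt (x := a) (by simp)

/-- A connected acyclic 3-coloured graph represents a piecewise linear 2-sphere. -/
theorem isSphere_of_isAcyclic {V : Type u} [Fintype V] [Nonempty V] {σ : Fin 3 → V → V}
    (hσ : IsColouring σ) (hc : IsConn σ) (hq : IsAcyclic σ) : IsSphere σ := by
  suffices ∀ (n : ℕ) (V : Type u) [Fintype V] [Nonempty V] (σ : Fin 3 → V → V),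
      Fintype.card V = n → IsColouring σ → IsConn σ → IsAcyclic σ → IsSphere σ from
    this _ V σ rfl hσ hc hq
  intro n
  induction n using Nat.strong_induction_on with
  | _ n ih =>
    intro V _ _ σ hV hσ hc hq
    classical
    by_cases h : ∀ k, ∀ S : Set V, (∀ i, i ≠ k → ∀ v ∈ S, σ i v ∈ S) → S.Nonempty → S = Set.univ
    · exact isSphere_of_card_eq_two hσ (le_antisymm (card_le_two hσ hq h) (two_le_card hσ))
    · push Not at h
      obtain ⟨k, S, h1, h2, h3⟩ := h
      refine isSphere_of_closed n (fun W _ _ τ hW => ih _ hW W τ rfl) hV k _ σ hσ hc hq S.toFinset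
        rfl (by simpa using h2) ?_ (by simpa using h1)
      obtain ⟨v, hv⟩ := (Set.ne_univ_iff_exists_notMem S).1 h3
      exact ⟨v, by simpa using hv⟩

end Induction

end Gem

namespace Gem

section Cocycle

/-! ### Two-valued cocycles on a punctured ball in three-dimensional space -/

variable {ι X E : Type*} [TopologicalSpace X] [NormedAddCommGroup E] [NormedSpace ℝ E]

instance : DiscreteTopology (ZMod 2) := ⟨rfl⟩

instance : ContinuousAdd (ZMod 2) := ⟨continuous_of_discreteTopology⟩

/-- Each locally constant `ZMod 2`-valued cocycle on a cover of `S` by open sets indexed by `ι` is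
a coboundary. -/
def CocyclesTrivial (ι : Type*) (S : Set X) : Prop :=
  ∀ (U : ι → Set X) (g : ι → ι → X → ZMod 2), (∀ k, IsOpen (U k)) → S ⊆ ⋃ k, U k →
    (∀ k l, ContinuousOn (g k l) (U k ∩ U l)) →
    (∀ k l m, ∀ y ∈ S, y ∈ U k → y ∈ U l → y ∈ U m → g k l y + g l m y = g k m y) →
    ∃ s : ι → X → ZMod 2, (∀ k, ContinuousOn (s k) (S ∩ U k)) ∧
      ∀ k l, ∀ y ∈ S, y ∈ U k → y ∈ U l → s k y + s l y = g k l y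

/-- The cocycle glues a double cover of `S`. As `S` is contractible, the cover has a global section,
whose local coordinates form the coboundary. -/
lemma cocyclesTrivial_of_starConvex {S : Set E} (hS : IsOpen S) {a : E} (ha : a ∈ S)
    (hst : StarConvex ℝ a S) : CocyclesTrivial ι S := by
  classical
  intro U g hU hSU hg hc
  have hkk : ∀ k, ∀ y ∈ S, y ∈ U k → g k k y = 0 := fun k y hy hk => by
    simpa using hc k k k y hy hk hk hk
  have hmem : ∀ y : S, ∃ k, (y : E) ∈ U k := fun y => Set.mem_iUnion.1 (hSU y.2)
  choose idx hidx using hmem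
  let Z : FiberBundleCore ι S (ZMod 2) :=
    { baseSet := fun k => Subtype.val ⁻¹' U k
      isOpen_baseSet := fun k => (hU k).preimage continuous_subtype_val
      indexAt := idx
      mem_baseSet_at := hidx
      coordChange := fun i j x v => g i j x + v
      coordChange_self := fun i x hx v => by rw [hkk i x x.2 hx, zero_add]
      continuousOn_coordChange := fun i j => by
        exact (continuous_of_discreteTopology
          (f := fun q : ZMod 2 × ZMod 2 => q.1 + q.2)).comp_continuousOn
          (ContinuousOn.prodMk ((hg i j).comp (continuous_subtype_val.comp
            continuous_fst).continuousOn fun p hp => hp.1) continuousOn_snd)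
      coordChange_comp := fun i j k x hx v => by
        rw [← add_assoc, add_comm (g j k x), hc i j k x x.2 hx.1.1 hx.1.2 hx.2] }
  have hcov : IsCoveringMap (Bundle.TotalSpace.proj : Bundle.TotalSpace (ZMod 2) Z.Fiber → S) :=
    FiberBundle.isCoveringMap (F := ZMod 2)
  have : ContractibleSpace S := hst.contractibleSpace ⟨a, ha⟩
  have : LocallyPathConnectedSpace S := hS.locallyPathConnectedSpace
  -- A section is a lift of the identity; its value `0` at `a` is arbitrary.
  obtain ⟨F, ⟨-, hF⟩, -⟩ := hcov.existsUnique_continuousMap_lifts (ContinuousMap.id S) ⟨a, ha⟩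
    ⟨⟨a, ha⟩, (0 : ZMod 2)⟩ rfl
  have hF' : ∀ y : S, (F y).proj = y := fun y => congrFun hF y
  refine ⟨fun k y => if h : y ∈ S then (Z.localTriv k (F ⟨y, h⟩)).2 else 0, fun k => ?_,
    fun k l y hy hk hl => ?_⟩
  · have h1 : ContinuousOn (fun y : S => (Z.localTriv k (F y)).2) (Subtype.val ⁻¹' U k) := by
      refine continuous_snd.comp_continuousOn ((Z.localTriv k).continuousOn.comp
        F.continuous.continuousOn fun y hy => ?_)
      rw [FiberBundleCore.mem_localTriv_source, hF']
      exact hy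
    rw [continuousOn_iff_continuous_domRestrict] at h1 ⊢
    refine (h1.comp (f := fun y : (S ∩ U k : Set E) => ⟨⟨y.1, y.2.1⟩, y.2.2⟩)
      (by fun_prop)).congr fun y => ?_
    simp [y.2.1]
  · simp only [hy, dif_pos, FiberBundleCore.localTriv_apply]
    have h1 : (F ⟨y, hy⟩).proj = ⟨y, hy⟩ := hF' _
    have h2 : y ∈ U (idx ⟨y, hy⟩) := hidx ⟨y, hy⟩
    obtain ⟨v, hv⟩ : ∃ v : ZMod 2, v = (F ⟨y, hy⟩).snd := ⟨_, rfl⟩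
    rw [← hv, h1]
    change (g (idx ⟨y, hy⟩) k y + v) + (g (idx ⟨y, hy⟩) l y + v) = g k l y
    have h3 := hc k (idx ⟨y, hy⟩) k y hy hk h2 hk
    rw [hkk k y hy hk] at h3
    have h4 := hc k (idx ⟨y, hy⟩) l y hy hk h2 hl
    have h5 := zmod_two_add_self v
    have h6 := zmod_two_add_self (g (idx ⟨y, hy⟩) k y)
    linear_combination h4 + h5 + h6 - h3

/-- Mayer–Vietoris: on `A ∩ B` the two solutions differ by a locally constant function independent
of the index, hence by a constant `c`, which is added to the solution on `B`. -/
lemma CocyclesTrivial.union [Nonempty ι] {A B : Set X} (hA : IsOpen A) (hB : IsOpen B)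
    (hAB : IsPreconnected (A ∩ B)) (h1 : CocyclesTrivial ι A) (h2 : CocyclesTrivial ι B) :
    CocyclesTrivial ι (A ∪ B) := by
  classical
  intro U g hU hSU hg hc
  obtain ⟨s, hs, hs'⟩ := h1 U g hU (Set.subset_union_left.trans hSU) hg
    fun k l m y hy => hc k l m y (Or.inl hy)
  obtain ⟨t, ht, ht'⟩ := h2 U g hU (Set.subset_union_right.trans hSU) hg
    fun k l m y hy => hc k l m y (Or.inr hy)
  have hkl : ∀ k l, ∀ y ∈ A ∩ B, y ∈ U k → y ∈ U l → s k y + t k y = s l y + t l y := by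
    intro k l y hy hk hl
    have e1 := hs' k l y hy.1 hk hl
    have e2 := ht' k l y hy.2 hk hl
    have e3 := zmod_two_add_self (s l y)
    have e4 := zmod_two_add_self (t k y)
    linear_combination e1 - e2 + e4 - e3
  have hmem : ∀ y, ∃ k, y ∈ A ∩ B → y ∈ U k := fun y => by
    by_cases hy : y ∈ A ∩ B
    · obtain ⟨k, hk⟩ := Set.mem_iUnion.1 (hSU (Or.inl hy.1))
      exact ⟨k, fun _ => hk⟩
    · exact ⟨Classical.arbitrary ι, fun h => absurd h hy⟩
  choose idx hidx using hmem
  have hcont : ContinuousOn (fun y => s (idx y) y + t (idx y) y) (A ∩ B) := by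
    intro y hy
    have hyk := hidx y hy
    have hc1 : ContinuousAt (fun y => s (idx y) y + t (idx y) y) y := by
      have c1 : ContinuousAt (s (idx y)) y := (hs (idx y)).continuousAt
        ((hA.inter (hU _)).mem_nhds ⟨hy.1, hyk⟩)
      have c2 : ContinuousAt (t (idx y)) y := (ht (idx y)).continuousAt
        ((hB.inter (hU _)).mem_nhds ⟨hy.2, hyk⟩)
      refine (c1.add c2).congr ?_
      filter_upwards [((hA.inter hB).inter (hU (idx y))).mem_nhds ⟨hy, hyk⟩] with z hz
      exact hkl _ _ z hz.1 hz.2 (hidx z hz.1)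
    exact hc1.continuousWithinAt
  obtain ⟨c, hcc⟩ : ∃ c, ∀ y ∈ A ∩ B, s (idx y) y + t (idx y) y = c := by
    by_cases hne : (A ∩ B).Nonempty
    · obtain ⟨z, hz⟩ := hne
      exact ⟨_, fun y hy => hAB.constant hcont hy hz⟩
    · exact ⟨0, fun y hy => absurd ⟨y, hy⟩ hne⟩
  have hst : ∀ k, ∀ y ∈ A ∩ B, y ∈ U k → s k y = t k y + c := fun k y hy hk => by
    have e1 := hkl k (idx y) y hy hk (hidx y hy)
    rw [hcc y hy] at e1
    have e2 := zmod_two_add_self (t k y)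
    linear_combination e1 - e2
  refine ⟨fun k y => if y ∈ A then s k y else t k y + c, fun k y hy => ?_, fun k l y hy hk hl => ?_⟩
  · refine ContinuousAt.continuousWithinAt ?_
    by_cases hyA : y ∈ A
    · have c1 : ContinuousAt (s k) y := (hs k).continuousAt ((hA.inter (hU _)).mem_nhds ⟨hyA, hy.2⟩)
      refine c1.congr ?_
      filter_upwards [hA.mem_nhds hyA] with z hz
      rw [if_pos hz]
    · have hyB : y ∈ B := hy.1.resolve_left hyA
      have c2 : ContinuousAt (t k) y := (ht k).continuousAt ((hB.inter (hU _)).mem_nhds ⟨hyB, hy.2⟩)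
      refine (c2.add (continuousAt_const (y := c))).congr ?_
      filter_upwards [(hB.inter (hU _)).mem_nhds ⟨hyB, hy.2⟩] with z hz
      by_cases hzA : z ∈ A
      · exact (if_pos hzA).symm ▸ (hst k z ⟨hzA, hz.1⟩ hz.2).symm
      · exact (if_neg hzA).symm
  · dsimp only
    by_cases hyA : y ∈ A
    · rw [if_pos hyA, if_pos hyA]
      exact hs' k l y hyA hk hl
    · rw [if_neg hyA, if_neg hyA]
      have e1 := zmod_two_add_self c
      linear_combination ht' k l y (hy.resolve_left hyA) hk hl + e1

lemma CocyclesTrivial.of_leftInverse {Y : Type*} [TopologicalSpace Y] {S : Set X} {T : Set Y}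
    (hS : CocyclesTrivial ι S) (f : X → Y) (hf : Continuous f) (hfS : Set.MapsTo f S T) (g : Y → X)
    (hg : ContinuousOn g T) (hgT : Set.MapsTo g T S) (hfg : ∀ y ∈ T, f (g y) = y) :
    CocyclesTrivial ι T := by
  intro U h hU hTU hh hc
  obtain ⟨s, hs, hs'⟩ := hS (fun k => f ⁻¹' U k) (fun k l x => h k l (f x))
    (fun k => (hU k).preimage hf) (fun x hx => by
      obtain ⟨k, hk⟩ := Set.mem_iUnion.1 (hTU (hfS hx))
      exact Set.mem_iUnion.2 ⟨k, hk⟩)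
    (fun k l => (hh k l).comp hf.continuousOn fun x hx => hx)
    (fun k l m x hx => hc k l m (f x) (hfS hx))
  refine ⟨fun k y => s k (g y), fun k => (hs k).comp (hg.mono Set.inter_subset_left) fun y hy =>
    ⟨hgT hy.1, ?_⟩, fun k l y hy hk hl => ?_⟩
  · rw [Set.mem_preimage, hfg y hy.1]
    exact hy.2
  · have := hs' k l (g y) (hgT hy) (by rwa [Set.mem_preimage, hfg y hy])
      (by rwa [Set.mem_preimage, hfg y hy])
    rwa [hfg y hy] at this

open Module in
-- The complements of two opposite closed rays are star-shaped and cover the punctured space. They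
-- meet in the complement of a line, which is connected because its codimension is two.
lemma cocyclesTrivial_compl_zero [Nonempty ι] [FiniteDimensional ℝ E] (hE : finrank ℝ E = 3) :
    CocyclesTrivial ι ({0}ᶜ : Set E) := by
  have : Nontrivial E := Module.nontrivial_of_finrank_pos (R := ℝ) (by omega)
  obtain ⟨a, ha⟩ := exists_ne (0 : E)
  have key : ∀ a : E, a ≠ 0 → CocyclesTrivial ι {y : E | ∀ t : ℝ, 0 ≤ t → y ≠ t • a} ∧
      IsOpen {y : E | ∀ t : ℝ, 0 ≤ t → y ≠ t • a} := by
    intro a ha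
    have ho : IsOpen {y : E | ∀ t : ℝ, 0 ≤ t → y ≠ t • a} := by
      have hcl : IsClosed ((fun t : ℝ => t • a) '' Set.Ici 0) :=
        (isClosedEmbedding_smul_left ha).isClosedMap _ isClosed_Ici
      convert hcl.isOpen_compl using 1
      ext y
      simp only [Set.mem_ofPred_eq, Set.mem_compl_iff, Set.mem_image, Set.mem_Ici, not_exists,
        not_and]
      exact forall₂_congr fun t _ => ne_comm
    refine ⟨cocyclesTrivial_of_starConvex ho (a := -a) (fun t ht h => ?_) ?_, ho⟩
    · have : (t + 1) • a = 0 := by rw [add_smul, ← h]; simp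
      rcases smul_eq_zero.1 this with h | h
      · linarith
      · exact ha h
    · intro y hy p q hp hq hpq t ht h
      rcases hq.eq_or_lt with rfl | hq
      · have : (t + p) • a = 0 := by rw [add_smul, ← h]; simp
        rcases smul_eq_zero.1 this with h | h
        · linarith
        · exact ha h
      · refine hy (q⁻¹ * (t + p)) (by positivity) ?_
        have : q • y = (t + p) • a := by rw [add_smul, ← h]; simp
        rw [mul_smul, ← this, inv_smul_smul₀ hq.ne']
  have hneg : -a ≠ 0 := neg_ne_zero.2 ha
  have hun : ({0}ᶜ : Set E) =
      {y : E | ∀ t : ℝ, 0 ≤ t → y ≠ t • a} ∪ {y : E | ∀ t : ℝ, 0 ≤ t → y ≠ t • -a} := by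
    ext y
    simp only [Set.mem_compl_iff, Set.mem_singleton_iff, Set.mem_union, Set.mem_ofPred_eq]
    constructor
    · intro hy
      by_contra! hcon
      obtain ⟨⟨t, ht, rfl⟩, u, hu, h⟩ := hcon
      have : (t + u) • a = 0 := by rw [add_smul, h]; simp
      rcases smul_eq_zero.1 this with h' | h'
      · obtain rfl : t = 0 := by linarith
        exact hy (zero_smul _ _)
      · exact ha h'
    · rintro (h | h) rfl
      · exact h 0 le_rfl (by simp)
      · exact h 0 le_rfl (by simp)
  rw [hun]
  refine CocyclesTrivial.union (key a ha).2 (key _ hneg).2 ?_ (key a ha).1 (key _ hneg).1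
  have hint : {y : E | ∀ t : ℝ, 0 ≤ t → y ≠ t • a} ∩ {y : E | ∀ t : ℝ, 0 ≤ t → y ≠ t • -a} =
      ((Submodule.span ℝ {a} : Submodule ℝ E) : Set E)ᶜ := by
    ext y
    simp only [Set.mem_inter_iff, Set.mem_ofPred_eq, Set.mem_compl_iff, SetLike.mem_coe,
      Submodule.mem_span_singleton, not_exists]
    constructor
    · rintro ⟨h1, h2⟩ t h
      rcases le_total 0 t with ht | ht
      · exact h1 t ht h.symm
      · exact h2 (-t) (by linarith) (by simp [h])
    · intro h
      exact ⟨fun t _ h' => h t h'.symm, fun t _ h' => h (-t) (by simp [h'])⟩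
  rw [hint]
  refine (isConnected_compl_of_one_lt_codim ?_).isPreconnected
  have h1 := Submodule.finrank_quotient_add_finrank (Submodule.span ℝ {a})
  rw [finrank_span_singleton ha, hE] at h1
  rw [← Module.finrank_eq_rank]
  have : finrank ℝ (E ⧸ Submodule.span ℝ {a}) = 2 := by omega
  rw [this]
  norm_num

open Metric in
/-- Cocycles on a punctured ball in three-dimensional Euclidean space are coboundaries. -/
lemma cocyclesTrivial_ball [Nonempty ι] (p : EuclideanSpace ℝ (Fin 3)) {r : ℝ} (hr : 0 < r) :
    CocyclesTrivial ι (ball p r \ {p}) := by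
  let ψ := OpenPartialHomeomorph.univBall p r
  have hs : ψ.source = Set.univ := OpenPartialHomeomorph.univBall_source p r
  have ht : ψ.target = ball p r := OpenPartialHomeomorph.univBall_target p hr
  have h0 : ψ 0 = p := OpenPartialHomeomorph.univBall_apply_zero p r
  refine (cocyclesTrivial_compl_zero (by simp)).of_leftInverse ψ
    (OpenPartialHomeomorph.continuous_univBall p r) (fun x hx => ⟨?_, fun h => hx ?_⟩) ψ.symm
    ((OpenPartialHomeomorph.continuousOn_univBall_symm p r).mono Set.sdiff_subset)
    (fun y hy h => hy.2 ?_) fun y hy => ψ.right_inv (ht ▸ hy.1)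
  · rw [← ht]
    exact ψ.map_source (hs ▸ Set.mem_univ x)
  · exact ψ.injOn (hs ▸ Set.mem_univ x) (hs ▸ Set.mem_univ 0) (h.trans h0.symm)
  · rw [Set.mem_singleton_iff] at h ⊢
    rw [← ψ.right_inv (ht ▸ hy.1 : y ∈ ψ.target), h, h0]

end Cocycle

end Gem

namespace Gem

section Link

/-! ### The vertex links of a gem are acyclic -/

variable {V E : Type*} [NormedAddCommGroup E] [NormedSpace ℝ E]

/-- The maps `f v` are the restrictions to the simplices of a piecewise linear homeomorphism of the
complex of the 4-coloured graph `σ` onto `M`. -/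
structure IsGemMap (σ : Fin 4 → V → V) (f : V → (Fin 4 → ℝ) → E) (M : Set E) : Prop where
  isPLOn : ∀ v, IsPLOn (f v) Simplex
  eq_iff : ∀ v, ∀ x ∈ Simplex, ∀ w, ∀ y ∈ Simplex, f v x = f w y ↔ SamePoint σ (v, x) (w, y)
  range : ∀ y, y ∈ M ↔ ∃ v, ∃ x ∈ Simplex, f v x = y

/-- The link of the vertices coloured `c`. -/
def link (σ : Fin 4 → V → V) (c : Fin 4) (i : Fin 3) : V → V := σ (c.succAbove i)

/-- The point of the simplex with barycentric coordinate `u i` at the vertex `c.succAbove i`. -/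
def simplexPoint (c : Fin 4) (u : Fin 3 → ℝ) : Fin 4 → ℝ := c.insertNth (1 - ∑ i, u i) u

lemma simplexPoint_same (c : Fin 4) (u : Fin 3 → ℝ) : simplexPoint c u c = 1 - ∑ i, u i := by
  simp [simplexPoint]

lemma simplexPoint_succAbove (c : Fin 4) (u : Fin 3 → ℝ) (i : Fin 3) :
    simplexPoint c u (c.succAbove i) = u i := by
  simp [simplexPoint]

lemma simplexPoint_mem (c : Fin 4) {u : Fin 3 → ℝ} (hu : ∀ i, 0 ≤ u i) (hs : ∑ i, u i ≤ 1) :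
    simplexPoint c u ∈ Simplex := by
  refine ⟨fun m => ?_, ?_⟩
  · rcases c.eq_self_or_eq_succAbove m with rfl | ⟨i, rfl⟩
    · rw [simplexPoint_same]; linarith
    · rw [simplexPoint_succAbove]; exact hu i
  · rw [Fin.sum_univ_succAbove _ c, simplexPoint_same]
    simp [simplexPoint_succAbove]

lemma simplexPoint_dist (c : Fin 4) {u : Fin 3 → ℝ} {t : ℝ} (hu : ∀ i, 0 ≤ u i) (ht : ∀ i, u i ≤ t) :
    dist (simplexPoint c u) (Pi.single c 1) ≤ 3 * t := by
  have ht0 : 0 ≤ t := (hu 0).trans (ht 0)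
  refine (dist_pi_le_iff (by linarith)).2 fun m => ?_
  rcases c.eq_self_or_eq_succAbove m with rfl | ⟨i, rfl⟩
  · rw [simplexPoint_same, Pi.single_eq_same, Real.dist_eq, Fin.sum_univ_three, abs_le]
    constructor <;> linarith [hu 0, hu 1, hu 2, ht 0, ht 1, ht 2]
  · rw [simplexPoint_succAbove, Pi.single_eq_of_ne (Fin.succAbove_ne _ _), Real.dist_eq, abs_le]
    constructor <;> linarith [hu i, ht i]

variable {σ : Fin 4 → V → V} {f : V → (Fin 4 → ℝ) → E} {M : Set E}

lemma IsGemMap.isCompact_image [Finite V] (hf : IsGemMap σ f M) (A : Set V) {B : Set (Fin 4 → ℝ)}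
    (hB : IsClosed B) : IsCompact (⋃ w ∈ A, f w '' (Simplex ∩ B)) := by
  refine A.toFinite.isCompact_biUnion fun w _ => ?_
  exact ((isCompact_stdSimplex ℝ (Fin 4)).inter_right hB).image_of_continuousOn
    ((hf.isPLOn w).continuousOn.mono Set.inter_subset_left)

open Metric in
-- A cocycle on the link becomes a Čech cocycle on a punctured ball around the image of the vertex
-- in a chart, where it is a coboundary. Near the vertex the solution is constant on each simplex,
-- and these constants give the potential.
lemma IsGemMap.exists_link_potential [FiniteDimensional ℝ E] [Finite V]
    (hf : IsGemMap σ f M) (hM : IsClosedPLManifold 3 M) (c : Fin 4) (v₀ : V) {h : Fin 3 → V → ZMod 2}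
    (hh : ∀ i j k, i ≠ j → i ≠ k → j ≠ k → ∀ v,
      h i (link σ c k v) + h j (link σ c k v) = h i v + h j v) :
    ∃ F : V → ZMod 2, ∀ i k, i ≠ k → ∀ v, Joined σ {c}ᶜ v₀ v →
      F (link σ c i v) + h k (link σ c i v) = F v + h k v := by
  classical
  set e : Fin 4 → ℝ := Pi.single c 1 with he
  have heS : e ∈ Simplex := single_mem_stdSimplex ℝ c
  have he0 : ∀ i : Fin 3, e (c.succAbove i) = 0 := fun i => by
    rw [he, Pi.single_eq_of_ne (Fin.succAbove_ne _ _)]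
  set p := f v₀ e with hp
  have hpC : ∀ w, Joined σ {c}ᶜ v₀ w → f w e = p := fun w hw =>
    ((hf.eq_iff v₀ e heS w e heS).2 ⟨rfl, hw.mono fun i (hi : i ≠ c) =>
      (Pi.single_eq_of_ne hi 1 : e i = 0)⟩).symm
  have hpM : p ∈ M := (hf.range p).2 ⟨v₀, e, heS, rfl⟩
  obtain ⟨N, hNM, hN, χ, hχ, hinj, hnhds⟩ := hM.2 p hpM
  have hpN : p ∈ N := mem_of_mem_nhdsWithin hpM hN
  have hNc : IsCompact N := hχ.isCompactPolyhedron.isCompact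
  have hcl : ∀ (A : Set V) (B : Set (Fin 4 → ℝ)), IsClosed B →
      IsClosed (χ '' (N ∩ ⋃ w ∈ A, f w '' (Simplex ∩ B))) := fun A B hB =>
    ((hNc.inter (hf.isCompact_image A hB)).image_of_continuousOn
      (hχ.continuousOn.mono Set.inter_subset_left)).isClosed
  have hex : ∀ z : E, ∃ q : V × (Fin 4 → ℝ), z ∈ M → q.2 ∈ Simplex ∧ f q.1 q.2 = z := fun z => by
    by_cases hz : z ∈ M
    · obtain ⟨w, x, hx, hw⟩ := (hf.range z).1 hz
      exact ⟨(w, x), fun _ => ⟨hx, hw⟩⟩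
    · exact ⟨(v₀, 0), fun h => absurd h hz⟩
  choose q hq using hex
  have hqf : ∀ w, ∀ x ∈ Simplex, (q (f w x)).2 = x ∧ Joined σ {i | x i = 0} w (q (f w x)).1 := by
    intro w x hx
    have h1 := hq _ ((hf.range _).2 ⟨w, x, hx, rfl⟩)
    have h2 := (hf.eq_iff _ _ hx _ _ h1.1).1 h1.2.symm
    exact ⟨h2.1.symm, h2.2⟩
  have hex : ∀ y, ∃ z, y ∈ χ '' N → z ∈ N ∧ χ z = y := fun y => by
    by_cases hy : y ∈ χ '' N
    · obtain ⟨z, hz, hzy⟩ := hy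
      exact ⟨z, fun _ => ⟨hz, hzy⟩⟩
    · exact ⟨p, fun h => absurd h hy⟩
  choose ξ hξ using hex
  have hξχ : ∀ z ∈ N, ξ (χ z) = z := fun z hz =>
    hinj (hξ _ ⟨z, hz, rfl⟩).1 hz (hξ _ ⟨z, hz, rfl⟩).2
  -- The ball must avoid the simplices outside the residue of `v₀` and all faces opposite to `c`.
  -- Both are compact and miss `p`.
  have hBex : χ '' N ∩ (χ '' (N ∩ ⋃ w ∈ {w | ¬ Joined σ {c}ᶜ v₀ w}, f w '' (Simplex ∩ Set.univ)))ᶜ ∩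
      (χ '' (N ∩ ⋃ w ∈ (Set.univ : Set V), f w '' (Simplex ∩ {x | x c = 0})))ᶜ ∈ nhds (χ p) := by
    refine Filter.inter_mem (Filter.inter_mem hnhds ((hcl _ _ isClosed_univ).isOpen_compl.mem_nhds ?_))
      ((hcl _ _ (isClosed_eq (continuous_apply c) continuous_const)).isOpen_compl.mem_nhds ?_)
    · rintro ⟨z, ⟨hzN, hz⟩, hzp⟩
      obtain rfl := hinj hzN hpN hzp
      simp only [Set.mem_iUnion, Set.mem_image] at hz
      obtain ⟨w, hw, x, hx, hwx⟩ := hz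
      obtain ⟨h1, h2⟩ := (hf.eq_iff _ _ heS _ _ hx.1).1 hwx.symm
      refine hw (h2.mono fun i hi => ?_)
      rintro rfl
      simp [he] at hi
    · rintro ⟨z, ⟨hzN, hz⟩, hzp⟩
      obtain rfl := hinj hzN hpN hzp
      simp only [Set.mem_iUnion, Set.mem_image] at hz
      obtain ⟨w, hw, x, hx, hwx⟩ := hz
      obtain ⟨h1, h2⟩ := (hf.eq_iff _ _ heS _ _ hx.1).1 hwx.symm
      have h3 : x c = 0 := hx.2
      dsimp only at h1
      rw [← h1] at h3
      simp [he] at h3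
  obtain ⟨r, hr, hBr⟩ := Metric.mem_nhds_iff.1 hBex
  set B := ball (χ p) r with hBdef
  have hBN : ∀ y ∈ B, ξ y ∈ N ∧ χ (ξ y) = y := fun y hy => hξ y (hBr hy).1.1
  have hBq : ∀ y ∈ B, (q (ξ y)).2 ∈ Simplex ∧ f (q (ξ y)).1 (q (ξ y)).2 = ξ y := fun y hy =>
    hq _ (hNM (hBN y hy).1)
  have hBC : ∀ y ∈ B, Joined σ {c}ᶜ v₀ (q (ξ y)).1 := fun y hy => by
    by_contra hcon
    refine (hBr hy).1.2 ⟨ξ y, ⟨(hBN y hy).1, ?_⟩, (hBN y hy).2⟩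
    exact Set.mem_biUnion (x := (q (ξ y)).1) hcon ⟨_, ⟨(hBq y hy).1, trivial⟩, (hBq y hy).2⟩
  have hBc : ∀ y ∈ B, (q (ξ y)).2 c ≠ 0 := fun y hy hcon => by
    refine (hBr hy).2 ⟨ξ y, ⟨(hBN y hy).1, ?_⟩, (hBN y hy).2⟩
    exact Set.mem_biUnion (x := (q (ξ y)).1) trivial ⟨_, ⟨(hBq y hy).1, hcon⟩, (hBq y hy).2⟩
  -- The open stars: where the `k`-th link coordinate is nonzero. Only the vertex itself lies in
  -- none of them.
  let U : Fin 3 → Set (EuclideanSpace ℝ (Fin 3)) := fun k =>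
    B ∩ (χ '' (N ∩ ⋃ w ∈ (Set.univ : Set V), f w '' (Simplex ∩ {x | x (c.succAbove k) = 0})))ᶜ
  have hU : ∀ k, IsOpen (U k) := fun k =>
    isOpen_ball.inter (hcl _ _ (isClosed_eq (continuous_apply _) continuous_const)).isOpen_compl
  have hUiff : ∀ k, ∀ y ∈ B, y ∈ U k ↔ (q (ξ y)).2 (c.succAbove k) ≠ 0 := by
    intro k y hy
    constructor
    · intro hk hcon
      refine hk.2 ⟨ξ y, ⟨(hBN y hy).1, ?_⟩, (hBN y hy).2⟩
      exact Set.mem_biUnion (x := (q (ξ y)).1) trivial ⟨_, ⟨(hBq y hy).1, hcon⟩, (hBq y hy).2⟩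
    · refine fun hk => ⟨hy, ?_⟩
      rintro ⟨z, ⟨hzN, hz⟩, rfl⟩
      simp only [Set.mem_iUnion, Set.mem_image] at hz
      obtain ⟨w, hw, x, hx, rfl⟩ := hz
      rw [hξχ _ hzN, (hqf w x hx.1).1] at hk
      exact hk hx.2
  -- On `U k ∩ U l` a point can change its simplex only across the third link colour, and the
  -- cocycle identity makes `h k + h l` invariant under that colour.
  have hinv : ∀ k l w w' (x : Fin 4 → ℝ), x c ≠ 0 → x (c.succAbove k) ≠ 0 →
      x (c.succAbove l) ≠ 0 → Joined σ {i | x i = 0} w w' → h k w' + h l w' = h k w + h l w := by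
    intro k l w w' x hc hk hl hw
    by_cases hkl : k = l
    · subst hkl
      rw [zmod_two_add_self, zmod_two_add_self]
    · refine hw.apply_eq (f := fun w => h k w + h l w) fun i hi v => ?_
      rcases c.eq_self_or_eq_succAbove i with rfl | ⟨m, rfl⟩
      · exact absurd hi hc
      · refine hh k l m hkl ?_ ?_ v
        · rintro rfl; exact hk hi
        · rintro rfl; exact hl hi
  have hcover : B \ {χ p} ⊆ ⋃ k, U k := by
    rintro y ⟨hy, hyp⟩
    by_contra hcon
    simp only [Set.mem_iUnion, not_exists] at hcon
    have h0 : ∀ k : Fin 3, (q (ξ y)).2 (c.succAbove k) = 0 := fun k => by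
      by_contra h; exact hcon k ((hUiff k y hy).2 h)
    have hqe : (q (ξ y)).2 = e := by
      have h1 := (hBq y hy).1.2
      rw [Fin.sum_univ_succAbove _ c] at h1
      simp only [h0, Finset.sum_const_zero, add_zero] at h1
      funext m
      rcases c.eq_self_or_eq_succAbove m with rfl | ⟨i, rfl⟩
      · rw [h1, he, Pi.single_eq_same]
      · rw [h0, he0]
    have h1 := (hBq y hy).2
    rw [hqe, hpC _ (hBC y hy)] at h1
    refine hyp ?_
    rw [Set.mem_singleton_iff, h1, (hBN y hy).2]
  have hgcont : ∀ k l, ContinuousOn (fun y => h k (q (ξ y)).1 + h l (q (ξ y)).1) (U k ∩ U l) := by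
    intro k l y hy
    refine ContinuousAt.continuousWithinAt ?_
    have hyB : y ∈ B := hy.1.1
    refine continuousAt_const.congr (f := fun _ => h k (q (ξ y)).1 + h l (q (ξ y)).1) ?_
    have hnot : y ∉ χ '' (N ∩ ⋃ w ∈ {w | h k w + h l w ≠ h k (q (ξ y)).1 + h l (q (ξ y)).1},
        f w '' (Simplex ∩ Set.univ)) := by
      rintro ⟨z, ⟨hzN, hz⟩, hzy⟩
      simp only [Set.mem_iUnion, Set.mem_image] at hz
      obtain ⟨w, hw, x, hx, rfl⟩ := hz
      rw [Set.mem_ofPred_eq, ← hzy, hξχ _ hzN] at hw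
      have h1 := hBc y hyB
      have h2 := (hUiff k y hyB).1 hy.1
      have h3 := (hUiff l y hyB).1 hy.2
      rw [← hzy, hξχ _ hzN, (hqf w x hx.1).1] at h1 h2 h3
      exact hw (hinv k l _ _ x h1 h2 h3 (hqf w x hx.1).2).symm
    filter_upwards [(hcl _ _ isClosed_univ).isOpen_compl.mem_nhds hnot,
      (isOpen_ball.mem_nhds hyB : B ∈ nhds y)] with y' hy' hyB'
    by_contra hcon
    refine hy' ⟨ξ y', ⟨(hBN y' hyB').1, ?_⟩, (hBN y' hyB').2⟩
    exact Set.mem_biUnion (x := (q (ξ y')).1) (Ne.symm hcon)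
      ⟨_, ⟨(hBq y' hyB').1, trivial⟩, (hBq y' hyB').2⟩
  obtain ⟨s, hs, hs'⟩ := cocyclesTrivial_ball (ι := Fin 3) (χ p) hr U
    (fun k l y => h k (q (ξ y)).1 + h l (q (ξ y)).1) hU hcover hgcont fun k l m y _ _ _ _ => by
      have := zmod_two_add_self (h l (q (ξ y)).1)
      linear_combination this
  obtain ⟨δ, hδ, hW⟩ : ∃ δ > 0, ∀ w, Joined σ {c}ᶜ v₀ w → ∀ x ∈ ball e δ ∩ Simplex,
      f w x ∈ N ∧ χ (f w x) ∈ B := by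
    have hev : ∀ᶠ x in nhdsWithin e Simplex, ∀ w, Joined σ {c}ᶜ v₀ w →
        f w x ∈ N ∧ χ (f w x) ∈ B := by
      refine Filter.eventually_all.2 fun w => ?_
      by_cases hw : Joined σ {c}ᶜ v₀ w
      · have t1 : Filter.Tendsto (f w) (nhdsWithin e Simplex) (nhdsWithin p M) := by
          refine tendsto_nhdsWithin_iff.2 ⟨?_, ?_⟩
          · have := (hf.isPLOn w).continuousOn e heS
            rwa [ContinuousWithinAt, hpC w hw] at this
          · filter_upwards [self_mem_nhdsWithin] with x hx
            exact (hf.range _).2 ⟨w, x, hx, rfl⟩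
        have t2 : Filter.Tendsto (f w) (nhdsWithin e Simplex) (nhdsWithin p N) :=
          tendsto_nhdsWithin_iff.2 ⟨t1.mono_right nhdsWithin_le_nhds, t1 hN⟩
        have t3 : Filter.Tendsto (fun x => χ (f w x)) (nhdsWithin e Simplex) (nhds (χ p)) :=
          Filter.Tendsto.comp (hχ.continuousOn p hpN) t2
        filter_upwards [t1 hN, t3 (ball_mem_nhds _ hr)] with x h1 h2 _
        exact ⟨h1, h2⟩
      · exact Filter.Eventually.of_forall fun x h => absurd h hw
    obtain ⟨δ, hδ, hsub⟩ := Metric.mem_nhdsWithin_iff.1 hev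
    exact ⟨δ, hδ, fun w hw x hx => hsub hx w hw⟩
  have hqW : ∀ w, Joined σ {c}ᶜ v₀ w → ∀ x ∈ ball e δ ∩ Simplex, ∀ k, x (c.succAbove k) ≠ 0 →
      χ (f w x) ∈ (B \ {χ p}) ∩ U k := by
    intro w hw x hx k hk
    have h1 := hW w hw x hx
    refine ⟨⟨h1.2, fun h => hk ?_⟩, (hUiff k _ h1.2).2 ?_⟩
    · have h2 := hinj h1.1 hpN h
      have h3 := ((hf.eq_iff _ _ hx.2 _ _ heS).1 h2).1
      dsimp only at h3
      rw [h3, he0]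
    · rwa [hξχ _ h1.1, (hqf w x hx.2).1]
  -- With link coordinates at most `t`, the point is within `3 * t < δ` of the vertex and its `c`-th
  -- coordinate stays positive.
  set t := min (δ / 6) (1 / 6) with ht
  have htδ : t ≤ δ / 6 := min_le_left _ _
  have ht1 : t ≤ 1 / 6 := min_le_right _ _
  have ht0 : 0 < t := lt_min (by positivity) (by norm_num)
  have hpt : ∀ u : Fin 3 → ℝ, (∀ i, 0 ≤ u i) → (∀ i, u i ≤ t) →
      simplexPoint c u ∈ ball e δ ∩ Simplex := fun u h0 h1 => by
    refine ⟨mem_ball.2 ((simplexPoint_dist c h0 h1).trans_lt (by linarith)),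
      simplexPoint_mem c h0 ?_⟩
    rw [Fin.sum_univ_three]
    linarith [h1 0, h1 1, h1 2]
  have hall := hpt (fun _ => t) (fun _ => ht0.le) fun _ => le_rfl
  let S : V → Fin 3 → ZMod 2 := fun w k => s k (χ (f w (simplexPoint c fun _ => t)))
  have hconst : ∀ w, Joined σ {c}ᶜ v₀ w → ∀ k, ∀ x ∈ ball e δ ∩ Simplex, x (c.succAbove k) ≠ 0 →
      s k (χ (f w x)) = S w k := by
    intro w hw k x hx hk
    have hconv : Convex ℝ ((ball e δ ∩ Simplex) ∩ {x | 0 < x (c.succAbove k)}) := by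
      refine ((convex_ball e δ).inter (convex_stdSimplex ℝ _)).inter ?_
      exact convex_halfSpace_gt (f := fun x : Fin 4 → ℝ => x (c.succAbove k))
        ⟨fun _ _ => rfl, fun _ _ => rfl⟩ 0
    refine hconv.isPreconnected.constant (f := fun x => s k (χ (f w x))) ?_
      ⟨hx, lt_of_le_of_ne (hx.2.1 _) hk.symm⟩ ⟨hall, ?_⟩
    · refine (hs k).comp ((hχ.continuousOn.comp ((hf.isPLOn w).continuousOn.mono fun x hx => hx.1.2)
        fun x hx => (hW w hw x hx.1).1)) fun x hx => hqW w hw x hx.1 k (ne_of_gt hx.2)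
    · rw [Set.mem_ofPred_eq, simplexPoint_succAbove]; exact ht0
  have hSh : ∀ w, Joined σ {c}ᶜ v₀ w → ∀ k l, S w k + h k w = S w l + h l w := by
    intro w hw k l
    have hk : ∀ k, simplexPoint c (fun _ => t) (c.succAbove k) ≠ 0 := fun k => by
      rw [simplexPoint_succAbove]; exact ht0.ne'
    have h1 := hqW w hw _ hall k (hk k)
    have h2 := hqW w hw _ hall l (hk l)
    have h3 := hs' k l _ h1.1 h1.2 h2.2
    have h4 := hqf w _ hall.2
    have h5 : (q (f w (simplexPoint c fun _ => t))).1 = w := h4.2.apply_eq (f := id) fun i hi => by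
      exfalso
      rcases c.eq_self_or_eq_succAbove i with rfl | ⟨m, rfl⟩
      · have hi' : simplexPoint i (fun _ => t) i = 0 := hi
        rw [simplexPoint_same, Fin.sum_univ_three] at hi'
        linarith
      · exact hk m hi
    rw [hξχ _ (hW w hw _ hall).1, h5] at h3
    have e1 := zmod_two_add_self (h k w)
    have e2 := zmod_two_add_self (S w l)
    change S w k + S w l = h k w + h l w at h3
    linear_combination h3 + e1 - e2
  -- By `hSh` the index `0` may be replaced by any `k`. A point on the face of colour `i` with
  -- nonzero `k`-th coordinate then shows that `S · k` does not change across this face.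
  refine ⟨fun w => S w 0 + h 0 w, fun i k hik v hv => ?_⟩
  have hv' : Joined σ {c}ᶜ v₀ (link σ c i v) := hv.trans (Joined.edge σ (Fin.succAbove_ne c i) v)
  have hx := hpt (fun j => if j = i then 0 else t) (fun j => by split_ifs <;> linarith)
    fun j => by split_ifs <;> linarith
  have hxk : simplexPoint c (fun j => if j = i then 0 else t) (c.succAbove k) ≠ 0 := by
    rw [simplexPoint_succAbove, if_neg hik.symm]; exact ht0.ne'
  have hxi : simplexPoint c (fun j => if j = i then 0 else t) (c.succAbove i) = 0 := by
    rw [simplexPoint_succAbove, if_pos rfl]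
  have h1 := hconst v hv k _ hx hxk
  have h2 := hconst _ hv' k _ hx hxk
  rw [← (hf.eq_iff v _ hx.2 (link σ c i v) _ hx.2).2 (SamePoint.edge σ v hxi), h1] at h2
  dsimp only
  rw [hSh v hv 0 k, hSh _ hv' 0 k, h2]
  have e1 := zmod_two_add_self (h k v)
  have e2 := zmod_two_add_self (h k (link σ c i v))
  linear_combination e2 - e1

/-- The link of each vertex of a complex that is homeomorphic to a 3-manifold is acyclic. -/
lemma IsGemMap.isAcyclic_link [FiniteDimensional ℝ E] [Finite V] (hσ : IsColouring σ) (hf : IsGemMap σ f M)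
    (hM : IsClosedPLManifold 3 M) (c : Fin 4) : IsAcyclic (link σ c) := by
  intro h hh
  choose F hF using fun v₀ => hf.exists_link_potential hM c v₀ hh
  let R : Setoid V := ⟨fun v w => Joined σ {c}ᶜ v w, fun v => Joined.refl _ _ v,
    fun h => h.symm hσ, fun h h' => h.trans h'⟩
  -- Potentials are chosen separately on the components of the link, so adjacent vertices must use
  -- the same representative.
  let rep : V → V := fun v => (Quotient.mk R v).out
  have hrep : ∀ v, Joined σ {c}ᶜ (rep v) v := fun v => Quotient.exact (Quotient.mk R v).out_eq
  refine ⟨fun v => F (rep v) v, fun i k hik v => ?_⟩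
  have : rep (link σ c i v) = rep v := by
    have : Quotient.mk R (link σ c i v) = Quotient.mk R v :=
      Quotient.sound ((Joined.edge σ (Fin.succAbove_ne c i) v : Joined σ {c}ᶜ _ _).symm hσ)
    simp only [rep, this]
  dsimp only
  rw [this]
  exact hF (rep v) i k hik v (hrep v)

end Link

end Gem

namespace Gem

section Cone

/-! ### Cones over spheres -/

lemma bipyramidGauge_smul {t : ℝ} (ht : 0 ≤ t) (y : Fin 3 → ℝ) :
    bipyramidGauge (t • y) = t * bipyramidGauge y := by
  simp only [bipyramidGauge, Pi.smul_apply, smul_eq_mul, ← mul_add, abs_mul, abs_of_nonneg ht,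
    ← mul_min_of_nonneg _ _ ht]
  ring

lemma bipyramidGauge_nonneg (y : Fin 3 → ℝ) : 0 ≤ bipyramidGauge y := by
  have h0 := abs_nonneg (y 0 + y 1 + y 2)
  have m0 : min (y 0) (min (y 1) (y 2)) ≤ y 0 := min_le_left _ _
  have m1 : min (y 0) (min (y 1) (y 2)) ≤ y 1 := (min_le_right _ _).trans (min_le_left _ _)
  have m2 : min (y 0) (min (y 1) (y 2)) ≤ y 2 := (min_le_right _ _).trans (min_le_right _ _)
  rw [bipyramidGauge]
  linarith

lemma eq_zero_of_bipyramidGauge {y : Fin 3 → ℝ} (hy : bipyramidGauge y = 0) : y = 0 := by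
  have h0 := abs_nonneg (y 0 + y 1 + y 2)
  have m0 : min (y 0) (min (y 1) (y 2)) ≤ y 0 := min_le_left _ _
  have m1 : min (y 0) (min (y 1) (y 2)) ≤ y 1 := (min_le_right _ _).trans (min_le_left _ _)
  have m2 : min (y 0) (min (y 1) (y 2)) ≤ y 2 := (min_le_right _ _).trans (min_le_right _ _)
  rw [bipyramidGauge] at hy
  have hS : y 0 + y 1 + y 2 = 0 := abs_eq_zero.1 (by linarith)
  rw [hS] at hy
  simp only [abs_zero] at hy
  funext i
  fin_cases i <;> simp <;> linarith

lemma continuous_bipyramidGauge : Continuous bipyramidGauge := by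
  unfold bipyramidGauge
  fun_prop

/-- The cone of a map defined on the triangle. -/
noncomputable def coneMap (φ : (Fin 3 → ℝ) → (Fin 3 → ℝ)) (u : Fin 3 → ℝ) : Fin 3 → ℝ :=
  (∑ i, u i) • φ ((∑ i, u i)⁻¹ • u)

lemma coneMap_smul (φ : (Fin 3 → ℝ) → (Fin 3 → ℝ)) (t : ℝ) {x : Fin 3 → ℝ} (hx : x ∈ Triangle) :
    coneMap φ (t • x) = t • φ x := by
  have hs : ∑ i, (t • x) i = t := by
    simp only [Pi.smul_apply, smul_eq_mul, ← Finset.mul_sum, hx.2, mul_one]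
  rw [coneMap, hs]
  by_cases ht : t = 0
  · rw [ht, zero_smul, zero_smul]
  · rw [inv_smul_smul₀ ht]

/-- The cone with apex `0` over the triangle. -/
def Corner : Set (Fin 3 → ℝ) := {u | (∀ i, 0 ≤ u i) ∧ ∑ i, u i ≤ 1}

lemma inv_smul_mem_triangle {u : Fin 3 → ℝ} (hu : u ∈ Corner) (h : ∑ i, u i ≠ 0) :
    (∑ i, u i)⁻¹ • u ∈ Triangle := by
  have h0 : 0 ≤ ∑ i, u i := Finset.sum_nonneg fun i _ => hu.1 i
  refine ⟨fun i => mul_nonneg (inv_nonneg.2 h0) (hu.1 i), ?_⟩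
  simp only [Pi.smul_apply, smul_eq_mul, ← Finset.mul_sum]
  exact inv_mul_cancel₀ h

lemma exists_corner_eq {u : Fin 3 → ℝ} (hu : u ∈ Corner) :
    ∃ t ∈ Set.Icc (0 : ℝ) 1, ∃ x ∈ Triangle, u = t • x ∧ t = ∑ i, u i := by
  have h0 : 0 ≤ ∑ i, u i := Finset.sum_nonneg fun i _ => hu.1 i
  refine ⟨∑ i, u i, ⟨h0, hu.2⟩, ?_⟩
  by_cases h : ∑ i, u i = 0
  · refine ⟨Pi.single 0 1, single_mem_stdSimplex ℝ 0, ?_, rfl⟩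
    rw [h, zero_smul]
    funext i
    exact (Finset.sum_eq_zero_iff_of_nonneg fun i _ => hu.1 i).1 h i (Finset.mem_univ i)
  · exact ⟨_, inv_smul_mem_triangle hu h, (smul_inv_smul₀ h u).symm, rfl⟩

lemma smul_mem_corner {t : ℝ} (ht : t ∈ Set.Icc (0 : ℝ) 1) {x : Fin 3 → ℝ} (hx : x ∈ Triangle) :
    t • x ∈ Corner := by
  refine ⟨fun i => mul_nonneg ht.1 (hx.1 i), ?_⟩
  simp only [Pi.smul_apply, smul_eq_mul, ← Finset.mul_sum, hx.2, mul_one]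
  exact ht.2

lemma mem_convexHull_insert_zero {s : Finset (Fin 3 → ℝ)} (hs : s.Nonempty) {u : Fin 3 → ℝ} :
    u ∈ convexHull ℝ (insert 0 (s : Set (Fin 3 → ℝ))) ↔
      ∃ t ∈ Set.Icc (0 : ℝ) 1, ∃ x ∈ convexHull ℝ (s : Set (Fin 3 → ℝ)), u = t • x := by
  rw [convexHull_insert (by exact_mod_cast hs), mem_convexJoin]
  constructor
  · rintro ⟨z, rfl, x, hx, a, t, ha, ht, hat, rfl⟩
    exact ⟨t, ⟨ht, by linarith⟩, x, hx, by simp⟩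
  · rintro ⟨t, ht, x, hx, rfl⟩
    exact ⟨0, rfl, x, hx, 1 - t, t, by linarith [ht.2], ht.1, by ring, by simp⟩

/-- Over a polytope on which `φ` is affine the cone map is linear: the constant term of the affine
map is multiplied by the coordinate sum, which equals `1` on the triangle. -/
lemma isPLOn_coneMap {φ : (Fin 3 → ℝ) → (Fin 3 → ℝ)} (hφ : IsPLOn φ Triangle) :
    IsPLOn (coneMap φ) Corner := by
  classical
  obtain ⟨P, hP, hT, hA⟩ := hφ
  have hsub : ∀ s ∈ P, convexHull ℝ (s : Set (Fin 3 → ℝ)) ⊆ Triangle := fun s hs => by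
    rw [hT]; exact Set.subset_biUnion_of_mem (u := fun s : Finset _ => convexHull ℝ _) hs
  refine ⟨(fun s => insert 0 s) '' {s ∈ P | s.Nonempty}, (hP.subset fun s hs => hs.1).image _,
    ?_, ?_⟩
  · ext u
    simp only [Set.biUnion_image, Set.mem_iUnion, Finset.coe_insert, exists_prop]
    constructor
    · intro hu
      obtain ⟨t, ht, x, hx, rfl, -⟩ := exists_corner_eq hu
      rw [hT] at hx
      simp only [Set.mem_iUnion, exists_prop] at hx
      obtain ⟨s, hs, hx⟩ := hx
      have hne : s.Nonempty := by
        have := convexHull_nonempty_iff.1 ⟨x, hx⟩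
        exact_mod_cast this
      exact ⟨s, ⟨hs, hne⟩, (mem_convexHull_insert_zero hne).2 ⟨t, ht, x, hx, rfl⟩⟩
    · rintro ⟨s, ⟨hs, hne⟩, hu⟩
      obtain ⟨t, ht, x, hx, rfl⟩ := (mem_convexHull_insert_zero hne).1 hu
      exact smul_mem_corner ht (hsub s hs hx)
  · rintro _ ⟨s, ⟨hs, hne⟩, rfl⟩
    obtain ⟨A, hA⟩ := hA s hs
    let L : (Fin 3 → ℝ) →ₗ[ℝ] (Fin 3 → ℝ) :=
      A.linear + (∑ i, LinearMap.proj i : (Fin 3 → ℝ) →ₗ[ℝ] ℝ).smulRight (A 0)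
    refine ⟨L.toAffineMap, fun u hu => ?_⟩
    rw [Finset.coe_insert] at hu
    obtain ⟨t, ht, x, hx, rfl⟩ := (mem_convexHull_insert_zero hne).1 hu
    rw [coneMap_smul φ t (hsub s hs hx), hA hx, LinearMap.coe_toAffineMap, map_smul]
    congr 1
    have h1 : A x = A.linear x + A 0 := by
      have := A.map_vadd 0 x
      simpa using this
    have h2 : ∑ i, x i = 1 := (hsub s hs hx).2
    simp [L, h1, h2]

lemma bipyramidGauge_coneMap {V : Type*} {φ : V → (Fin 3 → ℝ) → (Fin 3 → ℝ)}
    (h3 : ∀ y, bipyramidGauge y = 1 ↔ ∃ v, ∃ x ∈ Triangle, φ v x = y) (v : V) {u : Fin 3 → ℝ}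
    (hu : u ∈ Corner) : bipyramidGauge (coneMap (φ v) u) = ∑ i, u i := by
  obtain ⟨t, ht, x, hx, rfl, ht'⟩ := exists_corner_eq hu
  rw [coneMap_smul _ _ hx, bipyramidGauge_smul ht.1, (h3 _).2 ⟨v, x, hx, rfl⟩, mul_one]
  exact ht'

end Cone

section Residue

/-! ### The residue of a vertex -/

variable {V : Type*} {σ : Fin 4 → V → V}

/-- The vertices that are joined to `v₀` by edges of colours other than `c`. -/
abbrev Residue (σ : Fin 4 → V → V) (c : Fin 4) (v₀ : V) : Type _ := {w // Joined σ {c}ᶜ v₀ w}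

/-- The 3-coloured graph formed by the residue of a vertex. -/
def residueGraph (σ : Fin 4 → V → V) (c : Fin 4) (v₀ : V) (i : Fin 3) (w : Residue σ c v₀) :
    Residue σ c v₀ :=
  ⟨link σ c i w, w.2.trans (Joined.edge σ (Fin.succAbove_ne c i) w.1)⟩

lemma isColouring_residueGraph (hσ : IsColouring σ) (c : Fin 4) (v₀ : V) :
    IsColouring (residueGraph σ c v₀) :=
  ⟨fun _ _ => Subtype.ext (hσ.invol _ _), fun _ _ h => hσ.ne _ _ (congrArg Subtype.val h)⟩

lemma isConn_residueGraph (hσ : IsColouring σ) (c : Fin 4) (v₀ : V) :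
    IsConn (residueGraph σ c v₀) := by
  rintro A hA ⟨a, ha⟩
  refine Set.eq_univ_of_forall fun w => ?_
  have h1 : Joined σ {c}ᶜ a.1 w.1 := (a.2.symm hσ).trans w.2
  have hcl : ∀ i ∈ ({c}ᶜ : Set (Fin 4)), ∀ v ∈ {u | ∃ h, (⟨u, h⟩ : Residue σ c v₀) ∈ A},
      σ i v ∈ {u | ∃ h, (⟨u, h⟩ : Residue σ c v₀) ∈ A} := by
    rintro i hi v ⟨hv, hvA⟩
    obtain ⟨j, rfl⟩ := Fin.exists_succAbove_eq (show i ≠ c from hi)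
    exact ⟨_, hA j _ hvA⟩
  obtain ⟨h, hw⟩ := h1.mem hcl ⟨a.2, ha⟩
  exact hw

lemma isAcyclic_residueGraph (hσ : IsColouring σ) {c : Fin 4} (h : IsAcyclic (link σ c)) (v₀ : V) :
    IsAcyclic (residueGraph σ c v₀) := by
  classical
  intro g hg
  let g' : Fin 3 → V → ZMod 2 := fun i v => if hv : Joined σ {c}ᶜ v₀ v then g i ⟨v, hv⟩ else 0
  have hin : ∀ i (w : Residue σ c v₀), g' i w = g i w := fun i w => dif_pos w.2
  obtain ⟨f, hf⟩ := h g' fun i j k hij hik hjk v => by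
    by_cases hv : Joined σ {c}ᶜ v₀ v
    · exact (hin i (residueGraph σ c v₀ k ⟨v, hv⟩)).symm ▸
        (hin j (residueGraph σ c v₀ k ⟨v, hv⟩)).symm ▸ (hin i ⟨v, hv⟩).symm ▸
        (hin j ⟨v, hv⟩).symm ▸ hg i j k hij hik hjk ⟨v, hv⟩
    · have hv' : ∀ k, ¬ Joined σ {c}ᶜ v₀ (link σ c k v) := fun k h =>
        hv (h.trans ((Joined.edge σ (Fin.succAbove_ne c k) v).symm hσ))
      simp only [g', dif_neg hv, dif_neg (hv' k)]
  refine ⟨fun w => f w, fun i k hik w => ?_⟩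
  have := hf i k hik w
  rw [hin k w] at this
  rw [← hin k (residueGraph σ c v₀ i w)]
  exact this

lemma joined_residueGraph_iff {c : Fin 4} {v₀ : V} {J : Set (Fin 3)} {w w' : Residue σ c v₀} :
    Joined (residueGraph σ c v₀) J w w' ↔ Joined σ (c.succAbove '' J) w.1 w'.1 := by
  constructor
  · intro h
    induction h with
    | refl => exact Joined.refl _ _ _
    | tail _ h ih =>
      obtain ⟨i, hi, rfl⟩ := h
      exact ih.trans (Joined.edge σ (Set.mem_image_of_mem c.succAbove hi) _)
  · intro h
    have hcl : ∀ i ∈ c.succAbove '' J, ∀ v ∈ {u | ∃ h, Joined (residueGraph σ c v₀) J w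
        (⟨u, h⟩ : Residue σ c v₀)}, σ i v ∈ {u | ∃ h, Joined (residueGraph σ c v₀) J w
        (⟨u, h⟩ : Residue σ c v₀)} := by
      rintro _ ⟨j, hj, rfl⟩ v ⟨hv, hvA⟩
      exact ⟨_, hvA.trans (Joined.edge (residueGraph σ c v₀) hj _)⟩
    have h0 : ∃ h, Joined (residueGraph σ c v₀) J w (⟨w.1, h⟩ : Residue σ c v₀) :=
      ⟨w.2, Joined.refl _ _ _⟩
    obtain ⟨h', hw⟩ := h.mem hcl h0
    exact hw

end Residue

end Gem

namespace Gem

section Chart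

/-! ### Complexes with acyclic vertex links are manifolds -/

variable {V E : Type*} [NormedAddCommGroup E] [NormedSpace ℝ E] {σ : Fin 4 → V → V}
  {f : V → (Fin 4 → ℝ) → E} {M : Set E}

lemma isPLOn_coord_simplex {X : Set (Fin 4 → ℝ)} (hX : IsCompactPolyhedron X) (i : Fin 4) :
    IsPLOn (fun x : Fin 4 → ℝ => x i) X :=
  hX.isPLOn (AffineMap.proj i : (Fin 4 → ℝ) →ᵃ[ℝ] ℝ)

/-- The map from the star of a vertex coloured `c` to the cone over its link. -/
noncomputable def starMap (c : Fin 4) (φ : (Fin 3 → ℝ) → (Fin 3 → ℝ)) (x : Fin 4 → ℝ) : Fin 3 → ℝ :=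
  coneMap φ fun i => x (c.succAbove i)

lemma sum_succAbove {x : Fin 4 → ℝ} (hx : x ∈ Simplex) (c : Fin 4) :
    ∑ i, x (c.succAbove i) = 1 - x c := by
  have := hx.2
  rw [Fin.sum_univ_succAbove _ c] at this
  linarith

lemma succAbove_mem_corner {x : Fin 4 → ℝ} (hx : x ∈ Simplex) (c : Fin 4) :
    (fun i => x (c.succAbove i)) ∈ Corner :=
  ⟨fun _ => hx.1 _, by rw [sum_succAbove hx]; linarith [hx.1 c]⟩

lemma isPLOn_starMap (c : Fin 4) {φ : (Fin 3 → ℝ) → (Fin 3 → ℝ)} (hφ : IsPLOn φ Triangle) :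
    IsPLOn (starMap c φ) Simplex :=
  (isPLOn_coneMap hφ).comp (IsPLOn.pi (isCompactPolyhedron_stdSimplex _) fun i =>
    isPLOn_coord_simplex (isCompactPolyhedron_stdSimplex _) (c.succAbove i))
    fun _ hx => succAbove_mem_corner hx c

/-- The gauge of the image recovers `1 - x c`, and the direction recovers the point of the link. At
the apex, `t = 0`, all simplices of the residue agree. Positivity of `x c` excludes gluing across
colour `c`, which the link does not see. -/
lemma starMap_eq_iff {c : Fin 4} {v₀ : V} {φ : Residue σ c v₀ → (Fin 3 → ℝ) → (Fin 3 → ℝ)}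
    (hσ : IsColouring σ)
    (h2 : ∀ v, ∀ x ∈ Triangle, ∀ w, ∀ y ∈ Triangle,
      φ v x = φ w y ↔ SamePoint (residueGraph σ c v₀) (v, x) (w, y))
    (h3 : ∀ y, bipyramidGauge y = 1 ↔ ∃ v, ∃ x ∈ Triangle, φ v x = y)
    (w w' : Residue σ c v₀) {x y : Fin 4 → ℝ} (hx : x ∈ Simplex) (hxc : 0 < x c)
    (hy : y ∈ Simplex) : starMap c (φ w) x = starMap c (φ w') y ↔ SamePoint σ (w.1, x) (w'.1, y) := by
  have hu := succAbove_mem_corner hx c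
  have hu' := succAbove_mem_corner hy c
  constructor
  · intro h
    have hg := bipyramidGauge_coneMap h3 w hu
    have hg' := bipyramidGauge_coneMap h3 w' hu'
    rw [starMap, starMap] at h
    rw [h, hg', sum_succAbove hx, sum_succAbove hy] at hg
    obtain ⟨t, ht, z, hz, hxz, ht'⟩ := exists_corner_eq hu
    obtain ⟨s, hs, z', hz', hyz, hs'⟩ := exists_corner_eq hu'
    rw [sum_succAbove hx] at ht'
    rw [sum_succAbove hy] at hs'
    obtain rfl : t = s := by linarith
    rw [hxz, hyz, coneMap_smul _ _ hz, coneMap_smul _ _ hz'] at h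
    have hxy : ∀ i, t * z i = t * z' i → x (c.succAbove i) = y (c.succAbove i) := fun i hi => by
      have e1 := congrFun hxz i
      have e2 := congrFun hyz i
      simp only [Pi.smul_apply, smul_eq_mul] at e1 e2
      rw [e1, e2, hi]
    have hxy' : (∀ i, t * z i = t * z' i) → x = y := fun hi => by
      funext m
      rcases c.eq_self_or_eq_succAbove m with rfl | ⟨i, rfl⟩
      · linarith
      · exact hxy i (hi i)
    by_cases ht0 : t = 0
    · refine ⟨hxy' (by simp [ht0]), ((w.2.symm hσ).trans w'.2).mono fun m hm => ?_⟩
      obtain ⟨i, rfl⟩ := Fin.exists_succAbove_eq (show m ≠ c from hm)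
      have := congrFun hxz i
      simpa [ht0] using this
    · obtain ⟨e, hj⟩ := (h2 _ _ hz _ _ hz').1 (smul_right_injective _ ht0 h)
      dsimp only at e hj
      refine ⟨hxy' (by simp [e]), (joined_residueGraph_iff.1 hj).mono ?_⟩
      rintro _ ⟨i, hi, rfl⟩
      have h1 := congrFun hxz i
      have h2 : z i = 0 := hi
      simpa [h2] using h1
  · rintro ⟨e, hj⟩
    dsimp only at e hj
    subst e
    obtain ⟨t, ht, z, hz, hxz, ht'⟩ := exists_corner_eq hu
    rw [starMap, starMap, hxz, coneMap_smul _ _ hz, coneMap_smul _ _ hz]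
    by_cases ht0 : t = 0
    · simp [ht0]
    · rw [(h2 w _ hz w' _ hz).2 ⟨rfl, joined_residueGraph_iff.2 (hj.mono fun m hm => ?_)⟩]
      rcases c.eq_self_or_eq_succAbove m with rfl | ⟨i, rfl⟩
      · exact absurd hm hxc.ne'
      · refine ⟨i, ?_, rfl⟩
        have h1 := congrFun hxz i
        have h2 : x (c.succAbove i) = 0 := hm
        simp only [h2, Pi.smul_apply, smul_eq_mul] at h1
        exact (mul_eq_zero.1 h1.symm).resolve_left ht0

lemma isCompactPolyhedron_simplex_inter (c : Fin 4) (a : ℝ) :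
    IsCompactPolyhedron (Simplex ∩ {x | a ≤ x c}) := by
  have h := (stdSimplex_isPolytope (Fin 4)).inter_halfspace
    ((AffineMap.proj c : (Fin 4 → ℝ) →ᵃ[ℝ] ℝ) - AffineMap.const ℝ _ a)
  have := (isPLOn_affine h (AffineMap.id ℝ _)).isCompactPolyhedron
  convert this using 2
  ext x
  simp

/-- Every point has a positive coordinate `c`, so it lies in the open star of a vertex coloured `c`.
This star is a cone over a sphere in `ℝ³`, which provides the chart. -/
lemma IsGemMap.isClosedPLManifold [FiniteDimensional ℝ E] [Fintype V] (hσ : IsColouring σ)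
    (hf : IsGemMap σ f M) (hq : ∀ c, IsAcyclic (link σ c)) : IsClosedPLManifold 3 M := by
  classical
  refine ⟨?_, fun z₀ hz₀ => ?_⟩
  · have h : M = ⋃ v, f v '' Simplex := by
      ext y
      rw [hf.range]
      simp
    rw [h]
    exact (IsPLOn.iUnion (f := (id : E → E)) fun v =>
      (hf.isPLOn v).isCompactPolyhedron_image.isPLOn (AffineMap.id ℝ E)).isCompactPolyhedron
  obtain ⟨v₀, x₀, hx₀, hz⟩ := (hf.range z₀).1 hz₀
  obtain ⟨c, hc⟩ : ∃ c, 0 < x₀ c := by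
    by_contra! h
    have := Finset.sum_nonpos fun i (_ : i ∈ Finset.univ) => h i
    rw [hx₀.2] at this
    linarith
  have : Nonempty (Residue σ c v₀) := ⟨⟨v₀, Joined.refl _ _ _⟩⟩
  obtain ⟨φ, h1, h2, h3⟩ := isSphere_of_isAcyclic (isColouring_residueGraph hσ c v₀)
    (isConn_residueGraph hσ c v₀) (isAcyclic_residueGraph hσ (hq c) v₀)
  -- Halving keeps the point off the frontier of the compact neighbourhood `x c ≥ a`, whose image
  -- contains all points of gauge less than `1 - a`.
  set a := x₀ c / 2 with ha
  set P : Set (Fin 4 → ℝ) := Simplex ∩ {x | a ≤ x c} with hP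
  have hPpoly : IsCompactPolyhedron P := isCompactPolyhedron_simplex_inter c a
  have hPc : ∀ x ∈ P, 0 < x c := fun x hx => by
    have : a ≤ x c := hx.2
    linarith
  have hkey : ∀ w, ∀ x ∈ P, ∀ w', ∀ y ∈ P,
      starMap c (φ w) x = starMap c (φ w') y ↔ f w x = f w' y := fun w x hx w' y hy => by
    rw [starMap_eq_iff hσ h2 h3 w w' hx.1 (hPc x hx) hy.1, hf.eq_iff _ _ hx.1 _ _ hy.1]
  set N : Set E := ⋃ w : Residue σ c v₀, f w '' P with hN
  have hex : ∀ z : E, ∃ q : Residue σ c v₀ × (Fin 4 → ℝ), z ∈ N → q.2 ∈ P ∧ f q.1 q.2 = z := by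
    intro z
    by_cases hz : z ∈ N
    · obtain ⟨w, x, hx, hw⟩ := Set.mem_iUnion.1 hz
      exact ⟨(w, x), fun _ => ⟨hx, hw⟩⟩
    · exact ⟨(Classical.arbitrary _, 0), fun h => absurd h hz⟩
  choose q hq' using hex
  set χ : E → EuclideanSpace ℝ (Fin 3) := fun z =>
    (EuclideanSpace.equiv (Fin 3) ℝ).symm (starMap c (φ (q z).1) (q z).2) with hχ
  have hmem : ∀ (w : Residue σ c v₀), ∀ x ∈ P, f w x ∈ N := fun w x hx =>
    Set.mem_iUnion.2 ⟨w, x, hx, rfl⟩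
  have hχf : ∀ w : Residue σ c v₀, ∀ x ∈ P, χ (f w x) =
      (EuclideanSpace.equiv (Fin 3) ℝ).symm (starMap c (φ w) x) := fun w x hx => by
    have := hq' _ (hmem w x hx)
    rw [hχ]
    dsimp only
    rw [(hkey _ _ this.1 w x hx).2 this.2]
  have hx₀P : x₀ ∈ P := ⟨hx₀, by change a ≤ x₀ c; linarith⟩
  refine ⟨N, ?_, ?_, χ, ?_, ?_, ?_⟩
  · refine Set.iUnion_subset fun w => ?_
    rintro _ ⟨x, hx, rfl⟩
    exact (hf.range _).2 ⟨w, x, hx.1, rfl⟩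
  · have hK : IsClosed ((⋃ w ∈ {w | ¬ Joined σ {c}ᶜ v₀ w}, f w '' (Simplex ∩ Set.univ)) ∪
        ⋃ w ∈ (Set.univ : Set V), f w '' (Simplex ∩ {x | x c ≤ a})) :=
      (hf.isCompact_image _ isClosed_univ).isClosed.union
        (hf.isCompact_image _ (isClosed_le (continuous_apply c) continuous_const)).isClosed
    refine mem_nhdsWithin.2 ⟨_, hK.isOpen_compl, ?_, ?_⟩
    · rintro (h | h)
      · simp only [Set.mem_iUnion, Set.mem_image] at h
        obtain ⟨w, hw, x, hx, hwx⟩ := h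
        obtain ⟨e1, e2⟩ := (hf.eq_iff _ _ hx₀ _ _ hx.1).1 (hz.trans hwx.symm)
        refine hw (e2.mono fun i hi => ?_)
        rintro rfl
        exact hc.ne' hi
      · simp only [Set.mem_iUnion, Set.mem_image] at h
        obtain ⟨w, hw, x, hx, hwx⟩ := h
        obtain ⟨e1, e2⟩ := (hf.eq_iff _ _ hx₀ _ _ hx.1).1 (hz.trans hwx.symm)
        have h4 : x c ≤ a := hx.2
        dsimp only at e1
        rw [← e1] at h4
        linarith
    · rintro y ⟨hyK, hyM⟩
      obtain ⟨w, x, hx, rfl⟩ := (hf.range y).1 hyM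
      have hw : Joined σ {c}ᶜ v₀ w := by
        by_contra hw
        exact hyK (Or.inl (Set.mem_biUnion (x := w) hw ⟨x, ⟨hx, trivial⟩, rfl⟩))
      have hxa : a ≤ x c := by
        by_contra! hxa
        exact hyK (Or.inr (Set.mem_biUnion (x := w) trivial ⟨x, ⟨hx, hxa.le⟩, rfl⟩))
      exact hmem ⟨w, hw⟩ x ⟨hx, hxa⟩
  · refine IsPLOn.iUnion fun w => ?_
    refine IsPLOn.of_comp ((hf.isPLOn w).mono hPpoly Set.inter_subset_left) ?_
      (((isPLOn_starMap c (h1 w)).mono hPpoly Set.inter_subset_left).affine_comp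
        (EuclideanSpace.equiv (Fin 3) ℝ).symm.toLinearMap.toAffineMap) (hχf w)
    intro x hx y hy hxy
    exact ((hf.eq_iff _ _ hx.1 _ _ hy.1).1 hxy).1
  · intro y hy z hz h
    obtain ⟨w, x, hx, rfl⟩ := Set.mem_iUnion.1 hy
    obtain ⟨w', x', hx', rfl⟩ := Set.mem_iUnion.1 hz
    rw [hχf w x hx, hχf w' x' hx'] at h
    exact (hkey _ _ hx _ _ hx').1 ((EuclideanSpace.equiv (Fin 3) ℝ).symm.injective h)
  · have hopen : IsOpen {y : EuclideanSpace ℝ (Fin 3) |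
        bipyramidGauge (EuclideanSpace.equiv (Fin 3) ℝ y) < 1 - a} :=
      isOpen_lt (continuous_bipyramidGauge.comp (EuclideanSpace.equiv (Fin 3) ℝ).continuous)
        continuous_const
    refine Filter.mem_of_superset (hopen.mem_nhds ?_) ?_
    · rw [Set.mem_ofPred_eq, ← hz, hχf ⟨v₀, Joined.refl _ _ _⟩ x₀ hx₀P,
        ContinuousLinearEquiv.apply_symm_apply, starMap,
        bipyramidGauge_coneMap h3 _ (succAbove_mem_corner hx₀ c), sum_succAbove hx₀]
      linarith
    · intro y hy
      obtain ⟨y, rfl⟩ := (EuclideanSpace.equiv (Fin 3) ℝ).symm.surjective y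
      rw [Set.mem_ofPred_eq, ContinuousLinearEquiv.apply_symm_apply] at hy
      have h0 := bipyramidGauge_nonneg y
      have hc1 : x₀ c ≤ 1 := by
        have := sum_succAbove hx₀ c
        have h5 : 0 ≤ ∑ i, x₀ (c.succAbove i) := Finset.sum_nonneg fun i _ => hx₀.1 _
        linarith
      obtain ⟨w, x, hx, hwx⟩ : ∃ w, ∃ x ∈ Triangle, y = bipyramidGauge y • φ w x := by
        by_cases hg : bipyramidGauge y = 0
        · refine ⟨Classical.arbitrary _, Pi.single 0 1, single_mem_stdSimplex ℝ 0, ?_⟩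
          rw [hg, zero_smul, eq_zero_of_bipyramidGauge hg]
        · obtain ⟨w, x, hx, hwx⟩ := (h3 ((bipyramidGauge y)⁻¹ • y)).1 (by
            rw [bipyramidGauge_smul (inv_nonneg.2 h0), inv_mul_cancel₀ hg])
          exact ⟨w, x, hx, by rw [hwx, smul_inv_smul₀ hg]⟩
      have hs : ∑ i, bipyramidGauge y * x i = bipyramidGauge y := by
        rw [← Finset.mul_sum, hx.2, mul_one]
      have hpS : simplexPoint c (bipyramidGauge y • x) ∈ P := by
        refine ⟨simplexPoint_mem c (fun i => mul_nonneg h0 (hx.1 i)) ?_, ?_⟩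
        · simp only [Pi.smul_apply, smul_eq_mul, hs]
          linarith
        · rw [Set.mem_ofPred_eq, simplexPoint_same]
          simp only [Pi.smul_apply, smul_eq_mul, hs]
          linarith
      refine ⟨_, hmem w _ hpS, ?_⟩
      rw [hχf w _ hpS, starMap]
      simp only [simplexPoint_succAbove]
      congr 1
      rw [show (fun i => (bipyramidGauge y • x) i) = bipyramidGauge y • x from rfl,
        coneMap_smul _ _ hx, ← hwx]

end Chart

section Embedding

/-! ### Embedding a complex in Euclidean space -/

variable {V : Type*} {σ : Fin 4 → V → V}

open Classical in
/-- A family of functions on the simplices that separate the points of the complex of `σ`. -/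
noncomputable def sepCoord (σ : Fin 4 → V → V) :
    (Set (Fin 4) × V) ⊕ Fin 4 → V → (Fin 4 → ℝ) → ℝ :=
  Sum.elim (fun p v x => if Joined σ p.1 p.2 v then
    let g := fun c : Fin 4 => if c ∈ p.1 then 1 else x c
    min (g 0) (min (g 1) (min (g 2) (g 3))) else 0) fun c _ x => x c

lemma isPLOn_sepCoord (p : (Set (Fin 4) × V) ⊕ Fin 4) (v : V) :
    IsPLOn (sepCoord σ p v) Simplex := by
  classical
  have hS := isCompactPolyhedron_stdSimplex (Fin 4)
  rcases p with p | c
  · by_cases hj : Joined σ p.1 p.2 v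
    · have hg : ∀ c : Fin 4, IsPLOn (fun x : Fin 4 → ℝ => if c ∈ p.1 then 1 else x c) Simplex := by
        intro c
        by_cases hc : c ∈ p.1
        · simpa only [if_pos hc] using hS.isPLOn_const (1 : ℝ)
        · simpa only [if_neg hc] using isPLOn_coord_simplex hS c
      refine ((hg 0).min ((hg 1).min ((hg 2).min (hg 3)))).congr fun x _ => ?_
      simp [sepCoord, hj]
    · refine (hS.isPLOn_const (0 : ℝ)).congr fun x _ => ?_
      simp [sepCoord, hj]
  · exact isPLOn_coord_simplex hS c

/-- The minimum effectively runs over the coordinates outside `J`, so it vanishes wherever a gluing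
across a colour outside `J` could take place. -/
lemma sepCoord_pos_iff (J : Set (Fin 4)) (u v : V) {x : Fin 4 → ℝ} (hx : x ∈ Simplex) :
    0 < sepCoord σ (Sum.inl (J, u)) v x ↔ Joined σ J u v ∧ {i | x i = 0} ⊆ J := by
  classical
  have h : ∀ c, (0 < if c ∈ J then (1 : ℝ) else x c) ↔ (x c = 0 → c ∈ J) := fun c => by
    by_cases hc : c ∈ J
    · simp [hc]
    · simpa [hc] using (hx.1 c).lt_iff_ne'
  by_cases hj : Joined σ J u v
  · simp only [sepCoord, Sum.elim_inl, hj, if_true, lt_min_iff, h, true_and, Set.subset_def,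
      Set.mem_ofPred_eq]
    constructor
    · rintro ⟨h0, h1, h2, h3⟩ i
      fin_cases i <;> assumption
    · exact fun h => ⟨h 0, h 1, h 2, h 3⟩
  · simp [sepCoord, hj]

lemma sepCoord_eq_iff (hσ : IsColouring σ) {v w : V} {x y : Fin 4 → ℝ} (hx : x ∈ Simplex)
    (hy : y ∈ Simplex) :
    (∀ p, sepCoord σ p v x = sepCoord σ p w y) ↔ SamePoint σ (v, x) (w, y) := by
  classical
  constructor
  · intro h
    obtain rfl : x = y := funext fun c => h (Sum.inr c)
    refine ⟨rfl, ?_⟩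
    -- The index consisting of the zero set of `x` and of `v` itself detects whether `w` represents
    -- the same point.
    have h1 := (sepCoord_pos_iff (σ := σ) {i | x i = 0} v v hx).2 ⟨Joined.refl _ _ _, subset_rfl⟩
    rw [h] at h1
    exact ((sepCoord_pos_iff _ _ _ hx).1 h1).1
  · rintro ⟨e, hj⟩
    dsimp only at e hj
    subst e
    rintro (⟨J, u⟩ | c)
    · by_cases hJ : {i | x i = 0} ⊆ J
      · have : Joined σ J u v ↔ Joined σ J u w :=
          ⟨fun h => h.trans (hj.mono hJ), fun h => h.trans ((hj.mono hJ).symm hσ)⟩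
        simp only [sepCoord, Sum.elim_inl, this]
      · have hn : ∀ v, sepCoord σ (Sum.inl (J, u)) v x = 0 := fun v => by
          have h1 := mt (sepCoord_pos_iff (σ := σ) J u v hx).1 fun h => hJ h.2
          refine le_antisymm (not_lt.1 h1) ?_
          simp only [sepCoord, Sum.elim_inl]
          have h0 : ∀ c, 0 ≤ if c ∈ J then (1 : ℝ) else x c := fun c => by
            split_ifs
            · exact zero_le_one
            · exact hx.1 c
          by_cases hu : Joined σ J u v
          · rw [if_pos hu]
            exact le_min (h0 0) (le_min (h0 1) (le_min (h0 2) (h0 3)))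
          · rw [if_neg hu]
        rw [hn, hn]
    · rfl

/-- The complex of a finite 4-coloured graph embeds in a Euclidean space. -/
lemma exists_isGemMap [Fintype V] (hσ : IsColouring σ) :
    ∃ (N : ℕ) (f : V → (Fin 4 → ℝ) → EuclideanSpace ℝ (Fin N)) (M : Set (EuclideanSpace ℝ (Fin N))),
      IsGemMap σ f M := by
  classical
  let e := Fintype.equivFin ((Set (Fin 4) × V) ⊕ Fin 4)
  refine ⟨_, fun v x => (EuclideanSpace.equiv _ ℝ).symm fun n => sepCoord σ (e.symm n) v x,
    {y | ∃ v, ∃ x ∈ Simplex, _ = y}, fun v => ?_, fun v x hx w y hy => ?_, fun y => Iff.rfl⟩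
  · exact (IsPLOn.pi (isCompactPolyhedron_stdSimplex _) fun n =>
      isPLOn_sepCoord (e.symm n) v).affine_comp
      (EuclideanSpace.equiv _ ℝ).symm.toLinearMap.toAffineMap
  · rw [← sepCoord_eq_iff hσ hx hy]
    rw [(EuclideanSpace.equiv _ ℝ).symm.injective.eq_iff, funext_iff]
    exact e.symm.surjective.forall (p := fun p => sepCoord σ p v x = sepCoord σ p w y) |>.symm

lemma IsGemMap.isConnected {E : Type*} [NormedAddCommGroup E] [NormedSpace ℝ E]
    {f : V → (Fin 4 → ℝ) → E} {M : Set E} (hf : IsGemMap σ f M) (v₀ : V)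
    (hc : ∀ v w, Joined σ Set.univ v w) : IsConnected M := by
  have h : M = ⋃ v, f v '' Simplex := by
    ext y
    rw [hf.range]
    simp
  have : Nonempty V := ⟨v₀⟩
  rw [h]
  refine IsConnected.iUnion_of_reflTransGen (fun v => ?_) fun v w => ?_
  · refine IsConnected.image ⟨⟨_, single_mem_stdSimplex ℝ 0⟩,
      (convex_stdSimplex ℝ (Fin 4)).isPreconnected⟩ _ (hf.isPLOn v).continuousOn
  · refine Relation.ReflTransGen.mono ?_ _ _ (hc v w)
    rintro v _ ⟨i, -, rfl⟩
    have hx : (Pi.single (i + 1) 1 : Fin 4 → ℝ) ∈ Simplex := single_mem_stdSimplex ℝ _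
    refine ⟨f v (Pi.single (i + 1) 1), ⟨_, hx, rfl⟩, _, hx,
      ((hf.eq_iff _ _ hx _ _ hx).2 (SamePoint.edge σ v (i := i) ?_)).symm⟩
    rw [Pi.single_eq_of_ne]
    fin_cases i <;> decide

end Embedding

end Gem

namespace Gem

section Cut

/-! ### Cutting a 4-coloured graph along four edges -/

variable {V V₁ : Type*}

lemma even_card_of_involution {τ : V → V} (hτ : ∀ v, τ (τ v) = v) (hne : ∀ v, τ v ≠ v)
    {B : Finset V} (hB : ∀ v ∈ B, τ v ∈ B) : Even B.card := by
  have h : ∑ v ∈ B, (1 : ZMod 2) = 0 :=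
    Finset.sum_involution (fun v _ => τ v) (fun v _ => zmod_two_add_self 1)
      (fun v _ _ => hne v) (fun v hv => hB v hv) fun v _ => hτ v
  rw [Finset.sum_const, nsmul_eq_mul, mul_one] at h
  exact (ZMod.natCast_eq_zero_iff_even).1 h

lemma odd_card_of_involution {τ : V → V} (hτ : ∀ v, τ (τ v) = v) (hne : ∀ v, τ v ≠ v)
    {B : Finset V} {a : V} (ha : a ∈ B) (haB : τ a ∉ B) (hB : ∀ v ∈ B, v ≠ a → τ v ∈ B) :
    Odd B.card := by
  classical
  have h : Even (B.erase a).card := even_card_of_involution hτ hne fun v hv => by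
    rw [Finset.mem_erase] at hv ⊢
    refine ⟨fun h => haB ?_, hB v hv.2 hv.1⟩
    rw [← h, hτ]
    exact hv.2
  rw [← Finset.card_erase_add_one ha]
  exact h.add_one

/-- The set `A` is cut off by one edge of each colour: the edge of colour `c` joins `u c ∈ A` with
the complement of `A`. -/
structure IsCut (σ : Fin 4 → V → V) (A : Set V) (u : Fin 4 → V) : Prop where
  mem : ∀ c, u c ∈ A
  apply_mem_iff : ∀ c, ∀ v ∈ A, σ c v ∈ A ↔ v ≠ u c

/-- At most one edge of each colour leaves `A`. Some edge does by connectedness, so `A` has odd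
size; a colour without a leaving edge would pair off all of `A`. -/
lemma exists_isCut [Finite V] {σ : Fin 4 → V → V} (hσ : IsColouring σ) {A : Set V}
    (hc : ∀ B : Set V, (∀ i, ∀ v ∈ B, σ i v ∈ B) → B.Nonempty → B = Set.univ) (hA : A.Nonempty)
    (hA' : A ≠ Set.univ) {a : Fin 4 → V}
    (ha : ∀ c, ∀ v ∈ A, σ c v ∉ A → v = a c ∨ v = σ c (a c)) : ∃ u, IsCut σ A u := by
  classical
  have := Fintype.ofFinite V
  have huniq : ∀ c, ∀ v ∈ A, σ c v ∉ A → ∀ w ∈ A, w ≠ v → σ c w ∈ A := by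
    intro c v hv hv' w hw hwv
    by_contra hw'
    rcases ha c v hv hv' with h | h <;> rcases ha c w hw hw' with h' | h'
    · exact hwv (h'.trans h.symm)
    · rw [← h] at h'
      exact hv' (h' ▸ hw)
    · rw [← h'] at h
      exact hw' (h ▸ hv)
    · exact hwv (h'.trans h.symm)
  have hodd : ∀ c, (∃ v ∈ A, σ c v ∉ A) → Odd A.toFinset.card := by
    rintro c ⟨v, hv, hv'⟩
    refine odd_card_of_involution (hσ.invol c) (hσ.ne c) (a := v) (by simpa using hv)
      (by simpa using hv') fun w hw hwv => ?_
    simpa using huniq c v hv hv' w (by simpa using hw) hwv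
  have hex : ∀ c, ∃ v ∈ A, σ c v ∉ A := by
    obtain ⟨c, hc⟩ : ∃ c, ∃ v ∈ A, σ c v ∉ A := by
      by_contra! h
      exact hA' (hc A h hA)
    intro d
    by_contra! h
    have h1 : Even A.toFinset.card := even_card_of_involution (hσ.invol d) (hσ.ne d) fun v hv => by
      simpa using h v (by simpa using hv)
    exact Nat.not_even_iff_odd.2 (hodd c hc) h1
  choose u hu hu' using hex
  refine ⟨u, hu, fun c v hv => ⟨?_, fun h => huniq c (u c) (hu c) (hu' c) v hv h⟩⟩
  rintro h rfl
  exact hu' c h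

variable {σ : Fin 4 → V → V} {A : Set V} {u : Fin 4 → V}

lemma IsCut.apply_notMem (h : IsCut σ A u) (c : Fin 4) : σ c (u c) ∉ A := fun h' =>
  (h.apply_mem_iff c _ (h.mem c)).1 h' rfl

lemma IsCut.eq_of_notMem (h : IsCut σ A u) {c : Fin 4} {v : V} (hv : v ∈ A) (hv' : σ c v ∉ A) :
    v = u c := by
  by_contra hne
  exact hv' ((h.apply_mem_iff c v hv).2 hne)

lemma IsCut.compl (hσ : IsColouring σ) (h : IsCut σ A u) : IsCut σ Aᶜ fun c => σ c (u c) := by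
  refine ⟨h.apply_notMem, fun c v hv => ⟨?_, fun hne hv' => hne ?_⟩⟩
  · rintro hv' rfl
    rw [hσ.invol] at hv'
    exact hv' (h.mem c)
  · have := h.eq_of_notMem hv' (by rwa [hσ.invol])
    rw [← this, hσ.invol]

/-- Each set that contains the end of the cutting edge of colour `i` outside `A` and is closed
under the colours `i` and `j` outside `A` contains also the end of the cutting edge of
colour `j`. -/
lemma IsCut.mem_of_closed [Finite V] (hσ : IsColouring σ) (h : IsCut σ A u) {i j : Fin 4}
    {B : Set V} (hBA : ∀ v ∈ B, v ∉ A) (hi : σ i (u i) ∈ B)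
    (hBi : ∀ v ∈ B, σ i v ∉ A → σ i v ∈ B) (hBj : ∀ v ∈ B, σ j v ∉ A → σ j v ∈ B) :
    σ j (u j) ∈ B := by
  classical
  have := Fintype.ofFinite V
  -- Otherwise colour `j` pairs off all of `B`, whereas colour `i` pairs off all but one of its
  -- vertices.
  by_contra hj
  have hjB : ∀ v ∈ B, σ j v ∈ B := fun v hv => hBj v hv fun hA => hj (by
    rwa [← h.eq_of_notMem hA (by rw [hσ.invol]; exact hBA v hv), hσ.invol])
  have h1 : Even B.toFinset.card := even_card_of_involution (hσ.invol j) (hσ.ne j) fun v hv => by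
    simpa using hjB v (by simpa using hv)
  refine Nat.not_even_iff_odd.2 (odd_card_of_involution (hσ.invol i) (hσ.ne i)
    (a := σ i (u i)) (by simpa using hi) ?_ fun v hv hne => ?_) h1
  · rw [hσ.invol, Set.mem_toFinset]
    exact fun hB => hBA _ hB (h.mem i)
  · rw [Set.mem_toFinset] at hv ⊢
    refine hBi v hv fun hA => hne ?_
    rw [← h.eq_of_notMem hA (by rw [hσ.invol]; exact hBA v hv), hσ.invol]

/-- The connecting path leaves `A` by the cut edge of colour `i`, runs through the complement, and
returns by that of colour `j`. -/
lemma IsCut.joined [Finite V] (hσ : IsColouring σ) (h : IsCut σ A u) {J : Set (Fin 4)}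
    {i j : Fin 4} (hi : i ∈ J) (hj : j ∈ J) : Joined σ J (u i) (u j) := by
  have h1 : σ j (u j) ∈ {v | v ∉ A ∧ Joined σ J (u i) v} :=
    h.mem_of_closed (i := i) hσ (fun v hv => hv.1) ⟨h.apply_notMem i, Joined.edge σ hi _⟩
      (fun v hv hv' => ⟨hv', hv.2.trans (Joined.edge σ hi _)⟩)
      fun v hv hv' => ⟨hv', hv.2.trans (Joined.edge σ hj _)⟩
  exact h1.2.trans ((Joined.edge σ hj _).symm hσ)

/-- The 4-coloured graph `σ₁` is obtained from `σ` by contracting the complement of `A` to the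
vertex `o`; the map `π` is the contraction. -/
structure IsCap (σ : Fin 4 → V → V) (A : Set V) (σ₁ : Fin 4 → V₁ → V₁) (o : V₁) (π : V → V₁) :
    Prop where
  eq_iff : ∀ v, π v = o ↔ v ∉ A
  inj : Set.InjOn π A
  surj : Function.Surjective π
  map : ∀ c, ∀ v ∈ A, π (σ c v) = σ₁ c (π v)

variable {σ₁ : Fin 4 → V₁ → V₁} {o : V₁} {π : V → V₁}

lemma IsCap.map_or (hσ : IsColouring σ) (hσ₁ : IsColouring σ₁) (h : IsCap σ A σ₁ o π) (c : Fin 4)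
    (v : V) : π (σ c v) = σ₁ c (π v) ∨ π (σ c v) = π v := by
  by_cases hv : v ∈ A
  · exact Or.inl (h.map c v hv)
  · by_cases hv' : σ c v ∈ A
    · left
      rw [hσ₁.eq_apply (h.map c _ hv').symm, hσ.invol]
    · right
      rw [(h.eq_iff _).2 hv, (h.eq_iff _).2 hv']

lemma IsCap.joined_map (hσ : IsColouring σ) (hσ₁ : IsColouring σ₁) (h : IsCap σ A σ₁ o π)
    {J : Set (Fin 4)} {v w : V} (hj : Joined σ J v w) : Joined σ₁ J (π v) (π w) := by
  refine hj.mem (S := {w | Joined σ₁ J (π v) (π w)}) (fun i hi w hw => ?_) (Joined.refl _ _ _)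
  rcases h.map_or hσ hσ₁ i w with e | e
  · rw [Set.mem_ofPred_eq, e]
    exact Joined.trans hw (Joined.edge σ₁ hi _)
  · rwa [Set.mem_ofPred_eq, e]

lemma IsCap.map_o (hσ₁ : IsColouring σ₁) (hu : IsCut σ A u) (h : IsCap σ A σ₁ o π) (c : Fin 4) :
    σ₁ c o = π (u c) := by
  rw [← (h.eq_iff _).2 (hu.apply_notMem c), h.map c _ (hu.mem c), hσ₁.invol]

/-- A passage through `o` enters by one colour of `J` and leaves by another; `IsCut.joined` replaces
it by a path in the original graph. -/
lemma IsCap.joined_iff [Finite V] (hσ : IsColouring σ) (hσ₁ : IsColouring σ₁) (hu : IsCut σ A u)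
    (h : IsCap σ A σ₁ o π) {J : Set (Fin 4)} {v w : V} (hv : v ∈ A) (hw : w ∈ A) :
    Joined σ₁ J (π v) (π w) ↔ Joined σ J v w := by
  refine ⟨fun hj => ?_, h.joined_map hσ hσ₁⟩
  have hcl : ∀ j ∈ J, ∀ z ∈ {z | (∃ w ∈ A, π w = z ∧ Joined σ J v w) ∨
      z = o ∧ ∃ i ∈ J, Joined σ J v (u i)}, σ₁ j z ∈ {z | (∃ w ∈ A, π w = z ∧ Joined σ J v w) ∨
      z = o ∧ ∃ i ∈ J, Joined σ J v (u i)} := by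
    rintro j hj z (⟨w, hw, rfl, hvw⟩ | ⟨rfl, i, hi, hvi⟩)
    · rw [← h.map j w hw]
      by_cases hjw : σ j w ∈ A
      · exact Or.inl ⟨_, hjw, rfl, hvw.trans (Joined.edge σ hj _)⟩
      · exact Or.inr ⟨(h.eq_iff _).2 hjw, j, hj, hu.eq_of_notMem hw hjw ▸ hvw⟩
    · exact Or.inl ⟨u j, hu.mem j, (h.map_o hσ₁ hu j).symm, hvi.trans (hu.joined hσ hi hj)⟩
  rcases hj.mem hcl (Or.inl ⟨v, hv, rfl, Joined.refl _ _ _⟩) with ⟨w', hw', e, hj'⟩ | ⟨e, -⟩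
  · rwa [← h.inj hw' hw e]
  · exact absurd hw ((h.eq_iff w).1 e)

/-- The pulled-back cocycle is constant outside `A`, so its potential is constant along edges there.
By parity it has equal values at the outer ends of the three cut edges of colours other than `c`;
this common value is assigned to `o`. -/
lemma IsCap.isAcyclic_link [Finite V] (hσ : IsColouring σ) (hσ₁ : IsColouring σ₁)
    (hu : IsCut σ A u) (h : IsCap σ A σ₁ o π) {c : Fin 4} (hq : IsAcyclic (link σ c)) :
    IsAcyclic (link σ₁ c) := by
  classical
  intro g hg
  obtain ⟨F, hF⟩ := hq (fun i v => g i (π v)) fun i j k hij hik hjk v => by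
    rcases h.map_or hσ hσ₁ (c.succAbove k) v with e | e
    · simp only [link, e]
      exact hg i j k hij hik hjk (π v)
    · simp only [link, e]
  have hFout : ∀ i, ∀ v ∉ A, link σ c i v ∉ A → F (link σ c i v) = F v := by
    intro i v hv hv'
    have := hF i (i + 1) (fin3_ne_add_one i) v
    rw [(h.eq_iff _).2 hv, (h.eq_iff _).2 hv'] at this
    exact add_right_cancel this
  have hFw : ∀ i j : Fin 3, F (link σ c j (u (c.succAbove j))) = F (link σ c i (u (c.succAbove i))) := by
    intro i j
    have h1 : σ (c.succAbove j) (u (c.succAbove j)) ∈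
        {v | v ∉ A ∧ F v = F (link σ c i (u (c.succAbove i)))} :=
      hu.mem_of_closed (i := c.succAbove i) hσ (fun v hv => hv.1) ⟨hu.apply_notMem _, rfl⟩
        (fun v hv hv' => ⟨hv', (hFout i v hv.1 hv').trans hv.2⟩)
        fun v hv hv' => ⟨hv', (hFout j v hv.1 hv').trans hv.2⟩
    exact h1.2
  have hex : ∀ z : V₁, ∃ x : ZMod 2, (∀ v ∈ A, π v = z → x = F v) ∧
      (z = o → ∀ i, x = F (link σ c i (u (c.succAbove i)))) := by
    intro z
    by_cases hz : z = o
    · exact ⟨_, fun v hv e => absurd hv ((h.eq_iff v).1 (e.trans hz)), fun _ i => hFw i 0⟩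
    · obtain ⟨v, rfl⟩ := h.surj z
      have hv : v ∈ A := by
        by_contra hv
        exact hz ((h.eq_iff v).2 hv)
      exact ⟨F v, fun w hw e => by rw [h.inj hw hv e], fun e => absurd e hz⟩
  choose F₁ hF₁ hF₁o using hex
  have hin : ∀ i k, i ≠ k → ∀ v ∈ A, F₁ (link σ₁ c i (π v)) + g k (link σ₁ c i (π v)) =
      F₁ (π v) + g k (π v) := by
    intro i k hik v hv
    have e : link σ₁ c i (π v) = π (link σ c i v) := (h.map _ v hv).symm
    rw [e, hF₁ _ v hv rfl, ← hF i k hik v]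
    congr 1
    by_cases hv' : link σ c i v ∈ A
    · exact hF₁ _ _ hv' rfl
    · have e' := hu.eq_of_notMem hv hv'
      rw [hF₁o _ ((h.eq_iff _).2 hv') i, ← e']
  refine ⟨F₁, fun i k hik z => ?_⟩
  by_cases hz : z = o
  · have h1 := h.map_o hσ₁ hu (c.succAbove i)
    have h2 := hin i k hik _ (hu.mem (c.succAbove i))
    have h3 : link σ₁ c i (π (u (c.succAbove i))) = o := by rw [← h1]; exact hσ₁.invol _ _
    have h4 : link σ₁ c i o = π (u (c.succAbove i)) := h1
    rw [h3] at h2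
    rw [hz, h4, h2]
  · obtain ⟨v, rfl⟩ := h.surj z
    have hv : v ∈ A := by
      by_contra hv
      exact hz ((h.eq_iff v).2 hv)
    exact hin i k hik v hv

end Cut

section ConnectedSum

/-! ### Connected sums -/

variable {V V₁ V₂ : Type*} {σ : Fin 4 → V → V} {A : Set V} {u : Fin 4 → V}
  {σ₁ : Fin 4 → V₁ → V₁} {o₁ : V₁} {π₁ : V → V₁} {σ₂ : Fin 4 → V₂ → V₂} {o₂ : V₂} {π₂ : V → V₂}
  {E E₁ E₂ : Type*} [NormedAddCommGroup E] [NormedSpace ℝ E] [NormedAddCommGroup E₁]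
  [NormedSpace ℝ E₁] [NormedAddCommGroup E₂] [NormedSpace ℝ E₂]
  {f : V → (Fin 4 → ℝ) → E} {M : Set E} {f₁ : V₁ → (Fin 4 → ℝ) → E₁} {M₁ : Set E₁}
  {f₂ : V₂ → (Fin 4 → ℝ) → E₂} {M₂ : Set E₂}

lemma IsGemMap.injOn (hf : IsGemMap σ f M) (v : V) : Set.InjOn (f v) Simplex :=
  fun x hx y hy h => ((hf.eq_iff v x hx v y hy).1 h).1

lemma IsGemMap.isPLEmbedding (hf : IsGemMap σ f M) (v : V) : IsPLEmbedding (f v) Simplex M :=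
  ⟨hf.isPLOn v, hf.injOn v, fun x hx => (hf.range _).2 ⟨v, x, hx, rfl⟩⟩

/-- The complement of the open ball at the new vertex of a capped graph. -/
lemma IsCap.diff_image (hσ₁ : IsColouring σ₁) (hu : IsCut σ A u) (h : IsCap σ A σ₁ o₁ π₁)
    (hf₁ : IsGemMap σ₁ f₁ M₁) :
    M₁ \ f₁ o₁ '' simplexInterior = ⋃ v : A, f₁ (π₁ v) '' Simplex := by
  ext y
  simp only [Set.mem_sdiff, Set.mem_iUnion, Set.mem_image]
  constructor
  · rintro ⟨hy, hy'⟩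
    obtain ⟨z, x, hx, rfl⟩ := (hf₁.range y).1 hy
    by_cases hz : z = o₁
    · subst hz
      obtain ⟨c, hc⟩ : ∃ c, x c = 0 := by
        by_contra! hne
        exact hy' ⟨x, ⟨hx, fun i => lt_of_le_of_ne (hx.1 i) (hne i).symm⟩, rfl⟩
      refine ⟨⟨u c, hu.mem c⟩, x, hx, ((hf₁.eq_iff _ _ hx _ _ hx).2 ?_).symm⟩
      rw [← h.map_o hσ₁ hu c]
      exact SamePoint.edge σ₁ _ hc
    · obtain ⟨v, rfl⟩ := h.surj z
      have hv : v ∈ A := by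
        by_contra hv
        exact hz ((h.eq_iff v).2 hv)
      exact ⟨⟨v, hv⟩, x, hx, rfl⟩
  · rintro ⟨v, x, hx, rfl⟩
    refine ⟨(hf₁.range _).2 ⟨_, x, hx, rfl⟩, ?_⟩
    rintro ⟨y, hy, e⟩
    obtain ⟨e1, e2⟩ := (hf₁.eq_iff _ _ hy.1 _ _ hx).1 e
    have : π₁ v = o₁ := e2.apply_eq (f := id) fun i hi => absurd hi (hy.2 i).ne'
    exact (h.eq_iff _).1 this v.2

/-- The complement of the open ball at the new vertex of a capped graph embeds in the complex of the
original graph. -/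
lemma IsCap.exists_embedding [FiniteDimensional ℝ E₁] [Finite V] (hσ : IsColouring σ)
    (hσ₁ : IsColouring σ₁) (hu : IsCut σ A u) (h : IsCap σ A σ₁ o₁ π₁) (hf : IsGemMap σ f M)
    (hf₁ : IsGemMap σ₁ f₁ M₁) :
    ∃ g : E₁ → E, IsPLEmbedding g (M₁ \ f₁ o₁ '' simplexInterior) M ∧
      ∀ v ∈ A, ∀ x ∈ Simplex, g (f₁ (π₁ v) x) = f v x := by
  classical
  obtain hV | hV := isEmpty_or_nonempty V
  · exact absurd (hV.elim (u 0)) id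
  -- `joined_iff` makes the value independent of the representative: capping creates no new
  -- identifications among the simplices of `A`.
  have hex : ∀ z : E₁, ∃ y : E, ∀ v ∈ A, ∀ x ∈ Simplex, f₁ (π₁ v) x = z → y = f v x := by
    intro z
    by_cases hz : ∃ v ∈ A, ∃ x ∈ Simplex, f₁ (π₁ v) x = z
    · obtain ⟨v, hv, x, hx, rfl⟩ := hz
      refine ⟨f v x, fun w hw y hy e => ?_⟩
      obtain ⟨e1, e2⟩ := (hf₁.eq_iff _ _ hy _ _ hx).1 e
      exact ((hf.eq_iff _ _ hy _ _ hx).2 ⟨e1, (h.joined_iff hσ hσ₁ hu hw hv).1 e2⟩).symm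
    · exact ⟨0, fun v hv x hx e => absurd ⟨v, hv, x, hx, e⟩ hz⟩
  choose g hg using hex
  have hg' : ∀ v ∈ A, ∀ x ∈ Simplex, g (f₁ (π₁ v) x) = f v x := fun v hv x hx =>
    hg _ v hv x hx rfl
  refine ⟨g, ?_, hg'⟩
  rw [h.diff_image hσ₁ hu hf₁]
  refine ⟨IsPLOn.iUnion fun v => IsPLOn.of_comp (hf₁.isPLOn _) (hf₁.injOn _) (hf.isPLOn v)
    (hg' v v.2), ?_, ?_⟩
  · intro y hy z hz e
    obtain ⟨v, x, hx, rfl⟩ := Set.mem_iUnion.1 hy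
    obtain ⟨w, x', hx', rfl⟩ := Set.mem_iUnion.1 hz
    rw [hg' v v.2 x hx, hg' w w.2 x' hx'] at e
    obtain ⟨e1, e2⟩ := (hf.eq_iff _ _ hx _ _ hx').1 e
    exact (hf₁.eq_iff _ _ hx _ _ hx').2 ⟨e1, h.joined_map hσ hσ₁ e2⟩
  · intro y hy
    obtain ⟨v, x, hx, rfl⟩ := Set.mem_iUnion.1 hy
    rw [hg' v v.2 x hx]
    exact (hf.range _).2 ⟨v, x, hx, rfl⟩

/-- A complex that is cut by one edge of each colour is the connected sum of the complexes obtained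
by capping the two parts. -/
theorem IsCap.isConnectedSum [FiniteDimensional ℝ E₁] [FiniteDimensional ℝ E₂] [Finite V]
    (hσ : IsColouring σ) (hσ₁ : IsColouring σ₁) (hσ₂ : IsColouring σ₂) (hu : IsCut σ A u)
    (h₁ : IsCap σ A σ₁ o₁ π₁) (h₂ : IsCap σ Aᶜ σ₂ o₂ π₂) (hf : IsGemMap σ f M)
    (hf₁ : IsGemMap σ₁ f₁ M₁) (hf₂ : IsGemMap σ₂ f₂ M₂) : IsConnectedSum M M₁ M₂ := by
  have hu' := hu.compl hσ
  obtain ⟨g₁, hg₁, hgf₁⟩ := h₁.exists_embedding hσ hσ₁ hu hf hf₁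
  obtain ⟨g₂, hg₂, hgf₂⟩ := h₂.exists_embedding hσ hσ₂ hu' hf hf₂
  have ho₁ : ∀ x ∈ Simplex, ∀ c, x c = 0 → g₁ (f₁ o₁ x) = f (u c) x := fun x hx c hc => by
    rw [← hgf₁ _ (hu.mem c) x hx, ← h₁.map_o hσ₁ hu c,
      (hf₁.eq_iff _ _ hx _ _ hx).2 (SamePoint.edge σ₁ o₁ hc)]
  have ho₂ : ∀ x ∈ Simplex, ∀ c, x c = 0 → g₂ (f₂ o₂ x) = f (u c) x := fun x hx c hc => by
    rw [(hf.eq_iff _ _ hx _ _ hx).2 (SamePoint.edge σ (u c) hc), ← hgf₂ _ (hu'.mem c) x hx,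
      ← h₂.map_o hσ₂ hu' c, (hf₂.eq_iff _ _ hx _ _ hx).2 (SamePoint.edge σ₂ o₂ hc)]
  refine ⟨f₁ o₁, f₂ o₂, g₁, g₂, hf₁.isPLEmbedding o₁, hf₂.isPLEmbedding o₂, hg₁, hg₂, ?_, ?_, ?_⟩
  · refine Set.Subset.antisymm (Set.union_subset hg₁.2.2.image_subset hg₂.2.2.image_subset) ?_
    intro y hy
    obtain ⟨v, x, hx, rfl⟩ := (hf.range y).1 hy
    rw [h₁.diff_image hσ₁ hu hf₁, h₂.diff_image hσ₂ hu' hf₂]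
    by_cases hv : v ∈ A
    · exact Or.inl ⟨_, Set.mem_iUnion.2 ⟨⟨v, hv⟩, x, hx, rfl⟩, hgf₁ v hv x hx⟩
    · exact Or.inr ⟨_, Set.mem_iUnion.2 ⟨⟨v, hv⟩, x, hx, rfl⟩, hgf₂ v hv x hx⟩
  · rw [h₁.diff_image hσ₁ hu hf₁, h₂.diff_image hσ₂ hu' hf₂]
    ext y
    constructor
    · rintro ⟨⟨_, hy₁, rfl⟩, _, hy₂, e⟩
      obtain ⟨v, x, hx, rfl⟩ := Set.mem_iUnion.1 hy₁
      obtain ⟨w, x', hx', rfl⟩ := Set.mem_iUnion.1 hy₂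
      rw [hgf₁ v v.2 x hx, hgf₂ w w.2 x' hx'] at e
      obtain ⟨e1, e2⟩ := (hf.eq_iff _ _ hx _ _ hx').1 e.symm
      have e3 := h₁.joined_map hσ hσ₁ e2
      rw [(h₁.eq_iff _).2 w.2] at e3
      refine ⟨f₁ o₁ x, ⟨x, ⟨hx, ?_⟩, rfl⟩, ?_⟩
      -- A point interior to a simplex has a single representative, which cannot lie both in `A` and
      -- outside it.
      · by_contra! hne
        have : (w : V) = v := e2.apply_eq (f := id) fun i hi => absurd hi (hne i)
        exact w.2 (this ▸ v.2)
      · rw [(hf₁.eq_iff (π₁ v) x hx o₁ x hx).2 ⟨rfl, e3⟩]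
    · rintro ⟨_, ⟨x, ⟨hx, c, hc⟩, rfl⟩, rfl⟩
      rw [ho₁ x hx c hc]
      refine ⟨⟨_, Set.mem_iUnion.2 ⟨⟨u c, hu.mem c⟩, x, hx, rfl⟩, hgf₁ _ (hu.mem c) x hx⟩,
        ⟨_, Set.mem_iUnion.2 ⟨⟨σ c (u c), hu'.mem c⟩, x, hx, rfl⟩, ?_⟩⟩
      rw [hgf₂ _ (hu'.mem c) x hx]
      exact ((hf.eq_iff _ _ hx _ _ hx).2 (SamePoint.edge σ (u c) hc)).symm
  · rw [Set.image_image, Set.image_image]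
    refine Set.image_congr ?_
    rintro x ⟨hx, c, hc⟩
    rw [ho₁ x hx c hc, ho₂ x hx c hc]

end ConnectedSum

end Gem

namespace Gem

section Bridge

/-! ### Coloured multigraphs and their realizations -/

variable {α β : Type*} {G : Graph α β} {γ : β → Fin 4}

/-- `σ c v` is the neighbour of `v` along the edge of colour `c`. -/
def IsNeighbourMap (G : Graph α β) (γ : β → Fin 4) (σ : Fin 4 → G.vertexSet → G.vertexSet) : Prop :=
  ∀ c v w, σ c v = w ↔ ∃ e, G.IsLink e v.1 w.1 ∧ γ e = c

lemma IsColouredGraph.exists_inc (hG : IsColouredGraph G γ) {v : α} (hv : v ∈ G.vertexSet)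
    (c : Fin 4) : ∃ e, G.Inc e v ∧ γ e = c := by
  have h1 : (γ '' G.incidenceSet v).ncard = 4 := by
    rw [(hG.injective v hv).ncard_image, hG.regular v hv]
  have h2 : γ '' G.incidenceSet v = Set.univ :=
    Set.eq_of_subset_of_ncard_le (Set.subset_univ _) (by simp [h1, Set.ncard_univ])
  obtain ⟨e, he, hc⟩ := h2 ▸ Set.mem_univ c
  exact ⟨e, he, hc⟩

lemma isColouredGraph_of_exists (hfin : G.vertexSet.Finite) (hloop : ∀ e v, ¬ G.IsLink e v v)
    (hex : ∀ v ∈ G.vertexSet, ∀ c, ∃ e, G.Inc e v ∧ γ e = c)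
    (huniq : ∀ e e' v, G.Inc e v → G.Inc e' v → γ e = γ e' → e = e') : IsColouredGraph G γ := by
  have hinj : ∀ v ∈ G.vertexSet, Set.InjOn γ (G.incidenceSet v) :=
    fun v _ e he e' he' h => huniq e e' v he he' h
  refine ⟨hfin, ⟨hloop⟩, fun v hv => ?_, hinj⟩
  rw [← (hinj v hv).ncard_image]
  have : γ '' G.incidenceSet v = Set.univ := Set.eq_univ_of_forall fun c => hex v hv c
  rw [this, Set.ncard_univ]
  simp

lemma IsColouredGraph.exists_isNeighbourMap (hG : IsColouredGraph G γ) :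
    ∃ σ, IsColouring σ ∧ IsNeighbourMap G γ σ := by
  have hex : ∀ (c : Fin 4) (v : G.vertexSet), ∃ w : G.vertexSet, ∃ e, G.IsLink e v.1 w.1 ∧ γ e = c := by
    intro c v
    obtain ⟨e, ⟨w, hw⟩, hc⟩ := hG.exists_inc v.2 c
    exact ⟨⟨w, hw.right_mem⟩, e, hw, hc⟩
  choose σ hσ using hex
  have hN : IsNeighbourMap G γ σ := by
    intro c v w
    constructor
    · rintro rfl
      exact hσ c v
    · rintro ⟨e, he, hc⟩
      obtain ⟨e', he', hc'⟩ := hσ c v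
      obtain rfl := hG.injective v.1 v.2 he.inc_left he'.inc_left (hc.trans hc'.symm)
      exact Subtype.ext (he'.right_unique he)
  refine ⟨σ, ⟨fun c v => ?_, fun c v h => ?_⟩, hN⟩
  · obtain ⟨e, he, hc⟩ := hσ c v
    exact (hN c _ _).2 ⟨e, he.symm, hc⟩
  · obtain ⟨e, he, hc⟩ := hσ c v
    rw [h] at he
    exact hG.loopless.not_isLoopAt e v.1 he

variable {σ : Fin 4 → G.vertexSet → G.vertexSet}

/-- All identifications keep the barycentric coordinates, so the generated equivalence amounts to
paths with colours in a fixed zero set. -/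
lemma mk_eq_mk_iff (hσ : IsColouring σ) (hN : IsNeighbourMap G γ σ) (v w : G.vertexSet)
    (x y : Simplex) : (Quot.mk (GlueRel G γ) ⟨v, x⟩ = Quot.mk (GlueRel G γ) ⟨w, y⟩) ↔
      SamePoint σ (v, x.1) (w, y.1) := by
  constructor
  · intro h
    have key : ∀ p q : Σ _ : G.vertexSet, Simplex, Relation.EqvGen (GlueRel G γ) p q →
        SamePoint σ (p.1, p.2.1) (q.1, q.2.1) := by
      intro p q hpq
      induction hpq with
      | rel p q h =>
        obtain ⟨h1, e, h2, h3⟩ := h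
        have := (hN (γ e) p.1 q.1).2 ⟨e, h2, rfl⟩
        rw [← h1, ← this]
        exact SamePoint.edge σ p.1 h3
      | refl p => exact SamePoint.refl _ _
      | symm p q _ ih => exact ih.symm hσ
      | trans p q r _ _ ih ih' => exact ih.trans ih'
    exact key _ _ (Quot.eqvGen_exact h)
  · rintro ⟨h1, h2⟩
    obtain rfl : x = y := Subtype.ext h1
    clear h1
    dsimp only at h2
    induction h2 with
    | refl => rfl
    | tail _ h ih =>
      obtain ⟨i, hi, rfl⟩ := h
      refine ih.trans (Quot.sound ⟨rfl, ?_⟩)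
      obtain ⟨e, he, hc⟩ := (hN i _ _).1 rfl
      refine ⟨e, he, ?_⟩
      rw [hc]
      exact hi

lemma IsGem.exists_isGemMap {n : ℕ} {M : Set (EuclideanSpace ℝ (Fin n))} (h : IsGem G γ M)
    (hσ : IsColouring σ) (hN : IsNeighbourMap G γ σ) : ∃ f, IsGemMap σ f M := by
  obtain ⟨-, -, -, φ, hφ⟩ := h
  choose f hf hφf using hφ
  replace hφf : ∀ v x (hx : x ∈ Simplex),
      (φ (Quot.mk (GlueRel G γ) ⟨v, ⟨x, hx⟩⟩) : EuclideanSpace ℝ (Fin n)) = f v x :=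
    fun v x hx => hφf v ⟨x, hx⟩
  refine ⟨f, hf, fun v x hx w y hy => ?_, fun y => ⟨fun hy => ?_, ?_⟩⟩
  · rw [← hφf v x hx, ← hφf w y hy, Subtype.coe_inj, φ.injective.eq_iff,
      mk_eq_mk_iff hσ hN]
  · obtain ⟨z, hz⟩ := φ.surjective ⟨y, hy⟩
    obtain ⟨⟨v, x⟩, rfl⟩ := Quot.exists_rep z
    exact ⟨v, x.1, x.2, by rw [← hφf v x.1 x.2]; exact congrArg Subtype.val hz⟩
  · rintro ⟨v, x, hx, rfl⟩
    rw [← hφf v x hx]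
    exact Subtype.coe_prop _

/-- The induced continuous bijection from a compact space to a Hausdorff space is a homeomorphism.
-/
lemma IsGemMap.isGem {n : ℕ} {M : Set (EuclideanSpace ℝ (Fin n))} (hG : IsColouredGraph G γ)
    (hσ : IsColouring σ) (hN : IsNeighbourMap G γ σ)
    {f : G.vertexSet → (Fin 4 → ℝ) → EuclideanSpace ℝ (Fin n)} (hf : IsGemMap σ f M)
    (hM : IsClosedPLManifold 3 M) (hc : IsConnected M) : IsGem G γ M := by
  refine ⟨hG, hM, hc, ?_⟩
  have : Finite G.vertexSet := hG.finite
  let F : Realization G γ → M := Quot.lift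
    (fun p => ⟨f p.1 p.2.1, (hf.range _).2 ⟨p.1, p.2.1, p.2.2, rfl⟩⟩) fun p q h =>
      Subtype.ext ((hf.eq_iff _ _ p.2.2 _ _ q.2.2).2
        ((mk_eq_mk_iff hσ hN p.1 q.1 p.2 q.2).1 (Quot.sound h)))
  have hFc : Continuous F := by
    refine continuous_quot_lift _ (Continuous.subtype_mk (continuous_sigma fun v => ?_) _)
    exact continuousOn_iff_continuous_domRestrict.1 (hf.isPLOn v).continuousOn
  have hFb : Function.Bijective F := by
    constructor
    · rintro ⟨v, x⟩ ⟨w, y⟩ h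
      exact (mk_eq_mk_iff hσ hN v w x y).2 ((hf.eq_iff _ _ x.2 _ _ y.2).1 (congrArg Subtype.val h))
    · rintro ⟨y, hy⟩
      obtain ⟨v, x, hx, rfl⟩ := (hf.range y).1 hy
      exact ⟨Quot.mk _ ⟨v, x, hx⟩, rfl⟩
  exact ⟨Continuous.homeoOfEquivCompactToT2 (f := Equiv.ofBijective F hFb) hFc, fun v =>
    ⟨f v, hf.isPLOn v, fun x => rfl⟩⟩

/-- A closed set of vertices and its complement would split `M` into two disjoint nonempty closed
pieces. -/
lemma IsGemMap.eq_univ {V E : Type*} [Finite V] [NormedAddCommGroup E] [NormedSpace ℝ E]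
    {σ : Fin 4 → V → V} {f : V → (Fin 4 → ℝ) → E} {M : Set E}
    (hf : IsGemMap σ f M) (hM : IsConnected M) (B : Set V) (hB : ∀ i, ∀ v ∈ B, σ i v ∈ B)
    (hne : B.Nonempty) : B = Set.univ := by
  by_contra hB'
  obtain ⟨w, hw⟩ := (Set.ne_univ_iff_exists_notMem B).1 hB'
  obtain ⟨v, hv⟩ := hne
  have hx : (Pi.single 0 1 : Fin 4 → ℝ) ∈ Simplex := single_mem_stdSimplex ℝ 0
  have hcl : ∀ A : Set V, IsClosed (⋃ w ∈ A, f w '' (Simplex ∩ Set.univ)) := fun A =>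
    (hf.isCompact_image A isClosed_univ).isClosed
  have hmem : ∀ (A : Set V), ∀ v ∈ A, ∀ x ∈ Simplex,
      f v x ∈ ⋃ w ∈ A, f w '' (Simplex ∩ Set.univ) := fun A v hv x hx =>
    Set.mem_biUnion (x := v) hv ⟨x, ⟨hx, trivial⟩, rfl⟩
  obtain ⟨z, -, hz₁, hz₂⟩ := isPreconnected_closed_iff.1 hM.isPreconnected _ _ (hcl B) (hcl Bᶜ)
    (fun y hy => by
      obtain ⟨v, x, hx, rfl⟩ := (hf.range y).1 hy
      by_cases hv : v ∈ B
      · exact Or.inl (hmem B v hv x hx)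
      · exact Or.inr (hmem Bᶜ v hv x hx))
    ⟨f v _, (hf.range _).2 ⟨v, _, hx, rfl⟩, hmem B v hv _ hx⟩
    ⟨f w _, (hf.range _).2 ⟨w, _, hx, rfl⟩, hmem Bᶜ w hw _ hx⟩
  simp only [Set.mem_iUnion, Set.mem_image] at hz₁ hz₂
  obtain ⟨v, hv, x, hx, rfl⟩ := hz₁
  obtain ⟨w, hw, y, hy, e⟩ := hz₂
  exact hw (((hf.eq_iff _ _ hx.1 _ _ hy.1).1 e.symm).2.mem (fun i _ v hv => hB i v hv) hv)

end Bridge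

section CapGraph

/-! ### The capped graphs -/

variable {α β : Type*} {G H : Graph α β} {γ : β → Fin 4} {σ : Fin 4 → G.vertexSet → G.vertexSet}
  {A : Set G.vertexSet} {u : Fin 4 → G.vertexSet}

/-- The hypotheses say that `H` is the subgraph of `G` induced on `A`, so the colour `j` is missing
exactly where its edge leaves `A`. -/
lemma IsCut.isBoundaryVertex_iff (hN : IsNeighbourMap G γ σ) (hu : IsCut σ A u)
    (hA : ∀ v : G.vertexSet, v ∈ A ↔ v.1 ∈ H.vertexSet) (hV : H.vertexSet ⊆ G.vertexSet)
    (hL : ∀ e x y, H.IsLink e x y ↔ G.IsLink e x y ∧ x ∈ H.vertexSet ∧ y ∈ H.vertexSet)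
    (j : Fin 4) (v : α) : IsBoundaryVertex H γ j v ↔ v = (u j).1 := by
  have hb : ∀ w, (w ∈ H.vertexSet ∧ ∀ e, H.Inc e w → γ e ≠ j) ↔ w = (u j).1 := by
    intro w
    constructor
    · rintro ⟨hw, hwe⟩
      have hwA : (⟨w, hV hw⟩ : G.vertexSet) ∈ A := (hA _).2 hw
      refine congrArg Subtype.val (hu.eq_of_notMem (c := j) hwA fun hj => ?_)
      obtain ⟨e, he, hc⟩ := (hN j ⟨w, hV hw⟩ _).1 rfl
      exact hwe e ⟨_, (hL e _ _).2 ⟨he, hw, (hA _).1 hj⟩⟩ hc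
    · rintro rfl
      refine ⟨(hA _).1 (hu.mem j), ?_⟩
      rintro e ⟨y, hy⟩ hc
      obtain ⟨h1, -, h2⟩ := (hL e _ _).1 hy
      have := (hN j (u j) ⟨y, hV h2⟩).2 ⟨e, h1, hc⟩
      exact hu.apply_notMem j (this ▸ (hA _).2 h2)
  constructor
  · intro h
    exact (hb v).1 ((h v).2 rfl)
  · rintro rfl
    exact hb

lemma isLink_cap_inl {e : β} {x y : Option α} : (cap H γ).IsLink (Sum.inl e) x y ↔
    ∃ u w, H.IsLink e u w ∧ x = some u ∧ y = some w := Iff.rfl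

lemma isLink_cap_inr {j : Fin 4} {x y : Option α} : (cap H γ).IsLink (Sum.inr j) x y ↔
    ∃ v, IsBoundaryVertex H γ j v ∧ (x = none ∧ y = some v ∨ x = some v ∧ y = none) := Iff.rfl

/-- Capping the part `H` of a coloured graph cut off by one edge of each colour produces a coloured
graph. -/
lemma IsCut.isColouredGraph_cap (hG : IsColouredGraph G γ) (hN : IsNeighbourMap G γ σ)
    (hu : IsCut σ A u) (hA : ∀ v : G.vertexSet, v ∈ A ↔ v.1 ∈ H.vertexSet)
    (hV : H.vertexSet ⊆ G.vertexSet)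
    (hL : ∀ e x y, H.IsLink e x y ↔ G.IsLink e x y ∧ x ∈ H.vertexSet ∧ y ∈ H.vertexSet) :
    IsColouredGraph (cap H γ) (capColour γ) := by
  have hb := hu.isBoundaryVertex_iff hN hA hV hL
  refine isColouredGraph_of_exists (((hG.finite.subset hV).image _).insert _) ?_ ?_ ?_
  · rintro (e | j) x h
    · obtain ⟨v, w, h, rfl, h'⟩ := isLink_cap_inl.1 h
      obtain rfl := Option.some_injective _ h'
      exact hG.loopless.not_isLoopAt e v ((hL _ _ _).1 h).1
    · obtain ⟨v, -, ⟨rfl, h⟩ | ⟨rfl, h⟩⟩ := isLink_cap_inr.1 h <;> simp at h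
  · rintro _ (rfl | ⟨v, hv, rfl⟩) c
    · exact ⟨Sum.inr c, ⟨some (u c).1, isLink_cap_inr.2 ⟨_, (hb c _).2 rfl, Or.inl ⟨rfl, rfl⟩⟩⟩, rfl⟩
    · by_cases hvu : v = (u c).1
      · exact ⟨Sum.inr c, ⟨none, isLink_cap_inr.2 ⟨_, (hb c _).2 rfl, Or.inr ⟨congrArg _ hvu, rfl⟩⟩⟩,
          rfl⟩
      · obtain ⟨e, he, hc⟩ := (hN c ⟨v, hV hv⟩ _).1 rfl
        have h1 := (hu.apply_mem_iff c ⟨v, hV hv⟩ ((hA _).2 hv)).2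
          fun h => hvu (congrArg Subtype.val h)
        exact ⟨Sum.inl e, ⟨_, isLink_cap_inl.2 ⟨_, _, (hL _ _ _).2 ⟨he, hv, (hA _).1 h1⟩, rfl, rfl⟩⟩,
          hc⟩
  · have hbd : ∀ e j v, H.Inc e v → IsBoundaryVertex H γ j v → γ e ≠ j := fun e j v h h' =>
      ((h' v).2 rfl).2 e h
    rintro (e | j) (e' | j') x ⟨y, hy⟩ ⟨y', hy'⟩ hc
    · obtain ⟨v, w, h, rfl, -⟩ := isLink_cap_inl.1 hy
      obtain ⟨v', w', h', e', -⟩ := isLink_cap_inl.1 hy'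
      obtain rfl := Option.some_injective _ e'
      have h1 := ((hL _ _ _).1 h).1
      exact congrArg _ (hG.injective v h1.left_mem h1.inc_left ((hL _ _ _).1 h').1.inc_left hc)
    · obtain ⟨v, w, h, rfl, -⟩ := isLink_cap_inl.1 hy
      obtain ⟨v', h', ⟨e', -⟩ | ⟨e', -⟩⟩ := isLink_cap_inr.1 hy'
      · simp at e'
      · obtain rfl := Option.some_injective _ e'
        exact absurd hc (hbd e j' v h.inc_left h')
    · obtain ⟨v, w, h, rfl, -⟩ := isLink_cap_inl.1 hy'
      obtain ⟨v', h', ⟨e', -⟩ | ⟨e', -⟩⟩ := isLink_cap_inr.1 hy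
      · simp at e'
      · obtain rfl := Option.some_injective _ e'
        exact absurd hc.symm (hbd _ j v h.inc_left h')
    · exact congrArg _ hc

lemma IsCut.exists_isCap (hN : IsNeighbourMap G γ σ) (hu : IsCut σ A u)
    (hA : ∀ v : G.vertexSet, v ∈ A ↔ v.1 ∈ H.vertexSet) (hV : H.vertexSet ⊆ G.vertexSet)
    (hL : ∀ e x y, H.IsLink e x y ↔ G.IsLink e x y ∧ x ∈ H.vertexSet ∧ y ∈ H.vertexSet)
    {σ₁ : Fin 4 → (cap H γ).vertexSet → (cap H γ).vertexSet}
    (hN₁ : IsNeighbourMap (cap H γ) (capColour γ) σ₁) : ∃ o π, IsCap σ A σ₁ o π := by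
  classical
  have hb := hu.isBoundaryVertex_iff hN hA hV hL
  let o : (cap H γ).vertexSet := ⟨none, Or.inl rfl⟩
  let π : G.vertexSet → (cap H γ).vertexSet := fun v =>
    if h : v ∈ A then ⟨some v.1, Or.inr ⟨v.1, (hA v).1 h, rfl⟩⟩ else o
  have hin : ∀ v ∈ A, (π v).1 = some v.1 := fun v hv => by simp only [π, dif_pos hv]
  have hout : ∀ v ∉ A, π v = o := fun v hv => dif_neg hv
  refine ⟨o, π, fun v => ⟨fun h hv => ?_, hout v⟩, fun v hv w hw h => ?_, ?_, fun c v hv => ?_⟩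
  · have := hin v hv
    rw [h] at this
    simp [o] at this
  · have := congrArg Subtype.val h
    rw [hin v hv, hin w hw] at this
    exact Subtype.ext (Option.some_injective _ this)
  · rintro ⟨_, rfl | ⟨v, hv, rfl⟩⟩
    · exact ⟨_, hout _ (hu.apply_notMem 0)⟩
    · exact ⟨⟨v, hV hv⟩, Subtype.ext (hin _ ((hA _).2 hv))⟩
  · refine ((hN₁ c _ _).2 ?_).symm
    rw [hin v hv]
    by_cases hcv : σ c v ∈ A
    · obtain ⟨e, he, hc⟩ := (hN c v _).1 rfl
      exact ⟨Sum.inl e, isLink_cap_inl.2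
        ⟨_, _, (hL _ _ _).2 ⟨he, (hA _).1 hv, (hA _).1 hcv⟩, rfl, hin _ hcv⟩, hc⟩
    · have := hu.eq_of_notMem hv hcv
      exact ⟨Sum.inr c, isLink_cap_inr.2 ⟨_, (hb c _).2 rfl, Or.inr ⟨by rw [this],
        by rw [hout _ hcv]⟩⟩, rfl⟩

/-- Capping a part of a gem that is cut off by one edge of each colour produces a gem. -/
lemma IsCut.exists_isGem_cap {n : ℕ} {M : Set (EuclideanSpace ℝ (Fin n))} (hM : IsGem G γ M)
    (hσ : IsColouring σ) (hN : IsNeighbourMap G γ σ)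
    (hu : IsCut σ A u) (hA : ∀ v : G.vertexSet, v ∈ A ↔ v.1 ∈ H.vertexSet)
    (hV : H.vertexSet ⊆ G.vertexSet)
    (hL : ∀ e x y, H.IsLink e x y ↔ G.IsLink e x y ∧ x ∈ H.vertexSet ∧ y ∈ H.vertexSet) :
    ∃ (n₁ : ℕ) (M₁ : Set (EuclideanSpace ℝ (Fin n₁))), IsGem (cap H γ) (capColour γ) M₁ := by
  have hG₁ := hu.isColouredGraph_cap hM.1 hN hA hV hL
  obtain ⟨σ₁, hσ₁, hN₁⟩ := hG₁.exists_isNeighbourMap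
  obtain ⟨o, π, hπ⟩ := hu.exists_isCap hN hA hV hL hN₁
  have : Finite G.vertexSet := hM.1.finite
  have : Finite (cap H γ).vertexSet := hG₁.finite
  have := Fintype.ofFinite (cap H γ).vertexSet
  obtain ⟨f, hf⟩ := hM.exists_isGemMap hσ hN
  -- The capped complex is realized afresh in some Euclidean space; nothing is inherited from the
  -- position of `M`.
  obtain ⟨N, f₁, M₁, hf₁⟩ := exists_isGemMap hσ₁
  refine ⟨N, M₁, hf₁.isGem hG₁ hσ₁ hN₁ (hf₁.isClosedPLManifold hσ₁ fun c =>
    hπ.isAcyclic_link hσ hσ₁ hu (hf.isAcyclic_link hσ hM.2.1 c)) (hf₁.isConnected o fun z w => ?_)⟩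
  obtain ⟨v, rfl⟩ := hπ.surj z
  obtain ⟨w, rfl⟩ := hπ.surj w
  refine hπ.joined_map hσ hσ₁ ?_
  have := hf.eq_univ hM.2.2.1 {w | Joined σ Set.univ v w}
    (fun i w hw => Joined.trans hw (Joined.edge σ (Set.mem_univ i) w)) ⟨v, Joined.refl _ _ _⟩
  exact (Set.ext_iff.1 this w).2 (Set.mem_univ w)

end CapGraph

end Gem

namespace Gem

section Components

/-! ### The two components -/

variable {α β : Type*} {G : Graph α β} {γ : β → Fin 4} {σ : Fin 4 → G.vertexSet → G.vertexSet}

lemma reflTransGen_adj_symm {D : Graph α β} {v w : α} (h : Relation.ReflTransGen D.Adj v w) :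
    Relation.ReflTransGen D.Adj w v := by
  induction h with
  | refl => exact Relation.ReflTransGen.refl
  | tail _ h ih => exact ih.head h.symm

/-- The vertex set of one of two components obtained by deleting one edge of each colour is a cut,
and the components are the induced subgraphs. -/
lemma exists_isCut_of_components [Finite G.vertexSet] (hσ : IsColouring σ)
    (hN : IsNeighbourMap G γ σ)
    (hconn : ∀ B : Set G.vertexSet, (∀ i, ∀ v ∈ B, σ i v ∈ B) → B.Nonempty → B = Set.univ)
    {e : Fin 4 → β} (he : ∀ i, e i ∈ G.edgeSet) (hcol : ∀ i, γ (e i) = i) {H₁ H₂ : Graph α β}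
    (hne : H₁ ≠ H₂) (hcomp : {H | IsComponent H (G.deleteEdges (Set.range e))} = {H₁, H₂}) :
    ∃ A u, IsCut σ A u ∧ (∀ v : G.vertexSet, v ∈ A ↔ v.1 ∈ H₁.vertexSet) ∧
      (∀ v : G.vertexSet, v ∈ Aᶜ ↔ v.1 ∈ H₂.vertexSet) ∧
      H₁.vertexSet ⊆ G.vertexSet ∧ H₂.vertexSet ⊆ G.vertexSet ∧
      (∀ f x y, H₁.IsLink f x y ↔ G.IsLink f x y ∧ x ∈ H₁.vertexSet ∧ y ∈ H₁.vertexSet) ∧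
      ∀ f x y, H₂.IsLink f x y ↔ G.IsLink f x y ∧ x ∈ H₂.vertexSet ∧ y ∈ H₂.vertexSet := by
  set D := G.deleteEdges (Set.range e) with hD
  have hDV : D.vertexSet = G.vertexSet := Graph.vertexSet_deleteEdges ..
  have hDL : ∀ f x y, D.IsLink f x y ↔ G.IsLink f x y ∧ f ∉ Set.range e := fun f x y =>
    iff_of_eq (Graph.deleteEdges_isLink ..)
  obtain ⟨v₁, hv₁, h₁⟩ : IsComponent H₁ D := (Set.ext_iff.1 hcomp H₁).2 (Or.inl rfl)
  obtain ⟨v₂, hv₂, h₂⟩ : IsComponent H₂ D := (Set.ext_iff.1 hcomp H₂).2 (Or.inr rfl)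
  have hm₁ : ∀ w, w ∈ H₁.vertexSet ↔ Relation.ReflTransGen D.Adj v₁ w := fun w => by
    rw [h₁]; rfl
  have hm₂ : ∀ w, w ∈ H₂.vertexSet ↔ Relation.ReflTransGen D.Adj v₂ w := fun w => by
    rw [h₂]; rfl
  have hsub : ∀ {v w : α}, v ∈ D.vertexSet → Relation.ReflTransGen D.Adj v w →
      w ∈ G.vertexSet := fun hv h => by
    rw [← hDV]
    induction h with
    | refl => exact hv
    | tail _ h _ => exact h.right_mem
  have hdis : ∀ w, w ∈ H₁.vertexSet → w ∉ H₂.vertexSet := fun w hw₁ hw₂ => hne (by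
    rw [hm₁] at hw₁
    rw [hm₂] at hw₂
    rw [h₁, h₂]
    congr 1
    ext z
    exact ⟨fun h => hw₂.trans ((reflTransGen_adj_symm hw₁).trans h),
      fun h => hw₁.trans ((reflTransGen_adj_symm hw₂).trans h)⟩)
  have hcov : ∀ w ∈ G.vertexSet, w ∈ H₁.vertexSet ∨ w ∈ H₂.vertexSet := fun w hw => by
    have h : D.induce {z | Relation.ReflTransGen D.Adj w z} ∈ ({H₁, H₂} : Set (Graph α β)) :=
      hcomp ▸ ⟨w, hDV ▸ hw, rfl⟩
    have hw' : w ∈ (D.induce {z | Relation.ReflTransGen D.Adj w z}).vertexSet :=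
      Relation.ReflTransGen.refl
    rcases h with h | h <;> rw [h] at hw'
    · exact Or.inl hw'
    · exact Or.inr hw'
  have hcross : ∀ c, ∀ v : G.vertexSet, v.1 ∈ H₁.vertexSet → (σ c v).1 ∉ H₁.vertexSet →
      G.IsLink (e c) v.1 (σ c v).1 := by
    intro c v hv hv'
    obtain ⟨f, hf, hc⟩ := (hN c v _).1 rfl
    by_cases hfe : f ∈ Set.range e
    · obtain ⟨i, rfl⟩ := hfe
      rw [hcol] at hc
      exact hc ▸ hf
    · refine absurd ?_ hv'
      rw [hm₁] at hv ⊢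
      exact hv.tail ⟨f, (hDL _ _ _).2 ⟨hf, hfe⟩⟩
  choose a b hab using fun c => Graph.exists_isLink_of_mem_edgeSet (he c)
  have hab' : ∀ c, σ c ⟨a c, (hab c).left_mem⟩ = ⟨b c, (hab c).right_mem⟩ := fun c =>
    (hN c _ _).2 ⟨e c, hab c, hcol c⟩
  obtain ⟨u, hu⟩ := exists_isCut (A := {v | v.1 ∈ H₁.vertexSet}) hσ hconn
    ⟨⟨v₁, hDV ▸ hv₁⟩, (hm₁ _).2 Relation.ReflTransGen.refl⟩
    (fun h => hdis v₂ ((Set.ext_iff.1 h ⟨v₂, hDV ▸ hv₂⟩).2 trivial)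
      ((hm₂ _).2 Relation.ReflTransGen.refl))
    (a := fun c => ⟨a c, (hab c).left_mem⟩) fun c v hv hv' => by
      rcases (hcross c v hv hv').left_eq_or_eq (hab c) with h | h
      · exact Or.inl (Subtype.ext h)
      · right
        rw [hab']
        exact Subtype.ext h
  have hA₂ : ∀ v : G.vertexSet, v ∈ {v : G.vertexSet | v.1 ∈ H₁.vertexSet}ᶜ ↔ v.1 ∈ H₂.vertexSet :=
    fun v => ⟨fun h => (hcov v v.2).resolve_left h, fun h h' => hdis _ h' h⟩
  have hends : ∀ c, G.IsLink (e c) (u c).1 (σ c (u c)).1 := fun c =>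
    hcross c _ (hu.mem c) (hu.apply_notMem c)
  refine ⟨_, u, hu, fun v => Iff.rfl, hA₂, fun w hw => hsub hv₁ ((hm₁ w).1 hw),
    fun w hw => hsub hv₂ ((hm₂ w).1 hw), fun f x y => ?_, fun f x y => ?_⟩
  · have hl : H₁.IsLink f x y ↔ D.IsLink f x y ∧ x ∈ H₁.vertexSet ∧ y ∈ H₁.vertexSet := by
      rw [h₁]; exact Iff.rfl
    rw [hl, hDL]
    refine ⟨fun h => ⟨h.1.1, h.2⟩, fun h => ⟨⟨h.1, ?_⟩, h.2⟩⟩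
    rintro ⟨c, rfl⟩
    -- A deleted edge has one end outside `H₁`, so no deleted edge is missing from the induced
    -- subgraph and `H₁` is induced in `G` itself.
    rcases (hends c).right_eq_or_eq h.1 with e' | e'
    · exact hu.apply_notMem c (e' ▸ h.2.1 : (σ c (u c)).1 ∈ H₁.vertexSet)
    · exact hu.apply_notMem c (e' ▸ h.2.2 : (σ c (u c)).1 ∈ H₁.vertexSet)
  · have hl : H₂.IsLink f x y ↔ D.IsLink f x y ∧ x ∈ H₂.vertexSet ∧ y ∈ H₂.vertexSet := by
      rw [h₂]; exact Iff.rfl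
    rw [hl, hDL]
    refine ⟨fun h => ⟨h.1.1, h.2⟩, fun h => ⟨⟨h.1, ?_⟩, h.2⟩⟩
    rintro ⟨c, rfl⟩
    rcases (hends c).left_eq_or_eq h.1 with e' | e'
    · exact hdis _ (hu.mem c) (e' ▸ h.2.1)
    · exact hdis _ (hu.mem c) (e' ▸ h.2.2)

end Components

end Gem

theorem mainTheorem8 {α β : Type*} (G : Graph α β) (γ : β → Fin 4)
    {n : ℕ} (M : Set (EuclideanSpace ℝ (Fin n))) (hM : Gem.IsGem G γ M)
    (e : Fin 4 → β) (he : ∀ i, e i ∈ G.edgeSet) (hcol : ∀ i, γ (e i) = i)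
    (H₁ H₂ : Graph α β) (hne : H₁ ≠ H₂)
    (hcomp : {H | Gem.IsComponent H (G.deleteEdges (Set.range e))} = {H₁, H₂}) :
    (∃ (n₁ : ℕ) (M₁ : Set (EuclideanSpace ℝ (Fin n₁))),
      Gem.IsGem (Gem.cap H₁ γ) (Gem.capColour γ) M₁) ∧
    (∃ (n₂ : ℕ) (M₂ : Set (EuclideanSpace ℝ (Fin n₂))),
      Gem.IsGem (Gem.cap H₂ γ) (Gem.capColour γ) M₂) ∧
    ∀ (n₁ n₂ : ℕ) (M₁ : Set (EuclideanSpace ℝ (Fin n₁))) (M₂ : Set (EuclideanSpace ℝ (Fin n₂))),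
      Gem.IsGem (Gem.cap H₁ γ) (Gem.capColour γ) M₁ →
      Gem.IsGem (Gem.cap H₂ γ) (Gem.capColour γ) M₂ →
      Gem.IsConnectedSum M M₁ M₂ := by
  have hfin : Finite G.vertexSet := hM.1.finite
  obtain ⟨σ, hσ, hN⟩ := hM.1.exists_isNeighbourMap
  obtain ⟨f, hf⟩ := hM.exists_isGemMap hσ hN
  obtain ⟨A, u, hu, hA₁, hA₂, hV₁, hV₂, hL₁, hL₂⟩ := Gem.exists_isCut_of_components hσ hN
    (hf.eq_univ hM.2.2.1) he hcol hne hcomp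
  have hu' := hu.compl hσ
  refine ⟨hu.exists_isGem_cap hM hσ hN hA₁ hV₁ hL₁, hu'.exists_isGem_cap hM hσ hN hA₂ hV₂ hL₂,
    fun n₁ n₂ M₁ M₂ hM₁ hM₂ => ?_⟩
  obtain ⟨σ₁, hσ₁, hN₁⟩ := hM₁.1.exists_isNeighbourMap
  obtain ⟨σ₂, hσ₂, hN₂⟩ := hM₂.1.exists_isNeighbourMap
  obtain ⟨o₁, π₁, hπ₁⟩ := hu.exists_isCap hN hA₁ hV₁ hL₁ hN₁
  obtain ⟨o₂, π₂, hπ₂⟩ := hu'.exists_isCap hN hA₂ hV₂ hL₂ hN₂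
  obtain ⟨f₁, hf₁⟩ := hM₁.exists_isGemMap hσ₁ hN₁
  obtain ⟨f₂, hf₂⟩ := hM₂.exists_isGemMap hσ₂ hN₂
  exact hπ₁.isConnectedSum hσ hσ₁ hσ₂ hu hπ₂ hf hf₁ hf₂
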